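/- Let $M$ be a real-analytic manifold of dimension $2n+1$ and let $H\subset \mathbb C TM$ be a real-analytic, 2-nondegenerate CR structure of hypersurface type on $M$: $H$ is a complex distribution of rank $n$ with $[H,H]\subset H$ and $H\cap\overline H=0$. Let $K\subset H$ be the kernel of the Levi form $\mathcal L(X_p,Y_p)=\frac i2[X,\overline Y]_p \bmod H_p\oplus\overline H_p$, and for $v\in\overline K_p$ let $\mathrm{ad}_v:H_p/K_p\to\overline H_p/\overline K_p$ be the linear map $Y_p\mapsto[V,Y]_p \bmod H_p\oplus\overline K_p$, where $V\in\Gamma(\overline K)$, $V_p=v$, $Y\in\Gamma(H)$. Put $\mathrm{ad}\,\overline K_p=\{\mathrm{ad}_v : v\in\overline K_p\}$. (2-nondegeneracy means that $K_p\neq 0$ and $\mathrm{ad}_v\ne0$ for all $p\in M$ and all nonzero $v\in\overline K_p$.) Near a point of $M$, let $\mathbb CM$ be a (small) complexification of $M$ with conjugation $\tau$, let $H,K$ also denote the holomorphic extensions to $\mathbb CM$, put $\overline H=\tau_*H$, $\overline K=\tau_*K$, and let $\pi:\mathbb CM\to\mathcal N$ be the projection onto the space of leaves of the foliation tangent to $K\oplus\overline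 K$. The dynamical Legendrian contact structure associated with the germ of $H$ is the distribution $\mathcal D=\pi_*(H\oplus\overline H)$ on $\mathcal N$, together with the families $J^-_\gamma=\{\pi_*H_q : q\in\pi^{-1}(\gamma)\}$ and $J^+_\gamma=\{\pi_*\overline H_q : q\in\pi^{-1}(\gamma)\}$ of subspaces of $\mathcal D_\gamma$, $\gamma\in\mathcal N$, and the involution induced by $\tau$ on $\mathcal N$. The map $F(q)=(\pi_*H_q,\pi_*\overline H_q)$ identifies $\mathbb CM$ locally with the bundle $J^-\times J^+$ over $\mathcal N$. The CR structure $H$ is called recoverable if each of its germs is uniquely determined by the associated dynamical Legendrian contact structure: whenever the germ at a point $p'$ of a real-analytic 2-nondegenerate hypersurface-type CR structure $H'$, with Levi kernel of constant rank, has the same dynamical Legendrian contact structure as the germ of $H$ at $p$, and $F'(p')=F(p)$, the distributions $F_*H$ and $F'_*H'$ on $J^-\times J^+$ coincide near $F(p)$. Assume that $\mathrm{rank}\,K=1$ everywhere on $M$. Then $H$ is recoverable if and only if, for a generic $p\in M$ (that is, for all $p$ in some open dense subset of $M$), the space $\mathrm{ad}\,\overline K_p$ is generated by an operator of rank greater than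 $1$. -/

import Mathlib

open scoped Manifold ContDiff TensorProduct Topology

universe u

noncomputable section

namespace LeviCR

/-! ## Complexification of a real vector space -/

section Complexification

variable {V : Type*} [AddCommGroup V] [Module ℝ V]

/-- Real part `ℂ ⊗ V → V`. -/
def tRe : ℂ ⊗[ℝ] V →ₗ[ℝ] V :=
  (TensorProduct.lid ℝ V).toLinearMap ∘ₗ LinearMap.rTensor V Complex.reLm

/-- Imaginary part `ℂ ⊗ V → V`. -/
def tIm : ℂ ⊗[ℝ] V →ₗ[ℝ] V :=
  (TensorProduct.lid ℝ V).toLinearMap ∘ₗ LinearMap.rTensor V Complex.imLm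

/-- The element `a + i b` of `ℂ ⊗ V`. -/
def tMk (a b : V) : ℂ ⊗[ℝ] V := (1 : ℂ) ⊗ₜ[ℝ] a + Complex.I ⊗ₜ[ℝ] b

/-- Complex conjugation on `ℂ ⊗ V`. -/
def tConj : ℂ ⊗[ℝ] V →ₗ[ℝ] ℂ ⊗[ℝ] V := LinearMap.rTensor V Complex.conjAe.toLinearMap

lemma tConj_smul (c : ℂ) (x : ℂ ⊗[ℝ] V) : tConj (c • x) = (starRingEnd ℂ) c • tConj x := by
  induction x with
  | zero => simp
  | tmul z v => simp [tConj, TensorProduct.smul_tmul']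
  | add x y hx hy => simp [smul_add, hx, hy]

lemma tRe_smul (c : ℂ) (x : ℂ ⊗[ℝ] V) : tRe (c • x) = c.re • tRe x - c.im • tIm x := by
  induction x with
  | zero => simp
  | tmul z v => simp [tRe, tIm, TensorProduct.smul_tmul', sub_smul, mul_smul]
  | add x y hx hy => rw [smul_add, map_add, hx, hy, map_add, map_add]; module

lemma tIm_smul (c : ℂ) (x : ℂ ⊗[ℝ] V) : tIm (c • x) = c.re • tIm x + c.im • tRe x := by
  induction x with
  | zero => simp
  | tmul z v => simp [tRe, tIm, TensorProduct.smul_tmul', add_smul, mul_smul]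
  | add x y hx hy => rw [smul_add, map_add, hx, hy, map_add, map_add]; module

lemma tMk_add (a b a' b' : V) : tMk (a + a') (b + b') = tMk a b + tMk a' b' := by
  simp only [tMk, TensorProduct.tmul_add]; abel

lemma tMk_zero : tMk (0 : V) 0 = 0 := by simp [tMk]

lemma smul_tMk (c : ℂ) (a b : V) :
    c • tMk a b = tMk (c.re • a - c.im • b) (c.re • b + c.im • a) := by
  have h : ∀ (z : ℂ) (v : V), z ⊗ₜ[ℝ] v = (1 : ℂ) ⊗ₜ[ℝ] (z.re • v) + Complex.I ⊗ₜ[ℝ] (z.im • v) := by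
    intro z v
    rw [← TensorProduct.smul_tmul, ← TensorProduct.smul_tmul, ← TensorProduct.add_tmul]
    congr 1
    apply Complex.ext <;> simp
  simp only [tMk, smul_add, TensorProduct.smul_tmul', smul_eq_mul, mul_one]
  rw [h c a, h (c * Complex.I) b]
  simp only [TensorProduct.tmul_add, TensorProduct.tmul_sub, Complex.mul_re, Complex.mul_im,
    Complex.I_re, Complex.I_im, mul_zero, mul_one, zero_sub, add_zero, neg_smul,
    TensorProduct.tmul_neg]
  abel

/-- The conjugate `S̄` of a complex subspace `S ⊆ ℂ ⊗ V`. -/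
def barSub (S : Submodule ℂ (ℂ ⊗[ℝ] V)) : Submodule ℂ (ℂ ⊗[ℝ] V) where
  carrier := {x | tConj x ∈ S}
  zero_mem' := by simp
  add_mem' := by
    intro a b ha hb
    simp only [Set.mem_ofPred_eq, map_add] at *
    exact S.add_mem ha hb
  smul_mem' := by
    intro c x hx
    simp only [Set.mem_ofPred_eq, tConj_smul] at *
    exact S.smul_mem _ hx

end Complexification

/-! ## Complex vector fields and CR structures on a real-analytic manifold -/

section CR

/-- The model space of a real `d`-dimensional manifold. -/
abbrev RSpace (d : ℕ) : Type := EuclideanSpace ℝ (Fin d)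

variable {d : ℕ} {M : Type*} [TopologicalSpace M] [ChartedSpace (RSpace d) M]
  [IsManifold (𝓡 d) ω M]

variable (d) in
/-- The complexified tangent space `ℂ T_p M`. -/
abbrev CTangent (p : M) : Type := ℂ ⊗[ℝ] TangentSpace (𝓡 d) p

variable (d M) in
/-- A (not necessarily continuous) section of `ℂ T M`. -/
abbrev CField : Type _ := (p : M) → CTangent d p

variable (d M) in
/-- A field of complex subspaces of `ℂ T M`. -/
abbrev CDist : Type _ := (p : M) → Submodule ℂ (CTangent d p)

/-- The conjugate field of subspaces. -/
def barDist (H : CDist d M) : CDist d M := fun p => barSub (H p)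

/-- The conjugate vector field. -/
def barField (X : CField d M) : CField d M := fun p => tConj (X p)

/-- `X` is of class `C^m` in a neighbourhood of `p` (`m = ∞`: smooth; `m = ω`: real-analytic). -/
def RegularNear (m : WithTop ℕ∞) (X : CField d M) (p : M) : Prop :=
  ∀ᶠ q in 𝓝 p,
    ContMDiffAt (𝓡 d) (𝓡 d).tangent m
      (fun y => (⟨y, tRe (X y)⟩ : TangentBundle (𝓡 d) M)) q ∧
    ContMDiffAt (𝓡 d) (𝓡 d).tangent m
      (fun y => (⟨y, tIm (X y)⟩ : TangentBundle (𝓡 d) M)) q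

/-- `X` is a smooth section of `H` defined in a neighbourhood of `p`. -/
def IsSectionNear (H : CDist d M) (X : CField d M) (p : M) : Prop :=
  RegularNear ∞ X p ∧ ∀ᶠ q in 𝓝 p, X q ∈ H q

/-- The complex-bilinear extension of the Lie bracket to sections of `ℂ T M`. -/
def cBracket (X Y : CField d M) (p : M) : CTangent d p :=
  tMk
    (VectorField.mlieBracket (𝓡 d) (fun q => tRe (X q)) (fun q => tRe (Y q)) p
      - VectorField.mlieBracket (𝓡 d) (fun q => tIm (X q)) (fun q => tIm (Y q)) p)
    (VectorField.mlieBracket (𝓡 d) (fun q => tRe (X q)) (fun q => tIm (Y q)) p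
      + VectorField.mlieBracket (𝓡 d) (fun q => tIm (X q)) (fun q => tRe (Y q)) p)

/-- On `U`, the field `H` is a real-analytic complex distribution of rank `r`: it is locally
spanned by `r` pointwise linearly independent real-analytic sections of `ℂ T M`. -/
def IsAnalyticDistOn (r : ℕ) (H : CDist d M) (U : Set M) : Prop :=
  ∀ p ∈ U, ∃ X : Fin r → CField d M, (∀ i, RegularNear ω (X i) p) ∧
    ∀ᶠ q in 𝓝 p, LinearIndependent ℂ (fun i => X i q) ∧
      Submodule.span ℂ (Set.range fun i => X i q) = H q

/-- `H` is, on the open set `U`, a real-analytic CR structure of rank `n` (of hypersurface type if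
the manifold has dimension `2 n + 1`): `[H, H] ⊆ H` and `H ∩ H̄ = 0`. -/
structure IsCRStructureOn (n : ℕ) (H : CDist d M) (U : Set M) : Prop where
  analytic : IsAnalyticDistOn n H U
  totally_real : ∀ p ∈ U, H p ⊓ barDist H p = ⊥
  involutive : ∀ p ∈ U, ∀ X Y : CField d M, IsSectionNear H X p → IsSectionNear H Y p →
    cBracket X Y p ∈ H p

/-! The next lemmas serve only to make the Levi kernel and the space `ad K̄` submodules. -/

lemma RegularNear.add {m : WithTop ℕ∞} {X Y : CField d M} {p : M} (hX : RegularNear m X p)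
    (hY : RegularNear m Y p) : RegularNear m (fun q => X q + Y q) p := by
  filter_upwards [hX, hY] with q h1 h2
  simp only [map_add]
  exact ⟨ContMDiffAt.add_section h1.1 h2.1, ContMDiffAt.add_section h1.2 h2.2⟩

lemma RegularNear.smul {m : WithTop ℕ∞} {X : CField d M} {p : M} (c : ℂ)
    (hX : RegularNear m X p) : RegularNear m (fun q => c • X q) p := by
  filter_upwards [hX] with q h1
  simp only [tRe_smul, tIm_smul]
  exact ⟨ContMDiffAt.sub_section (h1.1.const_smul_section) (h1.2.const_smul_section),
    ContMDiffAt.add_section (h1.2.const_smul_section) (h1.1.const_smul_section)⟩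

lemma RegularNear.zero {m : WithTop ℕ∞} (p : M) :
    RegularNear m (fun q => (0 : CTangent d q)) p := by
  refine Filter.Eventually.of_forall fun q => ?_
  simp only [map_zero]
  have := Bundle.contMDiff_zeroSection (n := m) (IB := 𝓡 d) ℝ (TangentSpace (𝓡 d) (M := M))
    (F := RSpace d)
  exact ⟨this q, this q⟩

lemma IsSectionNear.add {H : CDist d M} {X Y : CField d M} {p : M} (hX : IsSectionNear H X p)
    (hY : IsSectionNear H Y p) : IsSectionNear H (fun q => X q + Y q) p :=
  ⟨hX.1.add hY.1, by filter_upwards [hX.2, hY.2] with q h1 h2 using (H q).add_mem h1 h2⟩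

lemma IsSectionNear.smul {H : CDist d M} {X : CField d M} {p : M} (c : ℂ)
    (hX : IsSectionNear H X p) : IsSectionNear H (fun q => c • X q) p :=
  ⟨hX.1.smul c, by filter_upwards [hX.2] with q h1 using (H q).smul_mem c h1⟩

lemma IsSectionNear.zero (H : CDist d M) (p : M) :
    IsSectionNear H (fun q => (0 : CTangent d q)) p :=
  ⟨RegularNear.zero p, Filter.Eventually.of_forall fun q => (H q).zero_mem⟩

lemma RegularNear.mdiff {X : CField d M} {p : M} (hX : RegularNear ∞ X p) :
    MDifferentiableAt (𝓡 d) (𝓡 d).tangent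
      (fun y => (⟨y, tRe (X y)⟩ : TangentBundle (𝓡 d) M)) p ∧
    MDifferentiableAt (𝓡 d) (𝓡 d).tangent
      (fun y => (⟨y, tIm (X y)⟩ : TangentBundle (𝓡 d) M)) p :=
  ⟨hX.self_of_nhds.1.mdifferentiableAt (by simp), hX.self_of_nhds.2.mdifferentiableAt (by simp)⟩

lemma cBracket_add_left {X X' Y : CField d M} {p : M} (hX : RegularNear ∞ X p)
    (hX' : RegularNear ∞ X' p) :
    cBracket (fun q => X q + X' q) Y p = cBracket X Y p + cBracket X' Y p := by
  have key : ∀ W : (q : M) → TangentSpace (𝓡 d) q,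
      VectorField.mlieBracket (𝓡 d) (fun q => tRe (X q + X' q)) W p =
        VectorField.mlieBracket (𝓡 d) (fun q => tRe (X q)) W p +
        VectorField.mlieBracket (𝓡 d) (fun q => tRe (X' q)) W p ∧
      VectorField.mlieBracket (𝓡 d) (fun q => tIm (X q + X' q)) W p =
        VectorField.mlieBracket (𝓡 d) (fun q => tIm (X q)) W p +
        VectorField.mlieBracket (𝓡 d) (fun q => tIm (X' q)) W p := by
    intro W
    simp only [map_add]
    exact ⟨VectorField.mlieBracket_add_left hX.mdiff.1 hX'.mdiff.1,
      VectorField.mlieBracket_add_left hX.mdiff.2 hX'.mdiff.2⟩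
  rw [cBracket, cBracket, cBracket, (key _).1, (key _).2, (key _).1, (key _).2, ← tMk_add]
  congr 1 <;> abel

lemma cBracket_smul_left (c : ℂ) {X Y : CField d M} {p : M} (hX : RegularNear ∞ X p) :
    cBracket (fun q => c • X q) Y p = c • cBracket X Y p := by
  have key : ∀ W : (q : M) → TangentSpace (𝓡 d) q,
      VectorField.mlieBracket (𝓡 d) (fun q => tRe (c • X q)) W p =
        c.re • VectorField.mlieBracket (𝓡 d) (fun q => tRe (X q)) W p -
        c.im • VectorField.mlieBracket (𝓡 d) (fun q => tIm (X q)) W p ∧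
      VectorField.mlieBracket (𝓡 d) (fun q => tIm (c • X q)) W p =
        c.re • VectorField.mlieBracket (𝓡 d) (fun q => tIm (X q)) W p +
        c.im • VectorField.mlieBracket (𝓡 d) (fun q => tRe (X q)) W p := by
    intro W
    simp only [tRe_smul, tIm_smul, sub_eq_add_neg, ← neg_smul]
    have h1 := hX.mdiff.1
    have h2 := hX.mdiff.2
    have s1 := fun a : ℝ => (hX.self_of_nhds.1.const_smul_section (a := a)).mdifferentiableAt
      (by simp)
    have s2 := fun a : ℝ => (hX.self_of_nhds.2.const_smul_section (a := a)).mdifferentiableAt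
      (by simp)
    constructor
    · refine (VectorField.mlieBracket_add_left (s1 _) (s2 _)).trans ?_
      rw [VectorField.mlieBracket_const_smul_left h1, VectorField.mlieBracket_const_smul_left h2]
    · refine (VectorField.mlieBracket_add_left (s2 _) (s1 _)).trans ?_
      rw [VectorField.mlieBracket_const_smul_left h1, VectorField.mlieBracket_const_smul_left h2]
  rw [cBracket, cBracket, (key _).1, (key _).2, (key _).1, (key _).2, smul_tMk]
  congr 1 <;> module

lemma cBracket_zero_left {Y : CField d M} {p : M} :
    cBracket (fun q => (0 : CTangent d q)) Y p = 0 := by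
  have key : ∀ W : (q : M) → TangentSpace (𝓡 d) q,
      VectorField.mlieBracket (𝓡 d) (fun _ => 0) W p = 0 := fun W => by
    have := VectorField.mlieBracket_zero_left (I := 𝓡 d) (W := W)
    exact congrFun this p
  simp only [cBracket, map_zero, key, sub_zero, add_zero, tMk_zero]

/-- The representative `(i/2) [X, Ȳ]_p` of the Levi form `𝓛(X_p, Y_p)`, which takes values in
`ℂ T_p M / (H_p ⊕ H̄_p)`. -/
def leviRep (X Y : CField d M) (p : M) : CTangent d p :=
  (Complex.I / 2) • cBracket X (barField Y) p

/-- The kernel `K_p ⊆ H_p` of the Levi form: the vectors `X_p` with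
`𝓛(X_p, Y_p) = (i/2) [X, Ȳ]_p mod H_p ⊕ H̄_p = 0` for all `Y ∈ Γ(H)`. (The value of the form at
`p` depends on `X_p` and `Y_p` only, so that "some section `X` through `x`" and "every section `X`
through `x`" mean the same.) -/
def leviKernel (H : CDist d M) : CDist d M := fun p =>
  { carrier := {x | ∃ X : CField d M, IsSectionNear H X p ∧ X p = x ∧
      ∀ Y : CField d M, IsSectionNear H Y p → leviRep X Y p ∈ H p ⊔ barDist H p}
    zero_mem' := ⟨_, IsSectionNear.zero H p, rfl, fun Y _ => by
      rw [leviRep, cBracket_zero_left, smul_zero]; exact Submodule.zero_mem _⟩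
    add_mem' := by
      rintro a b ⟨X, hX, rfl, h⟩ ⟨X', hX', rfl, h'⟩
      refine ⟨_, hX.add hX', rfl, fun Y hY => ?_⟩
      have e := cBracket_add_left (Y := barField Y) hX.1 hX'.1
      rw [leviRep, e, smul_add]
      exact Submodule.add_mem _ (h Y hY) (h' Y hY)
    smul_mem' := by
      rintro c a ⟨X, hX, rfl, h⟩
      refine ⟨_, hX.smul c, rfl, fun Y hY => ?_⟩
      have e := cBracket_smul_left c (Y := barField Y) hX.1
      rw [leviRep, e, smul_comm]
      exact Submodule.smul_mem _ _ (h Y hY) }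

/-- The conjugate Levi kernel `K̄`. -/
abbrev leviKernelBar (H : CDist d M) : CDist d M := barDist (leviKernel H)

/-- The CR structure `H` is 2-nondegenerate at `p`: `K_p ≠ 0`, and for every `Y ∈ Γ(K)` with
`Y_p ≠ 0` there is `X ∈ Γ(H)` with `[X, Ȳ]_p ∉ H_p ⊕ K̄_p`; that is, `ad_v ≠ 0` for every nonzero
`v ∈ K̄_p`. -/
def IsTwoNondegenerateAt (H : CDist d M) (p : M) : Prop :=
  leviKernel H p ≠ ⊥ ∧
    ∀ Y : CField d M, IsSectionNear (leviKernel H) Y p → Y p ≠ 0 →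
      ∃ X : CField d M, IsSectionNear H X p ∧
        cBracket X (barField Y) p ∉ H p ⊔ leviKernelBar H p

/-- The quotient `H_p / K_p`. -/
abbrev HmodK (H : CDist d M) (p : M) : Type := H p ⧸ (leviKernel H p).submoduleOf (H p)

/-- The quotient `H̄_p / K̄_p`. -/
abbrev HbarModKbar (H : CDist d M) (p : M) : Type :=
  barDist H p ⧸ (leviKernelBar H p).submoduleOf (barDist H p)

/-- For a section `V` of `K̄` near `p`, the linear map `A : H_p / K_p → H̄_p / K̄_p` is `ad_v`,
`v = V_p`: for every section `Y` of `H` near `p`, `A [Y_p]` is represented by some `z ∈ H̄_p` with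
`[V, Y]_p ≡ z mod H_p ⊕ K̄_p`. -/
def IsAd (H : CDist d M) (p : M) (V : CField d M) (A : HmodK H p →ₗ[ℂ] HbarModKbar H p) : Prop :=
  ∀ (Y : CField d M), IsSectionNear H Y p → ∀ hY : Y p ∈ H p,
    ∃ z : barDist H p, A (Submodule.Quotient.mk ⟨Y p, hY⟩) = Submodule.Quotient.mk z ∧
      cBracket V Y p - z ∈ H p ⊔ leviKernelBar H p

/-- The space `ad K̄_p = {ad_v : v ∈ K̄_p}` of linear maps `H_p / K_p → H̄_p / K̄_p`. -/
def adKbar (H : CDist d M) (p : M) : Submodule ℂ (HmodK H p →ₗ[ℂ] HbarModKbar H p) where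
  carrier := {A | ∃ V : CField d M, IsSectionNear (leviKernelBar H) V p ∧ IsAd H p V A}
  zero_mem' := ⟨_, IsSectionNear.zero _ p, fun Y _ _ => ⟨0, by simp, by
    rw [cBracket_zero_left]; simp⟩⟩
  add_mem' := by
    rintro A B ⟨V, hV, h⟩ ⟨V', hV', h'⟩
    refine ⟨_, hV.add hV', fun Y hY hYp => ?_⟩
    obtain ⟨z, hz, hz'⟩ := h Y hY hYp
    obtain ⟨w, hw, hw'⟩ := h' Y hY hYp
    refine ⟨z + w, by rw [LinearMap.add_apply, hz, hw, Submodule.Quotient.mk_add], ?_⟩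
    rw [cBracket_add_left hV.1 hV'.1, Submodule.coe_add, add_sub_add_comm]
    exact Submodule.add_mem _ hz' hw'
  smul_mem' := by
    rintro c A ⟨V, hV, h⟩
    refine ⟨_, hV.smul c, fun Y hY hYp => ?_⟩
    obtain ⟨z, hz, hz'⟩ := h Y hY hYp
    refine ⟨c • z, by rw [LinearMap.smul_apply, hz, Submodule.Quotient.mk_smul], ?_⟩
    rw [cBracket_smul_left c hV.1, Submodule.coe_smul, ← smul_sub]
    exact Submodule.smul_mem _ _ hz'

end CR

/-! ## Local complexification, Levi leaf space, dynamical Legendrian contact structure -/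

section Leaf

/-- The complexification of `RSpace d`, on which local complexifications are modelled; the
conjugation `τ` is `star` (coordinatewise complex conjugation). -/
abbrev CSpace (d : ℕ) : Type := Fin d → ℂ

/-- The inclusion of `RSpace d` in `CSpace d` as the fixed-point set of `τ`. -/
def toC (d : ℕ) : RSpace d →ₗ[ℝ] CSpace d where
  toFun x := fun i => (x i : ℂ)
  map_add' x y := by ext i; simp
  map_smul' c x := by ext i; simp

/-- The field of subspaces `τ_* S` on `CSpace d`, i.e. `q ↦ conj (S (conj q))`. -/
def tauDist {d : ℕ} (S : CSpace d → Submodule ℂ (CSpace d)) (q : CSpace d) :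
    Submodule ℂ (CSpace d) where
  carrier := {x | star x ∈ S (star q)}
  zero_mem' := by simp
  add_mem' := by
    intro a b ha hb
    simp only [Set.mem_ofPred_eq, star_add] at *
    exact Submodule.add_mem _ ha hb
  smul_mem' := by
    intro c x hx
    simp only [Set.mem_ofPred_eq, star_smul] at *
    exact Submodule.smul_mem _ _ hx

/-- `S` is a holomorphic distribution of rank `r` on `W`. -/
def IsHolDistOn {d : ℕ} (r : ℕ) (S : CSpace d → Submodule ℂ (CSpace d)) (W : Set (CSpace d)) :
    Prop :=
  ∀ q ∈ W, ∃ X : Fin r → CSpace d → CSpace d, (∀ i, AnalyticAt ℂ (X i) q) ∧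
    ∀ᶠ z in 𝓝 q, LinearIndependent ℂ (fun i => X i z) ∧
      Submodule.span ℂ (Set.range fun i => X i z) = S z

/-- The data of a dynamical Legendrian contact structure with involution on a complex manifold
that is an open subset `base` of `ℂ^k`: the distribution `𝓓`, the families `γ ↦ J⁻_γ`,
`γ ↦ J⁺_γ` of sets of (Lagrangian) subspaces of `𝓓_γ`, and the graph of the involution. -/
structure DLCData (k : ℕ) where
  base : Set (CSpace k)
  contact : CSpace k → Submodule ℂ (CSpace k)
  Jminus : CSpace k → Set (Submodule ℂ (CSpace k))
  Jplus : CSpace k → Set (Submodule ℂ (CSpace k))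
  involution : Set (CSpace k × CSpace k)

variable {d : ℕ} {M : Type*} [TopologicalSpace M] [ChartedSpace (RSpace d) M]

/-- The point `p` in the local complexification given by the chart of `M` at `p`. -/
def basePoint (d : ℕ) {M : Type*} [TopologicalSpace M] [ChartedSpace (RSpace d) M] (p : M) :
    CSpace d :=
  toC d (chartAt (RSpace d) p p)

/-- The complex-linear extension `ℂ T_y M → ℂ^d` of the differential at `y` of the chart at `p`. -/
def chartDiff (p y : M) : CTangent d y →ₗ[ℂ] CSpace d :=
  LinearMap.liftBaseChange ℂ
    (toC d ∘ₗ (mfderiv (𝓡 d) (𝓡 d) (chartAt (RSpace d) p) y).toLinearMap)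

variable [IsManifold (𝓡 d) ω M]

/-- A Levi leaf space of the germ at `p` of the CR structure `H` of rank `n`, with Levi kernel
`K` of rank `r`, given on a neighbourhood `U` of `p`:

* a complexification of a neighbourhood of `p` (contained in `U`): a connected, open,
  `τ`-invariant neighbourhood `W` of `p` in the complexified chart at `p`;
* the holomorphic extensions of `H` and `K` to `W` (again `H`, `K`; `H̄ = τ_* H`, `K̄ = τ_* K`),
  with `W` so small that `H ∩ H̄ = 0` and 2-nondegeneracy hold on `W` (the latter says that
  the maps `J⁻_γ`, `J⁺_γ` on the leaf spaces of `K` and `K̄` in the fibres of `π` are immersions);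
* a holomorphic submersion `π` of `W` onto an open subset of `ℂ^k` whose fibres are the leaves
  of the foliation tangent to `K ⊕ K̄`. -/
structure LeviLeafSpace (n r k : ℕ) (H : CDist d M) (U : Set M) (p : M) where
  W : Set (CSpace d)
  Hc : CSpace d → Submodule ℂ (CSpace d)
  Kc : CSpace d → Submodule ℂ (CSpace d)
  π : CSpace d → CSpace k
  isOpen_W : IsOpen W
  isConnected_W : IsConnected W
  star_mem : ∀ q ∈ W, star q ∈ W
  base_mem : basePoint d p ∈ W
  real_mem : ∀ x : RSpace d, toC d x ∈ W →
    x ∈ (chartAt (RSpace d) p).target ∧ (chartAt (RSpace d) p).symm x ∈ U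
  hol_H : IsHolDistOn n Hc W
  hol_K : IsHolDistOn r Kc W
  extends_H : ∀ y ∈ (chartAt (RSpace d) p).source, toC d (chartAt (RSpace d) p y) ∈ W →
    Hc (toC d (chartAt (RSpace d) p y)) = (H y).map (chartDiff p y)
  extends_K : ∀ y ∈ (chartAt (RSpace d) p).source, toC d (chartAt (RSpace d) p y) ∈ W →
    Kc (toC d (chartAt (RSpace d) p y)) = (leviKernel H y).map (chartDiff p y)
  transversal : ∀ q ∈ W, Hc q ⊓ tauDist Hc q = ⊥
  nondegenerate : ∀ q ∈ W, ∀ v ∈ tauDist Kc q, v ≠ 0 → ∃ V X : CSpace d → CSpace d,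
    AnalyticAt ℂ V q ∧ AnalyticAt ℂ X q ∧ (∀ᶠ z in 𝓝 q, V z ∈ tauDist Kc z) ∧
    (∀ᶠ z in 𝓝 q, X z ∈ Hc z) ∧ V q = v ∧
    VectorField.lieBracket ℂ V X q ∉ Hc q ⊔ tauDist Kc q
  hol_π : DifferentiableOn ℂ π W
  submersion : ∀ q ∈ W, Function.Surjective (fderiv ℂ π q)
  ker_π : ∀ q ∈ W, (fderiv ℂ π q).toLinearMap.ker = Kc q ⊔ tauDist Kc q
  fibre_connected : ∀ γ : CSpace k, IsPreconnected (W ∩ π ⁻¹' {γ})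
  canonical_injOn : Set.InjOn (fun q => (π q, (Hc q).map (fderiv ℂ π q).toLinearMap,
    (tauDist Hc q).map (fderiv ℂ π q).toLinearMap)) W

namespace LeviLeafSpace

variable {n r k : ℕ} {H : CDist d M} {U : Set M} {p : M}

/-- `J⁻(q) = π_* H_q`. -/
def jMinus (R : LeviLeafSpace n r k H U p) (q : CSpace d) : Submodule ℂ (CSpace k) :=
  (R.Hc q).map (fderiv ℂ R.π q).toLinearMap

/-- `J⁺(q) = π_* H̄_q`. -/
def jPlus (R : LeviLeafSpace n r k H U p) (q : CSpace d) : Submodule ℂ (CSpace k) :=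
  (tauDist R.Hc q).map (fderiv ℂ R.π q).toLinearMap

/-- The canonical map `F(q) = (J⁻_γ(q), J⁺_γ(q))`, `γ = π(q)`, into the bundle `J⁻ × J⁺` over the
leaf space. -/
def canonicalMap (R : LeviLeafSpace n r k H U p) (q : CSpace d) :
    CSpace k × Submodule ℂ (CSpace k) × Submodule ℂ (CSpace k) :=
  (R.π q, R.jMinus q, R.jPlus q)

/-- The dynamical Legendrian contact structure `(𝓓, J⁻, J⁺)`, with its involution, on the Levi leaf
space: `𝓓_γ = π_* (H ⊕ H̄)`, `J^∓_γ` the images of the maps `J^∓` on the leaf `γ`, and the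
involution induced by `τ`. -/
def dlc (R : LeviLeafSpace n r k H U p) : DLCData k where
  base := R.π '' R.W
  contact γ := ⨆ q ∈ {q | q ∈ R.W ∧ R.π q = γ},
    (R.Hc q ⊔ tauDist R.Hc q).map (fderiv ℂ R.π q).toLinearMap
  Jminus γ := {L | ∃ q ∈ R.W, R.π q = γ ∧ R.jMinus q = L}
  Jplus γ := {L | ∃ q ∈ R.W, R.π q = γ ∧ R.jPlus q = L}
  involution := {x | ∃ q ∈ R.W, x = (R.π q, R.π (star q))}

end LeviLeafSpace

/-- The germ at `p` of the CR structure `H` is recoverable: it is uniquely determined by its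
dynamical Legendrian contact structure. That is, if the germ at `p'` of another 2-nondegenerate
hypersurface-type CR structure `H'` has the same dynamical Legendrian contact structure (isomorphic
structures become equal after a change of the coordinate `π'` on the second leaf space), then
`F_* H = F'_* H'` as distributions on `J⁻ × J⁺`; in other words the biholomorphism
`G = F'⁻¹ ∘ F` between the two complexified manifolds sends `H` to `H'`. -/
def IsRecoverableAt (n : ℕ) {M : Type u} [TopologicalSpace M]
    [ChartedSpace (RSpace (2 * n + 1)) M] [IsManifold (𝓡 (2 * n + 1)) ω M]
    (H : CDist (2 * n + 1) M) (p : M) : Prop :=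
  ∀ (M' : Type u) [TopologicalSpace M'] [ChartedSpace (RSpace (2 * n + 1)) M']
    [IsManifold (𝓡 (2 * n + 1)) ω M'] (H' : CDist (2 * n + 1) M') (U' : Set M') (p' : M')
    (r k : ℕ),
    IsOpen U' → p' ∈ U' → IsCRStructureOn n H' U' →
    (∀ q ∈ U', Module.finrank ℂ (leviKernel H' q) = r) →
    (∀ q ∈ U', IsTwoNondegenerateAt H' q) →
    ∀ (R : LeviLeafSpace n r k H Set.univ p) (R' : LeviLeafSpace n r k H' U' p'),
      R.dlc = R'.dlc →
      ∀ G : CSpace (2 * n + 1) → CSpace (2 * n + 1),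
        AnalyticAt ℂ G (basePoint (2 * n + 1) p) →
        Function.Bijective (fderiv ℂ G (basePoint (2 * n + 1) p)) →
        G (basePoint (2 * n + 1) p) = basePoint (2 * n + 1) p' →
        (∀ᶠ q in 𝓝 (basePoint (2 * n + 1) p), R'.canonicalMap (G q) = R.canonicalMap q) →
        ∀ᶠ q in 𝓝 (basePoint (2 * n + 1) p),
          (R.Hc q).map (fderiv ℂ G q).toLinearMap = R'.Hc (G q)

/-- The CR structure `H` on `M` is recoverable: all its germs are. -/
def IsRecoverable (n : ℕ) {M : Type u} [TopologicalSpace M]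
    [ChartedSpace (RSpace (2 * n + 1)) M] [IsManifold (𝓡 (2 * n + 1)) ω M]
    (H : CDist (2 * n + 1) M) : Prop :=
  ∀ p : M, IsRecoverableAt n H p

end Leaf

end LeviCR

end

namespace LeviCR

set_option linter.unusedSectionVars false

/-! ## Analytic families of linear maps -/

section Families

variable {G E F F' : Type*} [NormedAddCommGroup G] [NormedSpace ℂ G]
  [NormedAddCommGroup E] [NormedSpace ℂ E]
  [NormedAddCommGroup F] [NormedSpace ℂ F] [NormedAddCommGroup F'] [NormedSpace ℂ F']

/-! Everything is decided by one tensor. In a complexified chart put `S = H ⊕ K̄` and let `P` be a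
holomorphic one-form with kernel `S`. Its exterior derivative `Ω = curv P` (up to sign) sends the
values of two sections of `S` to the image under `P` of their bracket. Both `H` and `K ⊕ K̄` are
involutive, hence isotropic for `Ω`, and for `v` in `K̄` the map `Ω(v, ·)` on `H` is `ad_v`: by `H ∩
H̄ = 0`, `P` embeds `H̄ / K̄` in the values of `Ω` (`adKbar_eq_span_iff`). As `K` is a line, the
condition on `ad K̄` says that `Ω(v, ·)` has rank at least two on `H` (`RankGtOne`).

Sufficiency. Since `K ⊕ K̄` is the kernel of `dπ`, the distribution `S` is the preimage of `J⁻`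
under `dπ`. A map `G` respecting `π` and `J⁻` therefore carries `S` to `S'` and `Ω` to `Ω'`. It
carries `K` to `K'`, because by 2-nondegeneracy `K` consists of the vectors of `K ⊕ K̄` that
annihilate `H` under `Ω`. What is left is that the pull-back of `H'` could be a graph `{h + f(h) v}`
over `H` in the direction of `K̄`. Isotropy of both spaces gives `f(h) Ω(v, h') = f(h') Ω(v, h)`,
and a nonzero `f` would force `Ω(v, ·)` to have rank at most one (`le_of_linearIndependent_pair`).
This settles a dense set of real points; continuity and the identity theorem settle a full
neighbourhood (`map_fderiv_eq_of_dense_rankGtOne`).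

Necessity. The set where the condition holds is open. If it is not dense, the rank is at most one
near some `p`. Then the kernel `D` of `Ω(v, ·)` on `H` has corank one in `H` and consists of Cauchy
characteristics of `S`, so `D` is involutive and `S` descends to a rank-two distribution on the leaf
space of `D`. A line field in it is automatically involutive, and its pull-back is an involutive
`H'` with `D ⊆ H' ⊆ S` that can be prescribed at `p`, in particular different from `H`
(`exists_involutive_extension`, `IsCRGerm.exists_rotation`). This `H'` has the same Levi kernel `K`,
the same `H' ⊕ K̄` and the same `H' ⊕ H̄'`, hence the same dynamical Legendrian contact structure,
and the identity map contradicts recoverability (`not_isRecoverableAt_of_rank_le_one`).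

The analytic tools are the holomorphic Frobenius theorem (`frobenius`), obtained from an implicit
function theorem for curves, and the uniqueness of holomorphic maps given at real points
(`eventually_eq_zero_of_real`). The latter transports facts proved for smooth sections over `M` to
the complexification. The leaf spaces needed for the counterexample are built from a first integral
of `K ⊕ K̄` compatible with the conjugation (`exists_submersion_box`). -/

theorem analyticAt_clm_apply {A : G → E →L[ℂ] F} {v : G → E} {z₀ : G}
    (hA : AnalyticAt ℂ A z₀) (hv : AnalyticAt ℂ v z₀) :
    AnalyticAt ℂ (fun z => A z (v z)) z₀ :=
  ((ContinuousLinearMap.id ℂ (E →L[ℂ] F)).analyticAt_bilinear (A z₀, v z₀)).comp₂ hA hv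

theorem analyticAt_clm_comp {A : G → F →L[ℂ] F'} {B : G → E →L[ℂ] F} {z₀ : G}
    (hA : AnalyticAt ℂ A z₀) (hB : AnalyticAt ℂ B z₀) :
    AnalyticAt ℂ (fun z => (A z).comp (B z)) z₀ :=
  ((ContinuousLinearMap.compL ℂ E F F').analyticAt_bilinear (A z₀, B z₀)).comp₂ hA hB

theorem analyticAt_clm_prod {A : G → E →L[ℂ] F} {B : G → E →L[ℂ] F'} {z₀ : G}
    (hA : AnalyticAt ℂ A z₀) (hB : AnalyticAt ℂ B z₀) :
    AnalyticAt ℂ (fun z => (A z).prod (B z)) z₀ := by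
  have h := (analyticAt_clm_comp (analyticAt_const (v := ContinuousLinearMap.inl ℂ F F')) hA).add
    (analyticAt_clm_comp (analyticAt_const (v := ContinuousLinearMap.inr ℂ F F')) hB)
  refine h.congr (Filter.Eventually.of_forall fun z => ?_)
  ext v <;> simp

theorem analyticAt_clm_inverse [CompleteSpace E] {A : G → E →L[ℂ] F} {z₀ : G}
    (hA : AnalyticAt ℂ A z₀) (hinv : (A z₀).IsInvertible) :
    AnalyticAt ℂ (fun z => (A z).inverse) z₀ ∧ ∀ᶠ z in 𝓝 z₀, (A z).IsInvertible := by
  obtain ⟨e, he⟩ := hinv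
  have hc := contDiffAt_map_inverse (n := ω) e
  rw [he] at hc
  refine ⟨hc.analyticAt.comp hA, ?_⟩
  have := e.nhds
  rw [he] at this
  filter_upwards [hA.continuousAt this] with z hz
  exact hz

/-- A family of surjective maps has an analytic family of right inverses. -/
theorem exists_analytic_rightInverse [FiniteDimensional ℂ F] [CompleteSpace F]
    {A : G → E →L[ℂ] F} {z₀ : G}
    (hA : AnalyticAt ℂ A z₀) (hsurj : Function.Surjective (A z₀)) :
    ∃ T : G → F →L[ℂ] E, AnalyticAt ℂ T z₀ ∧ ∀ᶠ z in 𝓝 z₀, ∀ w, A z (T z w) = w := by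
  obtain ⟨T₀, hT₀⟩ := (A z₀).toLinearMap.exists_rightInverse_of_surjective
    (LinearMap.range_eq_top.2 hsurj)
  -- The constant map `S` is a right inverse at `z₀` only. Nearby `A z ∘ S` is close to the
  -- identity, and composing `S` with its inverse corrects it.
  set S : F →L[ℂ] E := LinearMap.toContinuousLinearMap T₀ with hS
  have hB : AnalyticAt ℂ (fun z => (A z).comp S) z₀ := analyticAt_clm_comp hA analyticAt_const
  have h0 : (A z₀).comp S = ContinuousLinearMap.id ℂ F := by
    ext w; exact LinearMap.congr_fun hT₀ w
  have hinv : ((A z₀).comp S).IsInvertible := h0 ▸ ⟨ContinuousLinearEquiv.refl ℂ F, rfl⟩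
  obtain ⟨h1, h2⟩ := analyticAt_clm_inverse hB hinv
  refine ⟨fun z => S.comp ((A z).comp S).inverse, analyticAt_clm_comp analyticAt_const h1, ?_⟩
  filter_upwards [h2] with z hz w
  exact hz.self_apply_inverse w

/-- A family of injective maps has an analytic family of left inverses. -/
theorem exists_analytic_leftInverse [FiniteDimensional ℂ F] [CompleteSpace E]
    {A : G → E →L[ℂ] F} {z₀ : G}
    (hA : AnalyticAt ℂ A z₀) (hinj : Function.Injective (A z₀)) :
    ∃ T : G → F →L[ℂ] E, AnalyticAt ℂ T z₀ ∧ ∀ᶠ z in 𝓝 z₀, ∀ v, T z (A z v) = v := by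
  obtain ⟨T₀, hT₀⟩ := (A z₀).toLinearMap.exists_leftInverse_of_injective
    (LinearMap.ker_eq_bot.2 hinj)
  set S : F →L[ℂ] E := LinearMap.toContinuousLinearMap T₀ with hS
  have hB : AnalyticAt ℂ (fun z => S.comp (A z)) z₀ := analyticAt_clm_comp analyticAt_const hA
  have h0 : S.comp (A z₀) = ContinuousLinearMap.id ℂ E := by
    ext w; exact LinearMap.congr_fun hT₀ w
  have hinv : (S.comp (A z₀)).IsInvertible := h0 ▸ ⟨ContinuousLinearEquiv.refl ℂ E, rfl⟩
  obtain ⟨h1, h2⟩ := analyticAt_clm_inverse hB hinv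
  refine ⟨fun z => (S.comp (A z)).inverse.comp S, analyticAt_clm_comp h1 analyticAt_const, ?_⟩
  filter_upwards [h2] with z hz v
  exact hz.inverse_apply_self v

theorem eventually_injective [FiniteDimensional ℂ F] [CompleteSpace E]
    {A : G → E →L[ℂ] F} {z₀ : G}
    (hA : AnalyticAt ℂ A z₀) (hinj : Function.Injective (A z₀)) :
    ∀ᶠ z in 𝓝 z₀, Function.Injective (A z) := by
  obtain ⟨T, -, hT⟩ := exists_analytic_leftInverse hA hinj
  filter_upwards [hT] with z hz using Function.LeftInverse.injective hz

theorem eventually_surjective [FiniteDimensional ℂ F] [CompleteSpace F]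
    {A : G → E →L[ℂ] F} {z₀ : G}
    (hA : AnalyticAt ℂ A z₀) (hsurj : Function.Surjective (A z₀)) :
    ∀ᶠ z in 𝓝 z₀, Function.Surjective (A z) := by
  obtain ⟨T, -, hT⟩ := exists_analytic_rightInverse hA hsurj
  filter_upwards [hT] with z hz using Function.RightInverse.surjective hz

end Families

/-! ## Holomorphic distributions, frames and coframes -/

section Distributions

variable {E F F' : Type*} [NormedAddCommGroup E] [NormedSpace ℂ E] [FiniteDimensional ℂ E]
  [CompleteSpace E]
  [NormedAddCommGroup F] [NormedSpace ℂ F] [FiniteDimensional ℂ F] [CompleteSpace F]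
  [NormedAddCommGroup F'] [NormedSpace ℂ F'] [FiniteDimensional ℂ F'] [CompleteSpace F']

/-- `P` is an analytic family of surjective maps whose kernels are the subspaces `D z` for `z`
near `z₀`. -/
structure IsCoframeAt (P : E → E →L[ℂ] F) (D : E → Submodule ℂ E) (z₀ : E) : Prop where
  analyticAt : AnalyticAt ℂ P z₀
  surjective : Function.Surjective (P z₀)
  mem_iff : ∀ᶠ z in 𝓝 z₀, ∀ v, v ∈ D z ↔ P z v = 0

/-- `X` is an analytic frame of `D` near `z₀`. -/
structure IsFrameAt {ι : Type*} (X : ι → E → E) (D : E → Submodule ℂ E) (z₀ : E) : Prop where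
  analyticAt : ∀ i, AnalyticAt ℂ (X i) z₀
  linearIndependent : LinearIndependent ℂ (fun i => X i z₀)
  span_eq : ∀ᶠ z in 𝓝 z₀, Submodule.span ℂ (Set.range fun i => X i z) = D z

/-- `D` is a holomorphic distribution near `z₀`. -/
def IsDistAt (D : E → Submodule ℂ E) (z₀ : E) : Prop :=
  ∃ (m : ℕ) (P : E → E →L[ℂ] (Fin m → ℂ)), IsCoframeAt P D z₀

/-- `X` is a holomorphic section of `D` near `z`. -/
def IsSec (D : E → Submodule ℂ E) (X : E → E) (z : E) : Prop :=
  AnalyticAt ℂ X z ∧ ∀ᶠ w in 𝓝 z, X w ∈ D w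

theorem IsSec.mem {D : E → Submodule ℂ E} {X : E → E} {z : E} (h : IsSec D X z) : X z ∈ D z :=
  h.2.self_of_nhds

theorem IsSec.eventually {D : E → Submodule ℂ E} {X : E → E} {z : E} (h : IsSec D X z) :
    ∀ᶠ w in 𝓝 z, IsSec D X w :=
  h.1.eventually_analyticAt.and h.2.eventually_nhds

theorem IsSec.mono {D D' : E → Submodule ℂ E} {X : E → E} {z : E} (h : IsSec D X z)
    (hD : ∀ᶠ w in 𝓝 z, D w ≤ D' w) : IsSec D' X z :=
  ⟨h.1, by filter_upwards [h.2, hD] with w h1 h2 using h2 h1⟩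

theorem IsCoframeAt.eventually {P : E → E →L[ℂ] F} {D : E → Submodule ℂ E} {z₀ : E}
    (h : IsCoframeAt P D z₀) : ∀ᶠ z in 𝓝 z₀, IsCoframeAt P D z := by
  filter_upwards [h.analyticAt.eventually_analyticAt,
    eventually_surjective h.analyticAt h.surjective, h.mem_iff.eventually_nhds] with z h1 h2 h3
  exact ⟨h1, h2, h3⟩

theorem IsCoframeAt.congr {P : E → E →L[ℂ] F} {D D' : E → Submodule ℂ E} {z₀ : E}
    (h : IsCoframeAt P D z₀) (hD : ∀ᶠ z in 𝓝 z₀, D z = D' z) : IsCoframeAt P D' z₀ :=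
  ⟨h.analyticAt, h.surjective, by
    filter_upwards [h.mem_iff, hD] with z h1 h2 v
    rw [← h2, h1]⟩

theorem IsDistAt.congr {D D' : E → Submodule ℂ E} {z₀ : E}
    (h : IsDistAt D z₀) (hD : ∀ᶠ z in 𝓝 z₀, D z = D' z) : IsDistAt D' z₀ := by
  obtain ⟨m, P, hP⟩ := h
  exact ⟨m, P, hP.congr hD⟩

theorem IsDistAt.eventually {D : E → Submodule ℂ E} {z₀ : E} (h : IsDistAt D z₀) :
    ∀ᶠ z in 𝓝 z₀, IsDistAt D z := by
  obtain ⟨m, P, hP⟩ := h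
  filter_upwards [hP.eventually] with z hz using ⟨m, P, hz⟩

theorem IsCoframeAt.isDistAt {P : E → E →L[ℂ] F} {D : E → Submodule ℂ E} {z₀ : E}
    (h : IsCoframeAt P D z₀) : IsDistAt D z₀ := by
  let e : F ≃L[ℂ] (Fin (Module.finrank ℂ F) → ℂ) :=
    (Module.finBasis ℂ F).equivFun.toContinuousLinearEquiv
  refine ⟨Module.finrank ℂ F,
    fun z => (e : F →L[ℂ] (Fin (Module.finrank ℂ F) → ℂ)).comp (P z),
    analyticAt_clm_comp (analyticAt_const (v := (e : F →L[ℂ] (Fin (Module.finrank ℂ F) → ℂ))))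
      h.analyticAt, e.surjective.comp h.surjective, ?_⟩
  filter_upwards [h.mem_iff] with z hz v
  simp [hz v]

/-- Every vector of a holomorphic distribution extends to a section: there is an analytic family
of projections onto the distribution. -/
theorem IsCoframeAt.exists_projection {P : E → E →L[ℂ] F} {D : E → Submodule ℂ E} {z₀ : E}
    (h : IsCoframeAt P D z₀) : ∃ Q : E → E →L[ℂ] E, AnalyticAt ℂ Q z₀ ∧
      ∀ᶠ z in 𝓝 z₀, (∀ v, Q z v ∈ D z) ∧ ∀ v ∈ D z, Q z v = v := by
  obtain ⟨T, hT, hPT⟩ := exists_analytic_rightInverse h.analyticAt h.surjective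
  refine ⟨fun z => ContinuousLinearMap.id ℂ E - (T z).comp (P z),
    analyticAt_const.sub (analyticAt_clm_comp hT h.analyticAt), ?_⟩
  filter_upwards [hPT, h.mem_iff] with z h1 h2
  refine ⟨fun v => ?_, fun v hv => ?_⟩
  · rw [h2]; simp [h1]
  · rw [h2] at hv; simp [hv]

theorem IsDistAt.exists_projection {D : E → Submodule ℂ E} {z₀ : E}
    (h : IsDistAt D z₀) : ∃ Q : E → E →L[ℂ] E, AnalyticAt ℂ Q z₀ ∧
      ∀ᶠ z in 𝓝 z₀, (∀ v, Q z v ∈ D z) ∧ ∀ v ∈ D z, Q z v = v := by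
  obtain ⟨m, P, hP⟩ := h
  exact hP.exists_projection

theorem IsDistAt.exists_sec {D : E → Submodule ℂ E} {z : E} (h : IsDistAt D z) {v : E}
    (hv : v ∈ D z) : ∃ X, IsSec D X z ∧ X z = v := by
  obtain ⟨Q, hQ, hQD⟩ := h.exists_projection
  refine ⟨fun w => Q w v, ⟨analyticAt_clm_apply hQ analyticAt_const, ?_⟩,
    hQD.self_of_nhds.2 v hv⟩
  filter_upwards [hQD] with w hw using hw.1 v

/-- The frame is an injective family `A`. With an analytic left inverse `T`, the operator `1 - A T`
kills the span, and following it by a projection onto a fixed complement of the span at `z₀` makes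
the target independent of `z`. Nothing else is killed near `z₀`, because there the pair `(T, P)`
stays injective. -/
theorem IsFrameAt.isDistAt {ι : Type*} [Finite ι] {X : ι → E → E} {D : E → Submodule ℂ E} {z₀ : E}
    (h : IsFrameAt X D z₀) : IsDistAt D z₀ := by
  classical
  have := Fintype.ofFinite ι
  -- the analytic family `x ↦ ∑ x i • X i z`
  let A : E → (ι → ℂ) →L[ℂ] E := fun z =>
    ∑ i, (ContinuousLinearMap.smulRightL ℂ (ι → ℂ) E (ContinuousLinearMap.proj i)) (X i z)
  have hAa : ∀ z x, A z x = ∑ i, x i • X i z := by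
    intro z x; simp [A]
  have hA : AnalyticAt ℂ A z₀ := by
    refine Finset.analyticAt_fun_sum _ fun i _ => ?_
    exact ((ContinuousLinearMap.smulRightL ℂ (ι → ℂ) E
      (ContinuousLinearMap.proj i)).analyticAt _).comp (h.analyticAt i)
  have hAi : Function.Injective (A z₀) := by
    rw [injective_iff_map_eq_zero]
    intro x hx
    rw [hAa] at hx
    ext i
    exact Fintype.linearIndependent_iff.1 h.linearIndependent x hx i
  obtain ⟨T, hT, hTA⟩ := exists_analytic_leftInverse hA hAi
  -- complement
  obtain ⟨C, hC⟩ := Submodule.exists_isCompl (LinearMap.range (A z₀).toLinearMap)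
  let pr : E →L[ℂ] C := LinearMap.toContinuousLinearMap (C.projectionOnto _ hC.symm)
  let P : E → E →L[ℂ] C := fun z => pr.comp (ContinuousLinearMap.id ℂ E - (A z).comp (T z))
  have hPan : AnalyticAt ℂ P z₀ := analyticAt_clm_comp analyticAt_const
    (analyticAt_const.sub (analyticAt_clm_comp hA hT))
  -- `(T, pr ∘ (1 - A T))` is invertible at `z₀`
  let B : E → E →L[ℂ] (ι → ℂ) × C := fun z => (T z).prod (P z)
  have hB : AnalyticAt ℂ B z₀ := analyticAt_clm_prod hT hPan
  have hTA0 := hTA.self_of_nhds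
  have hPA : ∀ x, P z₀ (A z₀ x) = 0 := by
    intro x; simp [P, hTA0]
  have hBi : Function.Injective (B z₀) := by
    rw [injective_iff_map_eq_zero]
    intro v hv
    have h1 : T z₀ v = 0 := congrArg Prod.fst hv
    have h2 : P z₀ v = 0 := congrArg Prod.snd hv
    have h3 : pr v = 0 := by simpa [P, h1] using h2
    have h4 : v ∈ LinearMap.range (A z₀).toLinearMap :=
      (Submodule.projectionOnto_apply_eq_zero_iff hC.symm).1 h3
    obtain ⟨x, rfl⟩ := h4
    have : x = 0 := by rw [← hTA0 x]; exact h1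
    simp [this]
  have hPs : Function.Surjective (P z₀) := by
    intro c
    refine ⟨c - A z₀ (T z₀ c), ?_⟩
    have : P z₀ ((c : E) - A z₀ (T z₀ c)) = P z₀ c := by rw [map_sub, hPA, sub_zero]
    rw [this]
    have e1 : pr (A z₀ (T z₀ (c : E))) = 0 :=
      (Submodule.projectionOnto_apply_eq_zero_iff hC.symm).2 ⟨_, rfl⟩
    have e2 : pr (c : E) = c := Submodule.projectionOnto_apply_left hC.symm c
    simp [P, e1, e2]
  refine IsCoframeAt.isDistAt (P := P) ⟨hPan, hPs, ?_⟩
  filter_upwards [h.span_eq, hTA, eventually_injective hB hBi] with z h1 h2 h3 v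
  have hr : v ∈ D z ↔ ∃ x, A z x = v := by
    rw [← h1, Submodule.mem_span_range_iff_exists_fun]
    simp only [hAa]
  rw [hr]
  constructor
  · rintro ⟨x, rfl⟩; simp [P, h2]
  · intro hv
    -- `v` and `A z (T z v)` have the same image under the injective map `B z = (T z, P z)`.
    refine ⟨T z v, h3 ?_⟩
    refine Prod.ext (by simp [B, h2]) ?_
    simp [B, hv]
    simp [P, h2]

theorem IsFrameAt.eventually {ι : Type*} [Finite ι] {X : ι → E → E} {D : E → Submodule ℂ E}
    {z₀ : E} (h : IsFrameAt X D z₀) : ∀ᶠ z in 𝓝 z₀, IsFrameAt X D z := by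
  have h1 : ContinuousAt (fun z i => X i z) z₀ :=
    continuousAt_pi.2 fun i => (h.analyticAt i).continuousAt
  have h2 : ∀ᶠ z in 𝓝 z₀, LinearIndependent ℂ (fun i => X i z) :=
    h1 (isOpen_setOfPred_linearIndependent.mem_nhds h.linearIndependent)
  filter_upwards [Filter.eventually_all.2 fun i => (h.analyticAt i).eventually_analyticAt, h2,
    h.span_eq.eventually_nhds] with z a b c
  exact ⟨a, b, c⟩

theorem IsFrameAt.finrank_eq {ι : Type*} [Fintype ι] {X : ι → E → E} {D : E → Submodule ℂ E}
    {z₀ : E} (h : IsFrameAt X D z₀) : Module.finrank ℂ (D z₀) = Fintype.card ι := by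
  rw [← h.span_eq.self_of_nhds]
  exact finrank_span_eq_card h.linearIndependent

theorem IsFrameAt.isSec {ι : Type*} [Finite ι] {X : ι → E → E} {D : E → Submodule ℂ E}
    {z₀ : E} (h : IsFrameAt X D z₀) (i : ι) : IsSec D (X i) z₀ := by
  refine ⟨h.analyticAt i, ?_⟩
  filter_upwards [h.span_eq] with z hz
  rw [← hz]
  exact Submodule.subset_span ⟨i, rfl⟩

theorem IsCoframeAt.finrank_add {P : E → E →L[ℂ] F} {D : E → Submodule ℂ E} {z₀ : E}
    (h : IsCoframeAt P D z₀) :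
    Module.finrank ℂ (D z₀) + Module.finrank ℂ F = Module.finrank ℂ E := by
  have hk : D z₀ = LinearMap.ker (P z₀).toLinearMap := by
    ext v; exact h.mem_iff.self_of_nhds v
  have := LinearMap.finrank_range_add_finrank_ker (P z₀).toLinearMap
  rw [LinearMap.range_eq_top.2 h.surjective, finrank_top] at this
  rw [hk, add_comm]; exact this

theorem IsDistAt.finrank_eventually {D : E → Submodule ℂ E} {z₀ : E} (h : IsDistAt D z₀) :
    ∀ᶠ z in 𝓝 z₀, Module.finrank ℂ (D z) = Module.finrank ℂ (D z₀) := by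
  obtain ⟨m, P, hP⟩ := h
  filter_upwards [hP.eventually] with z hz
  have h1 := hP.finrank_add
  have h2 := hz.finrank_add
  omega

/-- A basis of the space at `z₀` is moved by the analytic projections onto `D z`. Independence is an
open condition, and spanning follows because the dimension is locally constant. -/
theorem IsDistAt.exists_frame {D : E → Submodule ℂ E} {z₀ : E} (h : IsDistAt D z₀) {r : ℕ}
    (hr : Module.finrank ℂ (D z₀) = r) : ∃ X : Fin r → E → E, IsFrameAt X D z₀ := by
  obtain ⟨Q, hQ, hQD⟩ := h.exists_projection
  let b := Module.finBasisOfFinrankEq ℂ (D z₀) hr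
  let X : Fin r → E → E := fun i z => Q z (b i)
  have hX : ∀ i, AnalyticAt ℂ (X i) z₀ := fun i => analyticAt_clm_apply hQ analyticAt_const
  have hX0 : (fun i => X i z₀) = fun i => (b i : E) := by
    ext1 i; exact hQD.self_of_nhds.2 _ (b i).2
  have hli : LinearIndependent ℂ (fun i => X i z₀) := by
    rw [hX0]
    exact b.linearIndependent.map' (D z₀).subtype (Submodule.ker_subtype _)
  refine ⟨X, hX, hli, ?_⟩
  have h1 : ContinuousAt (fun z i => X i z) z₀ :=
    continuousAt_pi.2 fun i => (hX i).continuousAt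
  have h2 : ∀ᶠ z in 𝓝 z₀, LinearIndependent ℂ (fun i => X i z) :=
    h1 (isOpen_setOfPred_linearIndependent.mem_nhds hli)
  filter_upwards [h2, hQD, h.finrank_eventually] with z a b c
  refine Submodule.eq_of_le_of_finrank_eq (Submodule.span_le.2 ?_) ?_
  · rintro _ ⟨i, rfl⟩; exact b.1 _
  · rw [finrank_span_eq_card a, c, hr, Fintype.card_fin]

theorem IsFrameAt.sup {ι κ : Type*} {X : ι → E → E} {Y : κ → E → E} {D D' : E → Submodule ℂ E}
    {z₀ : E} (h : IsFrameAt X D z₀) (h' : IsFrameAt Y D' z₀) (hd : D z₀ ⊓ D' z₀ = ⊥) :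
    IsFrameAt (Sum.elim X Y) (fun z => D z ⊔ D' z) z₀ := by
  refine ⟨?_, ?_, ?_⟩
  · rintro (i | i)
    exacts [h.analyticAt i, h'.analyticAt i]
  · have := h.linearIndependent.sum_type h'.linearIndependent (by
      rw [h.span_eq.self_of_nhds, h'.span_eq.self_of_nhds, disjoint_iff, hd])
    have e : (fun i => Sum.elim X Y i z₀) = Sum.elim (fun i => X i z₀) fun i => Y i z₀ := by
      ext1 (i | i) <;> rfl
    rw [e]; exact this
  · filter_upwards [h.span_eq, h'.span_eq] with z h1 h2
    rw [← h1, ← h2, ← Submodule.span_union]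
    congr 1
    ext v
    simp

theorem IsDistAt.sup {D D' : E → Submodule ℂ E} {z₀ : E} (h : IsDistAt D z₀)
    (h' : IsDistAt D' z₀) (hd : D z₀ ⊓ D' z₀ = ⊥) : IsDistAt (fun z => D z ⊔ D' z) z₀ := by
  obtain ⟨X, hX⟩ := h.exists_frame rfl
  obtain ⟨Y, hY⟩ := h'.exists_frame rfl
  exact (hX.sup hY hd).isDistAt

/-- The dimensions of `D`, `D'` and, by transversality at `z₀`, of their sum are locally constant;
hence so is that of the intersection. -/
theorem IsDistAt.eventually_inf_eq_bot {D D' : E → Submodule ℂ E} {z₀ : E} (h : IsDistAt D z₀)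
    (h' : IsDistAt D' z₀) (hd : D z₀ ⊓ D' z₀ = ⊥) : ∀ᶠ z in 𝓝 z₀, D z ⊓ D' z = ⊥ := by
  filter_upwards [(h.sup h' hd).finrank_eventually, h.finrank_eventually, h'.finrank_eventually]
    with z h1 h2 h3
  have e1 := Submodule.finrank_sup_add_finrank_inf_eq (D z) (D' z)
  have e2 := Submodule.finrank_sup_add_finrank_inf_eq (D z₀) (D' z₀)
  rw [hd, finrank_bot] at e2
  rw [← Submodule.finrank_eq_zero (R := ℂ)]
  omega

/-- A section of `⊤` that lies in the kernel of the coframe. -/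
theorem IsCoframeAt.eventually_apply_eq_zero {P : E → E →L[ℂ] F} {D : E → Submodule ℂ E} {z : E}
    (h : IsCoframeAt P D z) {X : E → E} (hX : IsSec D X z) : ∀ᶠ w in 𝓝 z, P w (X w) = 0 := by
  filter_upwards [h.mem_iff, hX.2] with w h1 h2 using (h1 _).1 h2

theorem IsSec.lieBracket {D : E → Submodule ℂ E} {X Y : E → E} {z : E} (hX : AnalyticAt ℂ X z)
    (hY : AnalyticAt ℂ Y z) (h : ∀ᶠ w in 𝓝 z, VectorField.lieBracket ℂ X Y w ∈ D w) :
    IsSec D (VectorField.lieBracket ℂ X Y) z :=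
  ⟨(analyticAt_clm_apply hY.fderiv hX).sub (analyticAt_clm_apply hX.fderiv hY), h⟩

end Distributions

/-! ## The curvature of a coframe -/

section Curvature

variable {E E' F F' : Type*} [NormedAddCommGroup E] [NormedSpace ℂ E]
  [NormedAddCommGroup E'] [NormedSpace ℂ E']
  [NormedAddCommGroup F] [NormedSpace ℂ F]

/-- The exterior derivative of an `F`-valued one-form, up to sign: the bilinear form which sends the
values at `z` of two sections `X`, `Y` of `ker P` to `P z ([X, Y] z)`. -/
noncomputable def curv (P : E → E →L[ℂ] F) (z : E) : E →L[ℂ] E →L[ℂ] F :=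
  (fderiv ℂ P z).flip - fderiv ℂ P z

theorem curv_apply (P : E → E →L[ℂ] F) (z v w : E) :
    curv P z v w = fderiv ℂ P z w v - fderiv ℂ P z v w := by
  simp [curv]

theorem curv_swap (P : E → E →L[ℂ] F) (z v w : E) : curv P z v w = - curv P z w v := by
  simp [curv_apply]

theorem curv_self (P : E → E →L[ℂ] F) (z v : E) : curv P z v v = 0 := by
  simp [curv_apply]

theorem analyticAt_curv [CompleteSpace F] {P : E → E →L[ℂ] F} {z : E} (hP : AnalyticAt ℂ P z) :
    AnalyticAt ℂ (curv P) z := by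
  have h := @ContinuousLinearMap.analyticAt ℂ _ (E →L[ℂ] E →L[ℂ] F) _ _ (E →L[ℂ] E →L[ℂ] F) _ _
    (ContinuousLinearMap.flipₗᵢ ℂ E E F).toContinuousLinearEquiv.toContinuousLinearMap (fderiv ℂ P z)
  have h1 : AnalyticAt ℂ (fun w => (fderiv ℂ P w).flip) z := h.comp hP.fderiv
  exact h1.sub hP.fderiv

theorem fderiv_clm_apply_of_eventually_zero {P : E → E →L[ℂ] F} {X : E → E} {z : E}
    (hP : DifferentiableAt ℂ P z) (hX : DifferentiableAt ℂ X z) (h : ∀ᶠ w in 𝓝 z, P w (X w) = 0)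
    (v : E) : P z (fderiv ℂ X z v) = - fderiv ℂ P z v (X z) := by
  have h1 : fderiv ℂ (fun w => P w (X w)) z = 0 := by
    have : (fun w => P w (X w)) =ᶠ[𝓝 z] fun _ => 0 := h
    rw [this.fderiv_eq]; simp
  rw [fderiv_clm_apply hP hX] at h1
  have := congrArg (fun L => L v) h1
  simp only [add_apply, ContinuousLinearMap.comp_apply,
    ContinuousLinearMap.flip_apply, zero_apply] at this
  exact eq_neg_of_add_eq_zero_left this

/-- Differentiating `P X = 0` trades the derivative of `X` for that of `P`. The derivatives of the
sections thus drop out: modulo the distribution the bracket is a tensor. -/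
theorem apply_lieBracket_eq_curv {P : E → E →L[ℂ] F} {X Y : E → E} {z : E}
    (hP : DifferentiableAt ℂ P z) (hX : DifferentiableAt ℂ X z) (hY : DifferentiableAt ℂ Y z)
    (hPX : ∀ᶠ w in 𝓝 z, P w (X w) = 0) (hPY : ∀ᶠ w in 𝓝 z, P w (Y w) = 0) :
    P z (VectorField.lieBracket ℂ X Y z) = curv P z (X z) (Y z) := by
  rw [VectorField.lieBracket, map_sub, fderiv_clm_apply_of_eventually_zero hP hX hPX,
    fderiv_clm_apply_of_eventually_zero hP hY hPY, curv_apply]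
  abel

/-- The pullback of a one-form. -/
noncomputable def pullForm (Ψ : E' → E) (P : E → E →L[ℂ] F) (x : E') : E' →L[ℂ] F :=
  (P (Ψ x)).comp (fderiv ℂ Ψ x)

theorem analyticAt_pullForm [CompleteSpace E] {Ψ : E' → E} {P : E → E →L[ℂ] F} {x : E'}
    (hP : AnalyticAt ℂ P (Ψ x)) (hΨ : AnalyticAt ℂ Ψ x) : AnalyticAt ℂ (pullForm Ψ P) x :=
  analyticAt_clm_comp (hP.comp hΨ) hΨ.fderiv

/-- Exterior differentiation commutes with pull-back: the second derivative of `Ψ` is symmetric and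
cancels. -/
theorem curv_pullForm [CompleteSpace E] {Ψ : E' → E} {P : E → E →L[ℂ] F} {x : E'}
    (hP : DifferentiableAt ℂ P (Ψ x)) (hΨ : AnalyticAt ℂ Ψ x) (v w : E') :
    curv (pullForm Ψ P) x v w = curv P (Ψ x) (fderiv ℂ Ψ x v) (fderiv ℂ Ψ x w) := by
  have h1 : HasFDerivAt (fun y => P (Ψ y)) ((fderiv ℂ P (Ψ x)).comp (fderiv ℂ Ψ x)) x :=
    hP.hasFDerivAt.comp x hΨ.differentiableAt.hasFDerivAt
  have h2 := h1.clm_comp hΨ.fderiv.differentiableAt.hasFDerivAt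
  have h3 : IsSymmSndFDerivAt ℂ Ψ x :=
    hΨ.contDiffAt.isSymmSndFDerivAt (n := ω) (by simp)
  have h4 : fderiv ℂ (pullForm Ψ P) x = _ := h2.fderiv
  have h5 := h3 v w
  rw [curv_apply, curv_apply, h4]
  simp [h5]

end Curvature

/-! ### Curvature as the obstruction to involutivity; Cauchy characteristics. -/

section CurvatureOfDistributions

variable {E F F' : Type*} [NormedAddCommGroup E] [NormedSpace ℂ E] [FiniteDimensional ℂ E]
  [CompleteSpace E]
  [NormedAddCommGroup F] [NormedSpace ℂ F] [FiniteDimensional ℂ F] [CompleteSpace F]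
  [NormedAddCommGroup F'] [NormedSpace ℂ F'] [FiniteDimensional ℂ F'] [CompleteSpace F']

theorem IsCoframeAt.apply_lieBracket {P : E → E →L[ℂ] F} {D : E → Submodule ℂ E} {z : E}
    (h : IsCoframeAt P D z) {X Y : E → E} (hX : IsSec D X z) (hY : IsSec D Y z) :
    P z (VectorField.lieBracket ℂ X Y z) = curv P z (X z) (Y z) :=
  apply_lieBracket_eq_curv h.analyticAt.differentiableAt hX.1.differentiableAt
    hY.1.differentiableAt (h.eventually_apply_eq_zero hX) (h.eventually_apply_eq_zero hY)

theorem IsCoframeAt.lieBracket_mem_iff {P : E → E →L[ℂ] F} {D : E → Submodule ℂ E} {z : E}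
    (h : IsCoframeAt P D z) {X Y : E → E} (hX : IsSec D X z) (hY : IsSec D Y z) :
    VectorField.lieBracket ℂ X Y z ∈ D z ↔ curv P z (X z) (Y z) = 0 := by
  rw [h.mem_iff.self_of_nhds, h.apply_lieBracket hX hY]

/-- The curvature of a distribution vanishes on vectors of an involutive subdistribution. -/
theorem curv_eq_zero_of_le {P : E → E →L[ℂ] F} {P' : E → E →L[ℂ] F'} {C D : E → Submodule ℂ E}
    {z : E} (hC : IsCoframeAt P C z) (hD : IsCoframeAt P' D z) (hDC : ∀ᶠ w in 𝓝 z, D w ≤ C w)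
    {v w : E} (hv : v ∈ D z) (hw : w ∈ D z) (h0 : curv P' z v w = 0) : curv P z v w = 0 := by
  obtain ⟨X, hX, rfl⟩ := hD.isDistAt.exists_sec hv
  obtain ⟨Y, hY, rfl⟩ := hD.isDistAt.exists_sec hw
  rw [← hC.lieBracket_mem_iff (hX.mono hDC) (hY.mono hDC)]
  exact hDC.self_of_nhds ((hD.lieBracket_mem_iff hX hY).2 h0)

/-- Brackets of Cauchy characteristic fields are Cauchy characteristic. -/
theorem lieBracket_cauchy {P : E → E →L[ℂ] F} {C D : E → Submodule ℂ E}
    {z₀ : E} (hC : IsCoframeAt P C z₀) (hDC : ∀ᶠ z in 𝓝 z₀, D z ≤ C z)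
    (hch : ∀ᶠ z in 𝓝 z₀, ∀ v ∈ D z, ∀ c ∈ C z, curv P z v c = 0) :
    ∀ᶠ z in 𝓝 z₀, ∀ X Y, IsSec D X z → IsSec D Y z →
      VectorField.lieBracket ℂ X Y z ∈ C z ∧
      ∀ c ∈ C z, curv P z (VectorField.lieBracket ℂ X Y z) c = 0 := by
  have key : ∀ᶠ z in 𝓝 z₀, ∀ X Z, IsSec D X z → IsSec C Z z →
      IsSec C (VectorField.lieBracket ℂ X Z) z := by
    filter_upwards [hC.eventually.eventually_nhds, hDC.eventually_nhds, hch.eventually_nhds]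
      with z h1 h2 h3 X Z hX hZ
    refine IsSec.lieBracket hX.1 hZ.1 ?_
    filter_upwards [h1, h2.eventually_nhds, h3, hX.eventually, hZ.eventually] with w a b c d e
    rw [a.lieBracket_mem_iff (d.mono b) e]
    exact c _ d.mem _ e.mem
  filter_upwards [hC.eventually, hDC.eventually_nhds, key, hch] with z h1 h2 h3 h4 X Y hX hY
  have hXY := h3 X Y hX (hY.mono h2)
  refine ⟨hXY.mem, fun c hc => ?_⟩
  obtain ⟨Z, hZ, rfl⟩ := h1.isDistAt.exists_sec hc
  rw [← h1.lieBracket_mem_iff hXY hZ]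
  -- Jacobi: `[[X, Y], Z] = [X, [Y, Z]] - [Y, [X, Z]]`, and bracketing with `X` or `Y` preserves
  -- sections of `C`.
  have hL := VectorField.leibniz_identity_lieBracket (𝕜 := ℂ) (n := ω) (by simp)
    hX.1.contDiffAt hY.1.contDiffAt hZ.1.contDiffAt
  rw [eq_sub_of_add_eq hL.symm]
  exact sub_mem (h3 X _ hX (h3 Y Z hY hZ)).mem (h3 Y _ hY (h3 X Z hX hZ)).mem

end CurvatureOfDistributions
end LeviCR

namespace LeviCR

set_option linter.unusedSectionVars false

/-! ## The Frobenius theorem for holomorphic distributions -/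

section Nemytskii

variable {α E F : Type*} [TopologicalSpace α] [CompactSpace α]
  [NormedAddCommGroup E] [NormedSpace ℂ E] [NormedAddCommGroup F] [NormedSpace ℂ F]

/-- The multilinear map `(m₁, …, mₙ) ↦ (t ↦ p (m₁ t, …, mₙ t))`. -/
noncomputable def pointwiseMultilinear {n : ℕ} (p : E [×n]→L[ℂ] F) : C(α, E) [×n]→L[ℂ] C(α, F) :=
  MultilinearMap.mkContinuous
    { toFun := fun m => ⟨fun t => p fun i => m i t, by fun_prop⟩
      map_update_add' := by
        intro _ m i x y
        ext t
        have : ∀ z : C(α, E), (fun j => (Function.update m i z) j t) =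
            Function.update (fun j => m j t) i (z t) := by
          intro z; ext j; by_cases h : j = i
          · subst h; simp
          · simp [h]
        simp [this]
      map_update_smul' := by
        intro _ m i c x
        ext t
        have : ∀ z : C(α, E), (fun j => (Function.update m i z) j t) =
            Function.update (fun j => m j t) i (z t) := by
          intro z; ext j; by_cases h : j = i
          · subst h; simp
          · simp [h]
        simp [this] }
    ‖p‖ (by
      intro m
      rw [ContinuousMap.norm_le _ (by positivity)]
      intro t
      refine (p.le_opNorm _).trans ?_
      gcongr with i
      exact (m i).norm_coe_le_norm t)

theorem norm_pointwiseMultilinear_le {n : ℕ} (p : E [×n]→L[ℂ] F) :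
    ‖(pointwiseMultilinear p : C(α, E) [×n]→L[ℂ] C(α, F))‖ ≤ ‖p‖ :=
  MultilinearMap.mkContinuous_norm_le _ (norm_nonneg _) _

/-- The superposition operator of an analytic map is analytic. -/
theorem exists_analytic_superposition [CompleteSpace F] {f : E → F} {x₀ : E}
    (hf : AnalyticAt ℂ f x₀) :
    ∃ N : C(α, E) → C(α, F), AnalyticAt ℂ N (ContinuousMap.const α x₀) ∧
      ∀ᶠ c in 𝓝 (ContinuousMap.const α x₀), ∀ t, N c t = f (c t) := by
  classical
  obtain ⟨p, r, hp⟩ := hf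
  let q : FormalMultilinearSeries ℂ C(α, E) C(α, F) := fun n => pointwiseMultilinear (p n)
  -- Far from the constant curve `f ∘ c` need not be continuous; the value `0` there is arbitrary
  -- and plays no role in the germ.
  let N : C(α, E) → C(α, F) := fun c =>
    if h : Continuous (fun t => f (c t)) then ⟨fun t => f (c t), h⟩ else 0
  have hrad : r ≤ q.radius := hp.r_le.trans
    (FormalMultilinearSeries.radius_le_of_le fun n => norm_pointwiseMultilinear_le (p n))
  have hpt : ∀ c : C(α, E), c ∈ Metric.eball (0 : C(α, E)) r → ∀ t,
      HasSum (fun n => p n fun _ => c t) (f (x₀ + c t)) := by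
    intro c hc t
    apply hp.hasSum
    rw [mem_eball_zero_iff] at hc ⊢
    refine lt_of_le_of_lt ?_ hc
    rw [enorm_le_iff_norm_le]
    exact c.norm_coe_le_norm t
  have hsum : ∀ c : C(α, E), c ∈ Metric.eball (0 : C(α, E)) r →
      ∃ g : C(α, F), HasSum (fun n => q n fun _ => c) g ∧ ∀ t, g t = f (x₀ + c t) := by
    intro c hc
    have hs : Summable (fun n => q n fun _ => c) :=
      q.summable (Metric.eball_subset_eball hrad hc)
    refine ⟨_, hs.hasSum, fun t => ?_⟩
    have h1 := (ContinuousMap.evalCLM ℂ t : C(α, F) →L[ℂ] F).hasSum hs.hasSum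
    exact h1.unique (hpt c hc t)
  have hN : ∀ c : C(α, E), c ∈ Metric.eball (0 : C(α, E)) r →
      ∀ t, N (ContinuousMap.const α x₀ + c) t = f (x₀ + c t) := by
    intro c hc t
    obtain ⟨g, -, hg⟩ := hsum c hc
    have : Continuous (fun t => f ((ContinuousMap.const α x₀ + c) t)) := by
      convert g.continuous using 2 with t
      rw [hg]; rfl
    simp only [N, this, dif_pos]
    rfl
  refine ⟨N, ⟨q, r, hrad, hp.r_pos, fun {c} hc => ?_⟩, ?_⟩
  · obtain ⟨g, hg, hgt⟩ := hsum c hc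
    have e : N (ContinuousMap.const α x₀ + c) = g := by
      ext t
      rw [hN c hc, hgt]
    rw [e]; exact hg
  · filter_upwards [Metric.eball_mem_nhds (ContinuousMap.const α x₀) hp.r_pos] with c hc t
    have := hN (c - ContinuousMap.const α x₀) (by
      rw [mem_eball_zero_iff]; rwa [Metric.mem_eball, edist_eq_enorm_sub] at hc) t
    simpa using this

/-- Evaluation at `t` is continuous and linear, so the derivative of the operator is found by the
chain rule at each `t` separately. -/
theorem fderiv_superposition [CompleteSpace F] {f : E → F} {x₀ : E} {N : C(α, E) → C(α, F)}
    (hf : AnalyticAt ℂ f x₀) (hN : AnalyticAt ℂ N (ContinuousMap.const α x₀))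
    (h : ∀ᶠ c in 𝓝 (ContinuousMap.const α x₀), ∀ t, N c t = f (c t)) :
    ∀ᶠ c in 𝓝 (ContinuousMap.const α x₀), ∀ k t, fderiv ℂ N c k t = fderiv ℂ f (c t) (k t) := by
  have hfd : ∀ᶠ c in 𝓝 (ContinuousMap.const α x₀), ∀ t, DifferentiableAt ℂ f (c t) := by
    obtain ⟨ε, hε, hb⟩ := Metric.eventually_nhds_iff.1 hf.eventually_analyticAt
    filter_upwards [Metric.ball_mem_nhds (ContinuousMap.const α x₀) hε] with c hc t
    exact (hb (lt_of_le_of_lt (ContinuousMap.dist_apply_le_dist (f := c)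
      (g := ContinuousMap.const α x₀) t) hc)).differentiableAt
  filter_upwards [h.eventually_nhds, hN.eventually_analyticAt, hfd] with c h1 h2 h3 k t
  let ev : C(α, F) →L[ℂ] F := ContinuousMap.evalCLM ℂ t
  let ev' : C(α, E) →L[ℂ] E := ContinuousMap.evalCLM ℂ t
  have e1 : HasFDerivAt (fun c => ev (N c)) (ev.comp (fderiv ℂ N c)) c :=
    ev.hasFDerivAt.comp c h2.differentiableAt.hasFDerivAt
  have e2 : HasFDerivAt (fun c => f (ev' c)) ((fderiv ℂ f (c t)).comp ev') c :=
    HasFDerivAt.comp c (h3 t).hasFDerivAt ev'.hasFDerivAt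
  have e3 : (fun c => ev (N c)) =ᶠ[𝓝 c] fun c => f (ev' c) := by
    filter_upwards [h1] with c' hc' using hc' t
  exact congrArg (fun L => L k) (e1.unique (e2.congr_of_eventuallyEq e3))

end Nemytskii

/-! ### Implicit function theorem in Banach spaces. -/

section Implicit

variable {C P : Type*} [NormedAddCommGroup C] [NormedSpace ℂ C] [CompleteSpace C]
  [NormedAddCommGroup P] [NormedSpace ℂ P] [CompleteSpace P]

/-- The analytic implicit function theorem at the origin. -/
theorem exists_analytic_implicit {Φ : C × P → C} (hΦ : AnalyticAt ℂ Φ 0) (h0 : Φ 0 = 0)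
    (hd : ∀ c : C, fderiv ℂ Φ 0 (c, 0) = c) :
    ∃ y : P → C, AnalyticAt ℂ y 0 ∧ y 0 = 0 ∧ ∀ᶠ p in 𝓝 0, Φ (y p, p) = 0 := by
  let L := fderiv ℂ Φ 0
  let B : P →L[ℂ] C := L.comp (ContinuousLinearMap.inr ℂ C P)
  have hL : ∀ c p, L (c, p) = c + B p := by
    intro c p
    have : ((c, p) : C × P) = (c, 0) + (0, p) := by simp
    rw [this, map_add]
    exact congrArg₂ _ (hd c) rfl
  let e : (C × P) ≃L[ℂ] (C × P) := ContinuousLinearEquiv.equivOfInverse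
    (L.prod (ContinuousLinearMap.snd ℂ C P))
    ((ContinuousLinearMap.fst ℂ C P - B.comp (ContinuousLinearMap.snd ℂ C P)).prod
      (ContinuousLinearMap.snd ℂ C P))
    (fun x => by ext <;> simp [hL]) (fun x => by ext <;> simp [hL])
  let Ψ : C × P → C × P := fun x => (Φ x, x.2)
  have hΨ : AnalyticAt ℂ Ψ 0 := hΦ.prod analyticAt_snd
  have hΨ' : HasFDerivAt Ψ (e : C × P →L[ℂ] C × P) 0 :=
    hΦ.differentiableAt.hasFDerivAt.prodMk hasFDerivAt_snd
  have hc : ContDiffAt ℂ ω Ψ 0 := hΨ.contDiffAt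
  have hΨ0 : Ψ 0 = 0 := by simp [Ψ, h0]
  let g := hc.localInverse hΨ' (by simp)
  have hg : AnalyticAt ℂ g 0 := by
    have := hc.to_localInverse hΨ' (by simp)
    rw [hΨ0] at this
    exact this.analyticAt
  have hg0 : g 0 = 0 := by
    have := hc.localInverse_apply_image hΨ' (by simp)
    rwa [hΨ0] at this
  have hr : ∀ᶠ q in 𝓝 (0 : C × P), Ψ (g q) = q := by
    have := (hc.hasStrictFDerivAt' hΨ' (by simp)).eventually_right_inverse
    rwa [hΨ0] at this
  have hi : AnalyticAt ℂ (fun p : P => ((0, p) : C × P)) 0 := analyticAt_const.prod analyticAt_id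
  have hi0 : ((0, (0 : P)) : C × P) = 0 := rfl
  refine ⟨fun p => (g (0, p)).1, ?_, by simp [hi0, hg0], ?_⟩
  · exact (analyticAt_fst).comp (AnalyticAt.fun_comp (by exact hg) hi)
  · have := hi.continuousAt.eventually hr
    filter_upwards [this] with p hp
    have h2 : (g (0, p)).2 = p := congrArg Prod.snd hp
    have h1 : Φ (g (0, p)) = 0 := congrArg Prod.fst hp
    have : ((g (0, p)).1, p) = g (0, p) := Prod.ext rfl h2.symm
    rw [this, h1]

end Implicit

/-! ### Integration of a graph distribution along rays. -/

section Frobenius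

variable {U F : Type*} [NormedAddCommGroup U] [NormedSpace ℂ U] [CompleteSpace U]
  [NormedAddCommGroup F] [NormedSpace ℂ F] [CompleteSpace F]

/-- The primitive of the restriction of `c` to `[0, 1]`, extended by constants. -/
noncomputable def primitive (c : C(unitInterval, F)) (t : ℝ) : F :=
  ∫ s in (0 : ℝ)..t, c (Set.projIcc 0 1 zero_le_one s)

theorem hasDerivAt_primitive (c : C(unitInterval, F)) (t : ℝ) :
    HasDerivAt (primitive c) (c (Set.projIcc 0 1 zero_le_one t)) t := by
  have hc : Continuous fun s => c (Set.projIcc 0 1 zero_le_one s) := by fun_prop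
  exact intervalIntegral.integral_hasDerivAt_right (hc.intervalIntegrable _ _)
    (hc.stronglyMeasurableAtFilter _ _) hc.continuousAt

theorem primitive_zero (c : C(unitInterval, F)) : primitive c 0 = 0 := by simp [primitive]

/-- Integration from `0` as an operator on `C([0, 1], F)`. -/
noncomputable def integralOp (F : Type*) [NormedAddCommGroup F] [NormedSpace ℂ F]
    [CompleteSpace F] : C(unitInterval, F) →L[ℂ] C(unitInterval, F) :=
  LinearMap.mkContinuous
    { toFun := fun c => ⟨fun t => primitive c t, by
        have : Continuous (primitive c) :=
          continuous_iff_continuousAt.2 fun t => (hasDerivAt_primitive c t).continuousAt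
        fun_prop⟩
      map_add' := by
        intro c d
        ext t
        have h : ∀ c : C(unitInterval, F), Continuous fun s => c (Set.projIcc 0 1 zero_le_one s) :=
          fun c => by fun_prop
        exact intervalIntegral.integral_add ((h c).intervalIntegrable _ _)
          ((h d).intervalIntegrable _ _)
      map_smul' := by
        intro z c
        ext t
        exact intervalIntegral.integral_smul z _ }
    1 (by
      intro c
      rw [one_mul, ContinuousMap.norm_le _ (norm_nonneg _)]
      intro t
      have := intervalIntegral.norm_integral_le_of_norm_le_const (a := (0 : ℝ)) (b := t)
        (f := fun s => c (Set.projIcc 0 1 zero_le_one s)) (C := ‖c‖)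
        (fun s _ => c.norm_coe_le_norm _)
      refine this.trans ?_
      have h1 : |(t : ℝ) - 0| ≤ 1 := by
        rw [sub_zero, abs_of_nonneg t.2.1]; exact t.2.2
      exact mul_le_of_le_one_right (norm_nonneg _) h1)

theorem integralOp_apply (c : C(unitInterval, F)) (t : unitInterval) :
    integralOp F c t = primitive c t := rfl

/-- The map `(c, p) ↦ (t ↦ (p.1, (t p.1, c t)))`. -/
noncomputable def rayCurve (U F : Type*) [NormedAddCommGroup U] [NormedSpace ℂ U]
    [NormedAddCommGroup F] [NormedSpace ℂ F] :
    C(unitInterval, F) × (U × F) →L[ℂ] C(unitInterval, U × (U × F)) :=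
  LinearMap.mkContinuous
    { toFun := fun x => ⟨fun t => (x.2.1, (((t : ℝ) : ℂ) • x.2.1, x.1 t)), by fun_prop⟩
      map_add' := by intro x y; ext t <;> simp
      map_smul' := by intro c x; ext t <;> simp [smul_comm c] }
    1 (by
      intro x
      rw [one_mul, ContinuousMap.norm_le _ (norm_nonneg _)]
      intro t
      have h1 : ‖x.2.1‖ ≤ ‖x‖ := (norm_fst_le _).trans (norm_snd_le _)
      have h2 : ‖((t : ℝ) : ℂ) • x.2.1‖ ≤ ‖x‖ := by
        rw [norm_smul, Complex.norm_real, Real.norm_of_nonneg t.2.1]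
        exact (mul_le_of_le_one_left (norm_nonneg _) t.2.2).trans h1
      have h3 : ‖x.1 t‖ ≤ ‖x‖ := (x.1.norm_coe_le_norm t).trans (norm_fst_le _)
      exact max_le h1 (max_le h2 h3))

theorem rayCurve_apply (x : C(unitInterval, F) × (U × F)) (t : unitInterval) :
    rayCurve U F x t = (x.2.1, (((t : ℝ) : ℂ) • x.2.1, x.1 t)) := rfl

/-- Constant curves. -/
noncomputable def constCurve (F : Type*) [NormedAddCommGroup F] [NormedSpace ℂ F] :
    F →L[ℂ] C(unitInterval, F) :=
  LinearMap.mkContinuous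
    { toFun := fun y => ContinuousMap.const _ y
      map_add' := fun _ _ => rfl
      map_smul' := fun _ _ => rfl }
    1 (by
      intro y
      rw [one_mul, ContinuousMap.norm_le _ (norm_nonneg _)]
      exact fun t => le_rfl)

/-- Solution of the family of ray equations `Y' = a (t x, Y) x`, `Y 0 = y`, together with its
derivative with respect to the parameters. -/
theorem exists_ray_solution {a : U × F → U →L[ℂ] F} (ha : AnalyticAt ℂ a 0) :
    ∃ Y : U × F → C(unitInterval, F), AnalyticAt ℂ Y 0 ∧ Y 0 = 0 ∧
      ∀ᶠ p in 𝓝 (0 : U × F),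
        (∃ g : C(unitInterval, F), (∀ t, g t = a ((t : ℂ) • p.1, Y p t) p.1) ∧
          ∀ t : unitInterval, Y p t = p.2 + primitive g t) ∧
        ∀ u : U, ∃ g : C(unitInterval, F),
          (∀ t, g t = a ((t : ℂ) • p.1, Y p t) u +
            fderiv ℂ a ((t : ℂ) • p.1, Y p t) ((t : ℂ) • u, fderiv ℂ Y p (u, 0) t) p.1) ∧
          ∀ t : unitInterval, fderiv ℂ Y p (u, 0) t = primitive g t := by
  let f : U × (U × F) → F := fun x => a x.2 x.1
  have hf : AnalyticAt ℂ f 0 :=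
    analyticAt_clm_apply (AnalyticAt.fun_comp (x := (0 : U × (U × F))) (by exact ha) analyticAt_snd)
      analyticAt_fst
  have hf' : ∀ x : U × (U × F), DifferentiableAt ℂ a x.2 → ∀ v : U × (U × F),
      fderiv ℂ f x v = a x.2 v.1 + fderiv ℂ a x.2 v.2 x.1 := by
    intro x hx v
    have h1 : HasFDerivAt (fun x : U × (U × F) => a x.2)
      ((fderiv ℂ a x.2).comp (ContinuousLinearMap.snd ℂ U (U × F))) x :=
      hx.hasFDerivAt.comp x hasFDerivAt_snd
    have h2 := h1.clm_apply hasFDerivAt_fst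
    rw [h2.fderiv]
    simp
  obtain ⟨N, hN, hNf⟩ := exists_analytic_superposition (α := unitInterval) hf
  have hN' := fderiv_superposition hf hN hNf
  -- A zero of `Φ` is a solution of the integral form `c(t) = y + ∫₀ᵗ a(s x, c(s)) x ds` of the ray
  -- equation. The implicit function theorem then gives solvability and analytic dependence on `(x,
  -- y)` at once.
  let Φ : C(unitInterval, F) × (U × F) → C(unitInterval, F) := fun x =>
    x.1 - constCurve F x.2.2 - integralOp F (N (rayCurve U F x))
  have h00 : rayCurve U F 0 = ContinuousMap.const _ 0 := by rw [map_zero]; rfl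
  have hray : ContinuousAt (rayCurve U F) 0 := (rayCurve U F).continuous.continuousAt
  have hNray : AnalyticAt ℂ (fun x => N (rayCurve U F x)) 0 :=
    AnalyticAt.fun_comp (by rw [h00]; exact hN) ((rayCurve U F).analyticAt 0)
  have hΦ : AnalyticAt ℂ Φ 0 := by
    refine (analyticAt_fst.sub ?_).sub ?_
    · exact ((constCurve F).analyticAt _).fun_comp (analyticAt_snd.fun_comp analyticAt_snd)
    · exact ((integralOp F).analyticAt _).fun_comp hNray
  have hN0 : N (ContinuousMap.const _ 0) = 0 := by
    ext t
    rw [hNf.self_of_nhds t]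
    simp [f]
  have hΦ0 : Φ 0 = 0 := by
    simp only [Φ, h00, hN0]; simp
  have hΦ' : ∀ x, AnalyticAt ℂ N (rayCurve U F x) → HasFDerivAt Φ
      (ContinuousLinearMap.fst ℂ _ _ - (constCurve F).comp ((ContinuousLinearMap.snd ℂ U F).comp
        (ContinuousLinearMap.snd ℂ C(unitInterval, F) (U × F))) -
        (integralOp F).comp ((fderiv ℂ N (rayCurve U F x)).comp (rayCurve U F))) x := by
    intro x hx
    refine (hasFDerivAt_fst.sub ?_).sub ?_
    · exact (constCurve F).hasFDerivAt.comp x (hasFDerivAt_snd.comp x hasFDerivAt_snd)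
    · exact (integralOp F).hasFDerivAt.comp x
        (hx.differentiableAt.hasFDerivAt.comp x (rayCurve U F).hasFDerivAt)
  -- The integrand is linear in `x`, and `x = 0` at the base point, so the integral term does not
  -- contribute to the derivative in `c`.
  have hd : ∀ c, fderiv ℂ Φ 0 (c, 0) = c := by
    intro c
    rw [(hΦ' 0 (by rw [h00]; exact hN)).fderiv, h00]
    have : fderiv ℂ N (ContinuousMap.const _ 0) (rayCurve U F (c, 0)) = 0 := by
      ext t
      rw [hN'.self_of_nhds]
      have e := hf' 0 ha.differentiableAt (rayCurve U F (c, 0) t)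
      rw [rayCurve_apply] at e
      simpa [rayCurve_apply] using e
    simp only [sub_apply, ContinuousLinearMap.comp_apply, this]
    simp
  obtain ⟨Y, hY, hY0, hYΦ⟩ := exists_analytic_implicit hΦ hΦ0 hd
  refine ⟨Y, hY, hY0, ?_⟩
  -- near the origin the curves stay in the domain of the superposition operator
  have hcont : Filter.Tendsto (fun p => rayCurve U F (Y p, p)) (𝓝 0)
      (𝓝 (ContinuousMap.const _ 0)) := by
    have h1 : ContinuousAt (fun p => (Y p, p)) 0 := hY.continuousAt.prodMk continuousAt_id
    have h2 : (fun p => (Y p, p)) 0 = 0 := by simp [hY0]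
    rw [← h00, ← h2]
    exact ((rayCurve U F).continuous.tendsto _).comp h1
  have hea : ∀ᶠ c in 𝓝 (ContinuousMap.const unitInterval (0 : U × (U × F))), ∀ t,
      AnalyticAt ℂ a (c t).2 := by
    obtain ⟨ε, hε, hb⟩ := Metric.eventually_nhds_iff.1 ha.eventually_analyticAt
    filter_upwards [Metric.ball_mem_nhds (ContinuousMap.const unitInterval (0 : U × (U × F))) hε]
      with c hc t
    refine hb (lt_of_le_of_lt ?_ hc)
    refine le_trans ?_ (ContinuousMap.dist_apply_le_dist t)
    exact le_max_right _ _
  have hYeq : ∀ᶠ p in 𝓝 (0 : U × F),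
      Y p = constCurve F p.2 + integralOp F (N (rayCurve U F (Y p, p))) := by
    filter_upwards [hYΦ] with p hp
    have : Y p - constCurve F p.2 - integralOp F (N (rayCurve U F (Y p, p))) = 0 := hp
    rw [sub_sub, sub_eq_zero] at this
    exact this
  filter_upwards [hYeq.eventually_nhds, hY.eventually_analyticAt,
    hcont.eventually (hNf.and (hN'.and (hN.eventually_analyticAt.and hea)))]
    with p h1 h2 ⟨h3, h4, h5, h6⟩
  refine ⟨⟨N (rayCurve U F (Y p, p)), fun t => h3 t, fun t => ?_⟩, fun u => ?_⟩
  · have := congrArg (fun c => c t) h1.self_of_nhds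
    exact this
  · have e1 : HasFDerivAt (fun p => rayCurve U F (Y p, p))
        ((rayCurve U F).comp ((fderiv ℂ Y p).prod (ContinuousLinearMap.id ℂ (U × F)))) p :=
      (rayCurve U F).hasFDerivAt.comp p (h2.differentiableAt.hasFDerivAt.prodMk (hasFDerivAt_id p))
    have e2 : HasFDerivAt (fun p : U × F => constCurve F p.2 + integralOp F (N (rayCurve U F (Y p, p))))
        ((constCurve F).comp (ContinuousLinearMap.snd ℂ U F) +
          (integralOp F).comp ((fderiv ℂ N (rayCurve U F (Y p, p))).comp
          ((rayCurve U F).comp ((fderiv ℂ Y p).prod (ContinuousLinearMap.id ℂ (U × F)))))) p :=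
      ((constCurve F).hasFDerivAt.comp p hasFDerivAt_snd).add
        ((integralOp F).hasFDerivAt.comp p (HasFDerivAt.comp p h5.differentiableAt.hasFDerivAt e1))
    have e3 := (e2.congr_of_eventuallyEq h1).fderiv
    refine ⟨fderiv ℂ N (rayCurve U F (Y p, p)) (rayCurve U F (fderiv ℂ Y p (u, 0), (u, 0))),
      fun t => ?_, fun t => ?_⟩
    · rw [h4, hf' _ (h6 t).differentiableAt]
      rfl
    · have := congrArg (fun L => L (u, 0) t) e3
      simp only [add_apply, ContinuousLinearMap.comp_apply] at this
      rw [this]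
      simp [integralOp_apply]

/-- The distribution is spanned by the vectors `(u, a(q) u)`, and `hinv` is its integrability
condition. Solving along the ray from `0` to `x` gives the height `φ(x, y)` over `x` of the
candidate leaf through `(0, y)`. Integrability shows that its derivative in `x` is `a(x, φ)`, so
these graphs are tangent to the distribution in all directions, not just the radial one. Inverting
`(x, y) ↦ (x, φ(x, y))` and taking the second component gives a first integral. -/
theorem exists_firstIntegral_graph {a : U × F → U →L[ℂ] F} (ha : AnalyticAt ℂ a 0)
    (hinv : ∀ᶠ q in 𝓝 (0 : U × F), ∀ u x : U,
      fderiv ℂ a q (u, a q u) x = fderiv ℂ a q (x, a q x) u) :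
    ∃ ρ : U × F → F, AnalyticAt ℂ ρ 0 ∧
      (∀ᶠ q in 𝓝 (0 : U × F), ∀ u, fderiv ℂ ρ q (u, a q u) = 0) ∧
      ∀ v, fderiv ℂ ρ 0 (0, v) = v := by
  obtain ⟨Y, hY, hY0, hray⟩ := exists_ray_solution ha
  let ev : C(unitInterval, F) →L[ℂ] F := ContinuousMap.evalCLM ℂ 1
  let φ : U × F → F := fun p => Y p 1
  have hφ : AnalyticAt ℂ φ 0 := (ev.analyticAt _).fun_comp hY
  have hφ' : ∀ p, AnalyticAt ℂ Y p → ∀ w, fderiv ℂ φ p w = fderiv ℂ Y p w 1 := by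
    intro p hp w
    have : HasFDerivAt φ (ev.comp (fderiv ℂ Y p)) p :=
      ev.hasFDerivAt.comp p hp.differentiableAt.hasFDerivAt
    rw [this.fderiv]; rfl
  -- the rays stay in a neighbourhood of the origin
  obtain ⟨M, hM⟩ : ∃ M : ℝ, ∀ᶠ q in 𝓝 (0 : U × F), ‖fderiv ℂ a q‖ ≤ M :=
    ⟨‖fderiv ℂ a 0‖ + 1, (ha.fderiv.continuousAt.norm.eventually
      (gt_mem_nhds (lt_add_one ‖fderiv ℂ a 0‖))).mono fun _ h => le_of_lt h⟩
  have hgood : ∀ᶠ p in 𝓝 (0 : U × F), ∀ t : unitInterval,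
      AnalyticAt ℂ a ((((t : ℝ) : ℂ)) • p.1, Y p t) ∧
      ‖fderiv ℂ a ((((t : ℝ) : ℂ)) • p.1, Y p t)‖ ≤ M ∧
      (∀ u x : U, fderiv ℂ a ((((t : ℝ) : ℂ)) • p.1, Y p t)
          (u, a ((((t : ℝ) : ℂ)) • p.1, Y p t) u) x =
        fderiv ℂ a ((((t : ℝ) : ℂ)) • p.1, Y p t)
          (x, a ((((t : ℝ) : ℂ)) • p.1, Y p t) x) u) := by
    obtain ⟨ε, hε, hb⟩ := Metric.eventually_nhds_iff.1
      (ha.eventually_analyticAt.and (hM.and hinv))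
    have h1 : ∀ᶠ p in 𝓝 (0 : U × F), ‖p‖ < ε := by
      filter_upwards [Metric.ball_mem_nhds (0 : U × F) hε] with p hp using by simpa using hp
    have h2 : ∀ᶠ p in 𝓝 (0 : U × F), ‖Y p‖ < ε := by
      have := hY.continuousAt.norm
      rw [ContinuousAt, hY0, norm_zero] at this
      exact this.eventually (gt_mem_nhds hε)
    filter_upwards [h1, h2] with p h1 h2 t
    refine hb ?_
    rw [dist_zero_right]
    refine max_lt ?_ (lt_of_le_of_lt ((Y p).norm_coe_le_norm t) h2)
    change ‖((t : ℝ) : ℂ) • p.1‖ < ε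
    rw [norm_smul, Complex.norm_real, Real.norm_of_nonneg t.2.1]
    exact lt_of_le_of_lt (mul_le_of_le_one_left (norm_nonneg _) t.2.2)
      (lt_of_le_of_lt (norm_fst_le _) h1)
  -- the derivative of the flow in the direction of the first factor
  have hkey : ∀ᶠ p in 𝓝 (0 : U × F), ∀ u, fderiv ℂ φ p (u, 0) = a (p.1, φ p) u := by
    filter_upwards [hray, hgood, hY.eventually_analyticAt] with p ⟨⟨g, hg, hYg⟩, hd⟩ h2 h3 u
    obtain ⟨k, hk, hYk⟩ := hd u
    let Z : ℝ → F := fun t => p.2 + primitive g t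
    have hZ : ∀ t : unitInterval, Z t = Y p t := fun t => (hYg t).symm
    let q : ℝ → U × F := fun t => ((t : ℂ) • p.1, Z t)
    have hproj : ∀ t : unitInterval, Set.projIcc (0 : ℝ) 1 zero_le_one (t : ℝ) = t :=
      fun t => Set.projIcc_val zero_le_one t
    have hq : ∀ t : unitInterval, HasDerivAt q (p.1, a (q t) p.1) t := by
      intro t
      have e1 : HasDerivAt (fun s : ℝ => (s : ℂ) • p.1) p.1 (t : ℝ) := by
        have := (Complex.ofRealCLM.hasDerivAt (x := (t : ℝ))).smul_const p.1
        simpa using this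
      have e2 : HasDerivAt Z (g t) (t : ℝ) := by
        have := (hasDerivAt_primitive g t).const_add p.2
        rwa [hproj] at this
      have e3 := e1.prodMk e2
      rw [hg t] at e3
      simp only [q, hZ]
      exact e3
    -- The defect between the variation of the ray solution in the direction `u` and the slope
    -- required of a leaf. By `hinv` it solves the homogeneous linear equation `W' = Da(0, W) x`; as
    -- `W 0 = 0`, it vanishes by a Grönwall argument.
    let W : ℝ → F := fun t => primitive k t - a (q t) ((t : ℂ) • u)
    have hW : ∀ t : unitInterval, HasDerivAt W (fderiv ℂ a (q t) (0, W t) p.1) t := by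
      intro t
      have hqt : q t = (((t : ℝ) : ℂ) • p.1, Y p t) := by simp only [q, hZ]
      obtain ⟨g1, -, g3⟩ := h2 t
      rw [← hqt] at g1 g3
      have e1 : HasDerivAt (primitive k) (k t) (t : ℝ) := by
        have := hasDerivAt_primitive k t
        rwa [hproj] at this
      have e2 : HasDerivAt (fun s : ℝ => (s : ℂ) • u) u (t : ℝ) := by
        have := (Complex.ofRealCLM.hasDerivAt (x := (t : ℝ))).smul_const u
        simpa using this
      have e3 : HasDerivAt (fun s => a (q s)) (fderiv ℂ a (q t) (p.1, a (q t) p.1)) (t : ℝ) :=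
        (g1.differentiableAt.hasFDerivAt.restrictScalars ℝ).comp_hasDerivAt (t : ℝ) (hq t)
      have e4 : HasDerivAt (fun s : ℝ => a (q s) ((s : ℂ) • u))
          (fderiv ℂ a (q t) (p.1, a (q t) p.1) (((t : ℝ) : ℂ) • u) + a (q t) u) (t : ℝ) := by
        have hb := ((ContinuousLinearMap.id ℂ (U →L[ℂ] F)).isBoundedBilinearMap.hasFDerivAt
          (a (q t), ((t : ℝ) : ℂ) • u)).restrictScalars ℝ
        have := hb.comp_hasDerivAt (t : ℝ) (e3.prodMk e2)
        rw [add_comm]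
        simpa [Function.comp_def] using this
      have e5 := e1.sub e4
      refine e5.congr_deriv ?_
      rw [hk t, ← hqt, hYk t, g3 p.1]
      have e6 : ((0 : U), W t) = (((t : ℝ) : ℂ) • u, primitive k t) -
          (((t : ℝ) : ℂ) • u, a (q t) (((t : ℝ) : ℂ) • u)) := by
        simp [W]
      rw [e6, map_sub, sub_apply]
      abel
    have hW0 : W 0 = 0 := by simp [W, primitive_zero]
    have hbound : ∀ t : unitInterval, ‖fderiv ℂ a (q t) (0, W t) p.1‖ ≤ (M * ‖p.1‖) * ‖W t‖ := by
      intro t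
      have hqt : q t = (((t : ℝ) : ℂ) • p.1, Y p t) := by simp only [q, hZ]
      obtain ⟨-, g2, -⟩ := h2 t
      rw [← hqt] at g2
      calc ‖fderiv ℂ a (q t) (0, W t) p.1‖ ≤ ‖fderiv ℂ a (q t) (0, W t)‖ * ‖p.1‖ :=
            ContinuousLinearMap.le_opNorm _ _
        _ ≤ (‖fderiv ℂ a (q t)‖ * ‖((0 : U), W t)‖) * ‖p.1‖ := by
            gcongr; exact ContinuousLinearMap.le_opNorm _ _
        _ = (‖fderiv ℂ a (q t)‖ * ‖W t‖) * ‖p.1‖ := by simp [Prod.norm_def]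
        _ ≤ (M * ‖W t‖) * ‖p.1‖ := by gcongr
        _ = _ := by ring
    have hW1 : W 1 = 0 := by
      refine eq_zero_of_abs_deriv_le_mul_abs_self_of_eq_zero_right (a := 0) (b := 1)
        (f' := fun t => fderiv ℂ a (q t) (0, W t) p.1) (K := M * ‖p.1‖) ?_ ?_ hW0 ?_ 1 (by simp)
      · exact fun t ht => (hW ⟨t, ht⟩).continuousAt.continuousWithinAt
      · exact fun t ht => (hW ⟨t, ht.1, ht.2.le⟩).hasDerivWithinAt
      · exact fun t ht => hbound ⟨t, ht.1, ht.2.le⟩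
    have h5 : fderiv ℂ φ p (u, 0) = primitive k 1 := by
      rw [hφ' p h3]
      exact hYk 1
    have h6 : q 1 = (p.1, φ p) := by
      have := hZ 1
      simp only [q, φ]
      rw [← this]; simp
    have h7 : primitive k 1 = a (q 1) (((1 : ℝ) : ℂ) • u) := sub_eq_zero.1 hW1
    rw [h5, h7, h6]
    simp
  have hφ0 : ∀ᶠ y in 𝓝 (0 : F), φ (0, y) = y := by
    have hi : ContinuousAt (fun y : F => ((0 : U), y)) 0 := by fun_prop
    filter_upwards [hi.eventually hray] with y ⟨⟨g, hg, hYg⟩, _⟩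
    have : g = 0 := by
      ext t; rw [hg t]; simp
    have := hYg 1
    simp_all [φ, primitive]
  have hφ2 : ∀ v, fderiv ℂ φ 0 (0, v) = v := by
    intro v
    have h1 : HasFDerivAt (fun y : F => φ (0, y))
        ((fderiv ℂ φ 0).comp (ContinuousLinearMap.inr ℂ U F)) 0 :=
      HasFDerivAt.comp (0 : F) (g := φ) (f := fun y => ((0 : U), y)) hφ.differentiableAt.hasFDerivAt
        (hasFDerivAt_prodMk_right 0 0)
    have h2 : HasFDerivAt (fun y : F => φ (0, y)) (ContinuousLinearMap.id ℂ F) 0 :=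
      (hasFDerivAt_id (0 : F)).congr_of_eventuallyEq hφ0
    exact congrArg (fun L => L v) (h1.unique h2)
  -- straighten the leaves
  let A : U →L[ℂ] F := (fderiv ℂ φ 0).comp (ContinuousLinearMap.inl ℂ U F)
  have hφd : ∀ x : U × F, fderiv ℂ φ 0 x = A x.1 + x.2 := by
    rintro ⟨u, v⟩
    have : ((u, v) : U × F) = (u, 0) + (0, v) := by simp
    rw [this, map_add, hφ2]; simp [A]
  let e : (U × F) ≃L[ℂ] (U × F) := ContinuousLinearEquiv.equivOfInverse
    ((ContinuousLinearMap.fst ℂ U F).prod (fderiv ℂ φ 0))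
    ((ContinuousLinearMap.fst ℂ U F).prod
      (ContinuousLinearMap.snd ℂ U F - A.comp (ContinuousLinearMap.fst ℂ U F)))
    (fun x => by ext <;> simp [hφd]) (fun x => by ext <;> simp [hφd])
  let Ψ : U × F → U × F := fun x => (x.1, φ x)
  have hΨ : AnalyticAt ℂ Ψ 0 := analyticAt_fst.prod hφ
  have hΨ' : HasFDerivAt Ψ (e : U × F →L[ℂ] U × F) 0 :=
    hasFDerivAt_fst.prodMk hφ.differentiableAt.hasFDerivAt
  have hc : ContDiffAt ℂ ω Ψ 0 := hΨ.contDiffAt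
  have hΨ0 : Ψ 0 = 0 := by simp [Ψ, φ, hY0]
  let g := hc.localInverse hΨ' (by simp)
  have hg : AnalyticAt ℂ g 0 := by
    have := hc.to_localInverse hΨ' (by simp)
    rw [hΨ0] at this
    exact this.analyticAt
  have hg0 : g 0 = 0 := by
    have := hc.localInverse_apply_image hΨ' (by simp)
    rwa [hΨ0] at this
  have hr : ∀ᶠ q in 𝓝 (0 : U × F), Ψ (g q) = q := by
    have := (hc.hasStrictFDerivAt' hΨ' (by simp)).eventually_right_inverse
    rwa [hΨ0] at this
  have hl : ∀ᶠ x in 𝓝 (0 : U × F), g (Ψ x) = x :=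
    (hc.hasStrictFDerivAt' hΨ' (by simp)).eventually_left_inverse
  have hg' : Filter.Tendsto g (𝓝 0) (𝓝 0) := by
    have := hg.continuousAt.tendsto
    rwa [hg0] at this
  have hρ : AnalyticAt ℂ (fun q => (g q).2) 0 := analyticAt_snd.fun_comp hg
  refine ⟨fun q => (g q).2, hρ, ?_, ?_⟩
  · have hkey2 : ∀ᶠ p in 𝓝 (0 : U × F), ∀ u,
        fderiv ℂ (fun q => (g q).2) (Ψ p) (u, a (Ψ p) u) = 0 := by
      have hρΨ : ∀ᶠ p in 𝓝 (0 : U × F), AnalyticAt ℂ (fun q => (g q).2) (Ψ p) := by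
        have : Filter.Tendsto Ψ (𝓝 0) (𝓝 0) := by
          have := hΨ.continuousAt.tendsto
          rwa [hΨ0] at this
        exact this.eventually hρ.eventually_analyticAt
      filter_upwards [hl.eventually_nhds, hkey, hρΨ, hφ.eventually_analyticAt] with p h1 h2 h3 h4 u
      have e1 : HasFDerivAt (fun x => (g (Ψ x)).2)
          ((fderiv ℂ (fun q => (g q).2) (Ψ p)).comp
            ((ContinuousLinearMap.fst ℂ U F).prod (fderiv ℂ φ p))) p :=
        HasFDerivAt.comp (g := fun q => (g q).2) p h3.differentiableAt.hasFDerivAt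
          (hasFDerivAt_fst.prodMk h4.differentiableAt.hasFDerivAt)
      have e2 : HasFDerivAt (fun x => (g (Ψ x)).2) (ContinuousLinearMap.snd ℂ U F) p := by
        refine hasFDerivAt_snd.congr_of_eventuallyEq ?_
        filter_upwards [h1] with x hx using by rw [hx]
      have e3 := congrArg (fun L => L (u, 0)) (e1.unique e2)
      simpa [h2 u, Ψ] using e3
    filter_upwards [hg'.eventually hkey2, hr] with q h1 h2 u
    have := h1 u
    rwa [h2] at this
  · intro v
    have e1 : HasFDerivAt (fun y : F => (g (0, y)).2)
        ((fderiv ℂ (fun q => (g q).2) 0).comp (ContinuousLinearMap.inr ℂ U F)) 0 :=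
      HasFDerivAt.comp (0 : F) (g := fun q => (g q).2) (f := fun y => ((0 : U), y))
        hρ.differentiableAt.hasFDerivAt (hasFDerivAt_prodMk_right 0 0)
    have hi : ContinuousAt (fun y : F => ((0 : U), y)) 0 := by fun_prop
    have e2 : HasFDerivAt (fun y : F => (g (0, y)).2) (ContinuousLinearMap.id ℂ F) 0 := by
      refine (hasFDerivAt_id (0 : F)).congr_of_eventuallyEq ?_
      filter_upwards [hi.eventually hl, hφ0] with y h1 h2
      have : Ψ (0, y) = (0, y) := by simp [Ψ, h2]
      rw [this] at h1
      simp [h1]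
    exact congrArg (fun L => L v) (e1.unique e2)

end Frobenius

/-! ### The Frobenius theorem in coframe form. -/

section FrobeniusGeneral

variable {E F : Type*} [NormedAddCommGroup E] [NormedSpace ℂ E] [FiniteDimensional ℂ E]
  [CompleteSpace E] [NormedAddCommGroup F] [NormedSpace ℂ F] [FiniteDimensional ℂ F]
  [CompleteSpace F]

/-- The Frobenius theorem: an involutive holomorphic distribution is the kernel of the differential
of a holomorphic submersion, whose differential at one point can be prescribed. -/
theorem frobenius {P : E → E →L[ℂ] F} {D : E → Submodule ℂ E} {z₀ : E} (hP : IsCoframeAt P D z₀)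
    (hinv : ∀ᶠ z in 𝓝 z₀, ∀ v ∈ D z, ∀ w ∈ D z, curv P z v w = 0) :
    ∃ ρ : E → F, AnalyticAt ℂ ρ z₀ ∧ IsCoframeAt (fderiv ℂ ρ) D z₀ ∧ fderiv ℂ ρ z₀ = P z₀ := by
  let U : Submodule ℂ E := LinearMap.ker (P z₀).toLinearMap
  have : CompleteSpace U := FiniteDimensional.complete ℂ U
  obtain ⟨T, hT, hPT⟩ := exists_analytic_rightInverse hP.analyticAt hP.surjective
  let T₀ : F →L[ℂ] E := T z₀
  have hPT₀ : ∀ w, P z₀ (T₀ w) = w := hPT.self_of_nhds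
  have hU : ∀ u : U, P z₀ u = 0 := fun u => u.2
  -- linear coordinates adapted to `D z₀`
  let M : U × F →L[ℂ] E := U.subtypeL.coprod T₀
  have hM : ∀ x : U × F, M x = x.1 + T₀ x.2 := fun x => by simp [M]
  let N₁ : E →L[ℂ] U := (ContinuousLinearMap.id ℂ E - T₀.comp (P z₀)).codRestrict U
    (fun v => by simp [U, hPT₀])
  let N : E →L[ℂ] U × F := N₁.prod (P z₀)
  have hNM : ∀ x, N (M x) = x := by
    intro x
    refine Prod.ext ?_ ?_
    · ext
      simp [N, N₁, hM, hU, hPT₀]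
    · simp [N, hM, hU, hPT₀]
  have hMN : ∀ v, M (N v) = v := by
    intro v
    simp [N, N₁, hM]
  let Ψ : U × F → E := fun x => z₀ + M x
  have hΨ : ∀ x, HasFDerivAt Ψ M x := fun x => M.hasFDerivAt.const_add z₀
  have hΨa : ∀ x, AnalyticAt ℂ Ψ x := fun x => analyticAt_const.add (M.analyticAt x)
  have hΨ0 : Ψ 0 = z₀ := by simp [Ψ]
  have hΨt : Filter.Tendsto Ψ (𝓝 0) (𝓝 z₀) := by
    have := (hΨa 0).continuousAt.tendsto
    rwa [hΨ0] at this
  let B : U × F → F →L[ℂ] F := fun x => (P (Ψ x)).comp T₀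
  have hPΨ : AnalyticAt ℂ (fun x => P (Ψ x)) 0 :=
    AnalyticAt.fun_comp (by rw [hΨ0]; exact hP.analyticAt) (hΨa 0)
  have hB : AnalyticAt ℂ B 0 := analyticAt_clm_comp hPΨ analyticAt_const
  have hB0 : B 0 = ContinuousLinearMap.id ℂ F := by
    ext w; simp [B, hΨ0, hPT₀]
  obtain ⟨hBi, hBinv⟩ := analyticAt_clm_inverse hB
    (hB0 ▸ ⟨ContinuousLinearEquiv.refl ℂ F, rfl⟩)
  -- Solving `P (u + T₀ w) = 0` for `w` presents the distribution as the graph of `a` over `U`; `B`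
  -- is invertible near the origin because it is the identity there.
  let a : U × F → U →L[ℂ] F := fun x => -((B x).inverse.comp ((P (Ψ x)).comp U.subtypeL))
  have ha : AnalyticAt ℂ a 0 :=
    (analyticAt_clm_comp hBi (analyticAt_clm_comp hPΨ analyticAt_const)).neg
  let D' : U × F → Submodule ℂ (U × F) := fun x => (D (Ψ x)).comap M.toLinearMap
  let θ : U × F → U × F →L[ℂ] F := fun x =>
    ContinuousLinearMap.snd ℂ U F - (a x).comp (ContinuousLinearMap.fst ℂ U F)
  have hθa : ∀ x, AnalyticAt ℂ a x → AnalyticAt ℂ θ x := fun x hx =>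
    analyticAt_const.sub (analyticAt_clm_comp hx analyticAt_const)
  have hθ : IsCoframeAt θ D' 0 := by
    refine ⟨hθa 0 ha, fun w => ⟨(0, w), by simp [θ]⟩, ?_⟩
    filter_upwards [hBinv, hΨt.eventually hP.mem_iff] with x h1 h2 v
    have e1 : v ∈ D' x ↔ P (Ψ x) (M v) = 0 := h2 (M v)
    have e2 : P (Ψ x) (M v) = P (Ψ x) v.1 + B x v.2 := by rw [hM, map_add]; rfl
    have e3 : θ x v = (B x).inverse (P (Ψ x) (M v)) := by
      rw [e2, map_add, h1.inverse_apply_self]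
      simp [θ, a, add_comm]
    rw [e1, e3]
    refine ⟨fun h => by rw [h, map_zero], fun h => ?_⟩
    have := congrArg (B x) h
    rwa [h1.self_apply_inverse, map_zero] at this
  have hpull : ∀ᶠ x in 𝓝 (0 : U × F), IsCoframeAt (pullForm Ψ P) D' x ∧
      ∀ v ∈ D' x, ∀ w ∈ D' x, curv (pullForm Ψ P) x v w = 0 := by
    filter_upwards [hΨt.eventually hP.eventually, hΨt.eventually hinv] with x h1 h2
    have hfd : ∀ x, fderiv ℂ Ψ x = M := fun x => (hΨ x).fderiv
    refine ⟨⟨analyticAt_pullForm h1.analyticAt (hΨa x), ?_, ?_⟩, fun v hv w hw => ?_⟩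
    · intro w
      obtain ⟨v, hv⟩ := h1.surjective w
      exact ⟨N v, by simp [pullForm, hfd, hMN, hv]⟩
    · filter_upwards [(hΨa x).continuousAt.eventually h1.mem_iff] with y hy v
      simp only [pullForm, hfd]
      exact hy (M v)
    · rw [curv_pullForm h1.analyticAt.differentiableAt (hΨa x), hfd]
      exact h2 _ hv _ hw
  have hcθ : ∀ᶠ x in 𝓝 (0 : U × F), ∀ u y : U,
      fderiv ℂ a x (u, a x u) y = fderiv ℂ a x (y, a x y) u := by
    filter_upwards [hpull, hθ.eventually, ha.eventually_analyticAt] with x ⟨h1, h2⟩ h3 h4 u y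
    have hmem : ∀ u : U, (u, a x u) ∈ D' x := fun u => by
      rw [h3.mem_iff.self_of_nhds]; simp [θ]
    -- Vanishing of the curvature does not depend on the coframe: it passes from the pull-back of
    -- `P` to the graph form `θ`, where it reads as the symmetry condition on `a`.
    have h5 := curv_eq_zero_of_le h3 h1 (Filter.Eventually.of_forall fun _ => le_rfl)
      (hmem u) (hmem y) (h2 _ (hmem u) _ (hmem y))
    have h6 : HasFDerivAt θ (-(((ContinuousLinearMap.compL ℂ (U × F) U F).flip
        (ContinuousLinearMap.fst ℂ U F)).comp (fderiv ℂ a x))) x := by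
      have := (((ContinuousLinearMap.compL ℂ (U × F) U F).flip
        (ContinuousLinearMap.fst ℂ U F)).hasFDerivAt.comp x
          h4.differentiableAt.hasFDerivAt).const_sub (ContinuousLinearMap.snd ℂ U F)
      exact this
    rw [curv_apply, h6.fderiv] at h5
    simp only [neg_apply, ContinuousLinearMap.comp_apply, ContinuousLinearMap.flip_apply,
      ContinuousLinearMap.compL_apply, ContinuousLinearMap.coe_fst'] at h5
    rw [sub_neg_eq_add, neg_add_eq_zero] at h5
    exact h5.symm
  obtain ⟨ρ, hρ, hρa, hρ2⟩ := exists_firstIntegral_graph ha hcθ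
  let σ : E → U × F := fun z => N (z - z₀)
  have hσ : ∀ z, HasFDerivAt σ N z := fun z => by
    have e : σ = fun z => N z - N z₀ := by ext1 z; simp [σ]
    rw [e]
    exact (N.hasFDerivAt (x := z)).sub_const (N z₀)
  have hσa : AnalyticAt ℂ σ z₀ := (N.analyticAt _).fun_comp (analyticAt_id.sub analyticAt_const)
  have hσ0 : σ z₀ = 0 := by simp [σ]
  have hσt : Filter.Tendsto σ (𝓝 z₀) (𝓝 0) := by
    have := hσa.continuousAt.tendsto
    rwa [hσ0] at this
  have hσΨ : ∀ z, Ψ (σ z) = z := fun z => by simp [Ψ, σ, hMN]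
  have ha0 : a 0 = 0 := by ext u; simp [a, hΨ0, hU]
  have hρσ : ∀ᶠ z in 𝓝 z₀, fderiv ℂ (fun z => ρ (σ z)) z = (fderiv ℂ ρ (σ z)).comp N := by
    filter_upwards [hσt.eventually hρ.eventually_analyticAt] with z hz
    exact (hz.differentiableAt.hasFDerivAt.comp z (hσ z)).fderiv
  have hρσa : AnalyticAt ℂ (fun z => ρ (σ z)) z₀ :=
    AnalyticAt.fun_comp (by rw [hσ0]; exact hρ) hσa
  have h0 : fderiv ℂ (fun z => ρ (σ z)) z₀ = P z₀ := by
    rw [hρσ.self_of_nhds, hσ0]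
    ext v
    have e1 := hρa.self_of_nhds (N v).1
    rw [ha0] at e1
    have e2 : N v = ((N v).1, 0) + (0, P z₀ v) := by simp [N]
    rw [ContinuousLinearMap.comp_apply, e2, map_add, hρ2]
    simp only [zero_apply] at e1
    rw [e1, zero_add]
  refine ⟨fun z => ρ (σ z), hρσa, ⟨hρσa.fderiv, by rw [h0]; exact hP.surjective, ?_⟩, h0⟩
  have hsurj := eventually_surjective hρσa.fderiv (by rw [h0]; exact hP.surjective)
  filter_upwards [hsurj, hρσ, hσt.eventually hρa, hσt.eventually hθ.mem_iff, hP.eventually]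
    with z h1 h2 h3 h4 h5
  let K : Submodule ℂ E := LinearMap.ker (fderiv ℂ (fun z => ρ (σ z)) z).toLinearMap
  have hle : D z ≤ K := by
    intro v hv
    have hv' : N v ∈ D' (σ z) := by
      change M (N v) ∈ D (Ψ (σ z))
      rwa [hσΨ, hMN]
    rw [h4] at hv'
    have e : (N v).2 = a (σ z) (N v).1 := sub_eq_zero.1 hv'
    have e' : N v = ((N v).1, a (σ z) (N v).1) := Prod.ext rfl e
    change fderiv ℂ (fun z => ρ (σ z)) z v = 0
    rw [h2, ContinuousLinearMap.comp_apply, e', h3]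
  -- The differential vanishes on `D z`; both spaces have codimension `dim F`, so the inclusion is
  -- an equality.
  have hfr : Module.finrank ℂ (D z) = Module.finrank ℂ K := by
    have e1 := h5.finrank_add
    have e2 := LinearMap.finrank_range_add_finrank_ker (fderiv ℂ (fun z => ρ (σ z)) z).toLinearMap
    rw [LinearMap.range_eq_top.2 h1, finrank_top] at e2
    have e3 : Module.finrank ℂ F + Module.finrank ℂ K = Module.finrank ℂ E := e2
    omega
  intro v
  rw [Submodule.eq_of_le_of_finrank_eq hle hfr]
  rfl

end FrobeniusGeneral
end LeviCR

namespace LeviCR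

set_option linter.unusedSectionVars false

/-! ## Real points of `CSpace d` -/

section RealPoints

variable {d : ℕ}

/-- `toC` as a continuous linear map. -/
noncomputable def toCL (d : ℕ) : RSpace d →L[ℝ] CSpace d := LinearMap.toContinuousLinearMap (toC d)

theorem toCL_apply (x : RSpace d) : toCL d x = toC d x := rfl

theorem toC_apply (x : RSpace d) (i : Fin d) : toC d x i = (x i : ℂ) := rfl

/-- Real part of a vector of `CSpace d`. -/
noncomputable def reC (d : ℕ) : CSpace d →L[ℝ] RSpace d :=
  LinearMap.toContinuousLinearMap
    { toFun := fun z => WithLp.toLp 2 fun i => (z i).re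
      map_add' := fun x y => by ext i; simp
      map_smul' := fun c x => by ext i; simp }

/-- Imaginary part of a vector of `CSpace d`. -/
noncomputable def imC (d : ℕ) : CSpace d →L[ℝ] RSpace d :=
  LinearMap.toContinuousLinearMap
    { toFun := fun z => WithLp.toLp 2 fun i => (z i).im
      map_add' := fun x y => by ext i; simp
      map_smul' := fun c x => by ext i; simp }

@[simp] theorem reC_apply (z : CSpace d) (i : Fin d) : reC d z i = (z i).re := rfl

@[simp] theorem imC_apply (z : CSpace d) (i : Fin d) : imC d z i = (z i).im := rfl

@[simp] theorem reC_toC (x : RSpace d) : reC d (toC d x) = x := by ext i; simp [toC_apply]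

theorem toC_reC_add (z : CSpace d) : toC d (reC d z) + Complex.I • toC d (imC d z) = z := by
  ext i
  simp only [Pi.add_apply, Pi.smul_apply, toC_apply, reC_apply, imC_apply, smul_eq_mul]
  rw [mul_comm]
  exact Complex.re_add_im _

@[simp] theorem star_toC (x : RSpace d) : star (toC d x) = toC d x := by
  ext i; simp [toC_apply]

theorem continuous_toC (d : ℕ) : Continuous (toC d) := (toCL d).continuous

theorem eventually_reC {x₀ : RSpace d} {p : RSpace d → Prop} (h : ∀ᶠ x in 𝓝 x₀, p x) :
    ∀ᶠ z in 𝓝 (toC d x₀), p (reC d z) := by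
  have := (reC d).continuous.continuousAt (x := toC d x₀)
  rw [ContinuousAt, reC_toC] at this
  exact this.eventually h

theorem eventually_toC {x₀ : RSpace d} {p : CSpace d → Prop} (h : ∀ᶠ z in 𝓝 (toC d x₀), p z) :
    ∀ᶠ x in 𝓝 x₀, p (toC d x) :=
  (continuous_toC d).continuousAt.eventually h

end RealPoints

/-! ## Complexification of real-analytic maps -/

section Complexify

variable {d : ℕ} {F : Type*} [NormedAddCommGroup F] [NormedSpace ℂ F] [NormedSpace ℝ F]
  [IsScalarTower ℝ ℂ F]

/-- The complex-multilinear extension of a real multilinear map. -/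
noncomputable def complexifyMultilinear {n : ℕ} (p : RSpace d [×n]→L[ℝ] F) :
    CSpace d [×n]→L[ℂ] F :=
  ∑ σ : Fin n → Fin d,
    ((ContinuousMultilinearMap.mkPiAlgebra ℂ (Fin n) ℂ).compContinuousLinearMap
      (fun i => (ContinuousLinearMap.proj (σ i) : CSpace d →L[ℂ] ℂ))).smulRight
        (p fun i => EuclideanSpace.single (σ i) 1)

theorem complexifyMultilinear_apply {n : ℕ} (p : RSpace d [×n]→L[ℝ] F) (m : Fin n → CSpace d) :
    complexifyMultilinear p m =
      ∑ σ : Fin n → Fin d, (∏ i, m i (σ i)) • p fun i => EuclideanSpace.single (σ i) 1 := by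
  simp [complexifyMultilinear]

theorem complexifyMultilinear_toC {n : ℕ} (p : RSpace d [×n]→L[ℝ] F) (m : Fin n → RSpace d) :
    complexifyMultilinear p (fun i => toC d (m i)) = p m := by
  have h : m = fun i => ∑ j, m i j • EuclideanSpace.single j (1 : ℝ) := by
    ext i j
    simp [Finset.sum_apply, Pi.single_apply]
  rw [complexifyMultilinear_apply]
  conv_rhs => rw [h, ContinuousMultilinearMap.map_sum]
  refine Finset.sum_congr rfl fun σ _ => ?_
  rw [ContinuousMultilinearMap.map_smul_univ]
  simp only [toC_apply]
  rw [← Complex.ofReal_prod, ← Complex.coe_algebraMap, algebraMap_smul]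

theorem norm_complexifyMultilinear_le {n : ℕ} (p : RSpace d [×n]→L[ℝ] F) :
    ‖complexifyMultilinear p‖ ≤ (d : ℝ) ^ n * ‖p‖ := by
  refine ContinuousMultilinearMap.opNorm_le_bound (by positivity) fun m => ?_
  rw [complexifyMultilinear_apply]
  have h : ∀ σ : Fin n → Fin d, ‖(∏ i, m i (σ i)) • p fun i => EuclideanSpace.single (σ i) 1‖ ≤
      ‖p‖ * ∏ i, ‖m i‖ := by
    intro σ
    rw [norm_smul, norm_prod, mul_comm]
    gcongr with i
    · refine (p.le_opNorm _).trans ?_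
      simp
    · exact norm_le_pi_norm (m i) (σ i)
  refine (norm_sum_le_of_le _ fun σ _ => h σ).trans ?_
  simp [mul_assoc]

/-- A real-analytic map extends holomorphically. -/
theorem exists_holomorphic_extension [CompleteSpace F] {f : RSpace d → F} {x₀ : RSpace d}
    (hf : AnalyticAt ℝ f x₀) :
    ∃ g : CSpace d → F, AnalyticAt ℂ g (toC d x₀) ∧ ∀ᶠ x in 𝓝 x₀, g (toC d x) = f x := by
  obtain ⟨p, r, hp⟩ := hf
  let q : FormalMultilinearSeries ℂ (CSpace d) F := fun n => complexifyMultilinear (p n)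
  obtain ⟨s, hs0, hsr⟩ := ENNReal.lt_iff_exists_nnreal_btwn.1 hp.r_pos
  obtain ⟨C, -, hC⟩ := p.norm_mul_pow_le_of_lt_radius (lt_of_lt_of_le hsr hp.r_le)
  have hs0' : 0 < s := by exact_mod_cast hs0
  -- The sum over `d ^ n` index functions costs a factor `d ^ n` in the norms, which shrinking the
  -- radius by `d + 1` absorbs. The extra `1` avoids division by zero when `d = 0`.
  let s' : NNReal := s / (d + 1)
  have hs' : 0 < s' := by positivity
  have hrad : (s' : ENNReal) ≤ q.radius := by
    refine q.le_radius_of_bound C fun n => ?_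
    have h1 : (s' : ℝ) = s / (d + 1) := by simp [s']
    have h2 : ((d : ℝ) / (d + 1)) ^ n ≤ 1 := by
      apply pow_le_one₀ (by positivity)
      rw [div_le_one (by positivity)]; linarith
    calc ‖q n‖ * (s' : ℝ) ^ n ≤ ((d : ℝ) ^ n * ‖p n‖) * (s' : ℝ) ^ n := by
          gcongr; exact norm_complexifyMultilinear_le (p n)
      _ = (((d : ℝ) / (d + 1)) ^ n) * (‖p n‖ * (s : ℝ) ^ n) := by
          rw [h1, div_pow, div_pow]; ring
      _ ≤ 1 * (‖p n‖ * (s : ℝ) ^ n) := by gcongr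
      _ ≤ C := by rw [one_mul]; exact hC n
  have hqpos : 0 < q.radius := lt_of_lt_of_le (by exact_mod_cast hs') hrad
  have hq := q.hasFPowerSeriesOnBall hqpos
  refine ⟨fun z => q.sum (z - toC d x₀), ?_, ?_⟩
  · have h1 : AnalyticAt ℂ q.sum (toC d x₀ - toC d x₀) := by
      rw [sub_self]; exact hq.analyticAt
    exact h1.fun_comp (f := fun z => z - toC d x₀) (analyticAt_id.sub analyticAt_const)
  · have h1 : ∀ᶠ x in 𝓝 x₀, toC d (x - x₀) ∈ Metric.eball (0 : CSpace d) q.radius := by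
      have hc : ContinuousAt (fun x => toC d (x - x₀)) x₀ :=
        ((continuous_toC d).comp (continuous_id.sub continuous_const)).continuousAt
      refine hc (Metric.isOpen_eball.mem_nhds ?_)
      simpa using hqpos
    have h2 : ∀ᶠ x in 𝓝 x₀, x - x₀ ∈ Metric.eball (0 : RSpace d) r := by
      have hc : ContinuousAt (fun x => x - x₀) x₀ := by fun_prop
      refine hc (Metric.isOpen_eball.mem_nhds ?_)
      simpa using hp.r_pos
    filter_upwards [h1, h2] with x h1 h2
    have e1 := hq.hasSum h1
    have e2 := hp.hasSum h2
    simp only [zero_add] at e1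
    have e3 : (fun n => q n fun _ => toC d (x - x₀)) = fun n => p n fun _ => (x - x₀) := by
      ext1 n
      exact complexifyMultilinear_toC (p n) _
    rw [e3] at e1
    rw [map_sub] at e1
    simpa using e1.unique e2

/-- A holomorphic map that vanishes at the real points vanishes. -/
theorem eventually_eq_zero_of_real [CompleteSpace F] {g : CSpace d → F} {x₀ : RSpace d}
    (hg : AnalyticAt ℂ g (toC d x₀)) (h : ∀ᶠ x in 𝓝 x₀, g (toC d x) = 0) :
    ∀ᶠ z in 𝓝 (toC d x₀), g z = 0 := by
  obtain ⟨ε, hε, hb⟩ := Metric.eventually_nhds_iff.1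
    (hg.eventually_analyticAt.and (eventually_reC h))
  have h1 : ∀ᶠ z in 𝓝 (toC d x₀), ‖toC d (reC d z) - toC d x₀‖ < ε / 4 := by
    have hc : ContinuousAt (fun z => ‖toC d (reC d z) - toC d x₀‖) (toC d x₀) :=
      (((continuous_toC d).comp (reC d).continuous).sub continuous_const).norm.continuousAt
    have := hc.eventually (gt_mem_nhds
      (show ‖toC d (reC d (toC d x₀)) - toC d x₀‖ < ε / 4 by simp; positivity))
    exact this
  have h2 : ∀ᶠ z in 𝓝 (toC d x₀), ‖toC d (imC d z)‖ < ε / 4 := by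
    have hc : ContinuousAt (fun z => ‖toC d (imC d z)‖) (toC d x₀) :=
      ((continuous_toC d).comp (imC d).continuous).norm.continuousAt
    have h0 : imC d (toC d x₀) = 0 := by ext i; simp [toC_apply]
    have := hc.eventually (gt_mem_nhds
      (show ‖toC d (imC d (toC d x₀))‖ < ε / 4 by simp [h0]; positivity))
    exact this
  filter_upwards [h1, h2] with z h1 h2
  -- The complex line through the real and imaginary parts of `z`: real parameters give real points
  -- and `t = i` gives `z`. The identity theorem in one variable, on the disc of radius `2`
  -- containing `i`, gives the result; the bounds `ε / 4` keep the disc inside the domain, as `ε / 4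
  -- + 2 (ε / 4) < ε`.
  let γ : ℂ → CSpace d := fun t => toC d (reC d z) + t • toC d (imC d z)
  have hγ : ∀ t, AnalyticAt ℂ γ t := fun t =>
    analyticAt_const.add (analyticAt_id.smul analyticAt_const)
  have hγb : ∀ t ∈ Metric.ball (0 : ℂ) 2, dist (γ t) (toC d x₀) < ε := by
    intro t ht
    rw [mem_ball_zero_iff] at ht
    rw [dist_eq_norm]
    have e : γ t - toC d x₀ = (toC d (reC d z) - toC d x₀) + t • toC d (imC d z) := by
      simp only [γ]; abel
    calc ‖γ t - toC d x₀‖ ≤ ‖toC d (reC d z) - toC d x₀‖ + ‖t‖ * ‖toC d (imC d z)‖ := by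
          rw [e, ← norm_smul]; exact norm_add_le _ _
      _ ≤ ε / 4 + 2 * (ε / 4) := by gcongr
      _ < ε := by linarith
  have hgγ : AnalyticOnNhd ℂ (fun t => g (γ t)) (Metric.ball (0 : ℂ) 2) := fun t ht =>
    (hb (hγb t ht)).1.fun_comp (hγ t)
  have hz : ∀ t : ℝ, |t| < 2 → g (γ t) = 0 := by
    intro t ht
    have := (hb (hγb t (by simpa using ht))).2
    have e : γ t = toC d (reC d z + t • imC d z) := by
      simp only [γ, map_add, map_smul]
      congr 1
    rw [e] at this ⊢
    simpa using this
  have hfreq : ∃ᶠ t in 𝓝[≠] (0 : ℂ), g (γ t) = 0 := by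
    rw [frequently_nhdsWithin_iff, Metric.nhds_basis_ball.frequently_iff]
    intro δ hδ
    let t : ℝ := min (δ / 2) 1
    have ht : 0 < t := by positivity
    have ht1 : t ≤ 1 := min_le_right _ _
    have ht2 : t ≤ δ / 2 := min_le_left _ _
    refine ⟨(t : ℂ), ?_, hz t ?_, by simpa using ht.ne'⟩
    · simp only [Metric.mem_ball, dist_zero_right, Complex.norm_real, Real.norm_of_nonneg ht.le]; linarith
    · rw [abs_of_pos ht]; linarith
  have := hgγ.eqOn_zero_of_preconnected_of_frequently_eq_zero
    (convex_ball _ _).isPreconnected (Metric.mem_ball_self two_pos) hfreq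
  have hI : Complex.I ∈ Metric.ball (0 : ℂ) 2 := by simp
  have h3 := this hI
  simp only [γ, toC_reC_add] at h3
  simpa using h3

/-- A holomorphic section of a distribution at the real points is one everywhere. -/
theorem eventually_mem_of_real {D : CSpace d → Submodule ℂ (CSpace d)} {X : CSpace d → CSpace d}
    {x₀ : RSpace d} (hD : IsDistAt D (toC d x₀)) (hX : AnalyticAt ℂ X (toC d x₀))
    (h : ∀ᶠ x in 𝓝 x₀, X (toC d x) ∈ D (toC d x)) : IsSec D X (toC d x₀) := by
  obtain ⟨m, P, hP⟩ := hD
  refine ⟨hX, ?_⟩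
  have h1 := eventually_eq_zero_of_real (analyticAt_clm_apply hP.analyticAt hX) (by
    filter_upwards [h, eventually_toC hP.mem_iff] with x h1 h2 using (h2 _).1 h1)
  filter_upwards [h1, hP.mem_iff] with z h2 h3 using (h3 _).2 h2

/-- Each member of a frame of `D` is a section of `D'` at real points, hence nearby by the identity
theorem. -/
theorem eventually_le_of_real {D D' : CSpace d → Submodule ℂ (CSpace d)} {x₀ : RSpace d}
    (hD : IsDistAt D (toC d x₀)) (hD' : IsDistAt D' (toC d x₀))
    (h : ∀ᶠ x in 𝓝 x₀, D (toC d x) ≤ D' (toC d x)) : ∀ᶠ z in 𝓝 (toC d x₀), D z ≤ D' z := by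
  obtain ⟨X, hX⟩ := hD.exists_frame rfl
  have h1 : ∀ i, IsSec D' (X i) (toC d x₀) := fun i =>
    eventually_mem_of_real hD' (hX.analyticAt i) (by
      filter_upwards [h, eventually_toC (hX.isSec i).2] with x h1 h2 using h1 h2)
  filter_upwards [hX.span_eq, Filter.eventually_all.2 fun i => (h1 i).2] with z h2 h3
  rw [← h2, Submodule.span_le]
  rintro _ ⟨i, rfl⟩
  exact h3 i

end Complexify

/-! ## The conjugation -/

section Conjugation

variable {E F : Type*} [NormedAddCommGroup E] [NormedSpace ℂ E] [StarAddMonoid E]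
  [NormedStarGroup E] [StarModule ℂ E]
  [NormedAddCommGroup F] [NormedSpace ℂ F] [StarAddMonoid F]
  [NormedStarGroup F] [StarModule ℂ F]

/-- The conjugate of a complex multilinear map. -/
noncomputable def conjMultilinear {n : ℕ} (p : E [×n]→L[ℂ] F) : E [×n]→L[ℂ] F :=
  MultilinearMap.mkContinuous
    { toFun := fun m => star (p fun i => star (m i))
      map_update_add' := by
        intro _ m i x y
        have : ∀ z : E, (fun j => star (Function.update m i z j)) =
            Function.update (fun j => star (m j)) i (star z) := by
          intro z; ext j; by_cases h : j = i
          · subst h; simp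
          · simp [h]
        simp [this]
      map_update_smul' := by
        intro _ m i c x
        have : ∀ z : E, (fun j => star (Function.update m i z j)) =
            Function.update (fun j => star (m j)) i (star z) := by
          intro z; ext j; by_cases h : j = i
          · subst h; simp
          · simp [h]
        simp [this] }
    ‖p‖ (by
      intro m
      change ‖star (p fun i => star (m i))‖ ≤ _
      rw [norm_star]
      refine (p.le_opNorm _).trans ?_
      simp [norm_star])

/-- Conjugating the coefficients of the power series preserves their norms, so the conjugated series
converges on the same ball. -/
theorem analyticAt_star_star {f : E → F} {z : E} (hf : AnalyticAt ℂ f (star z)) :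
    AnalyticAt ℂ (fun w => star (f (star w))) z := by
  obtain ⟨p, r, hp⟩ := hf
  refine ⟨fun n => conjMultilinear (p n), r, hp.r_le.trans ?_, hp.r_pos, fun {y} hy => ?_⟩
  · exact FormalMultilinearSeries.radius_le_of_le fun n =>
      MultilinearMap.mkContinuous_norm_le _ (norm_nonneg _) _
  · have hy' : star y ∈ Metric.eball (0 : E) r := by
      rw [mem_eball_zero_iff] at hy ⊢
      rwa [← ofReal_norm, norm_star, ofReal_norm]
    have h1 := hp.hasSum hy'
    have h2 := h1.star
    rw [star_add]
    exact h2

/-- `star` is only real-linear, so the chain rule is applied to real derivatives and the result is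
compared with the complex derivative, which is known to exist. -/
theorem fderiv_star_star {f : E → F} {z : E} (hf : AnalyticAt ℂ f (star z)) (v : E) :
    fderiv ℂ (fun w => star (f (star w))) z v = star (fderiv ℂ f (star z) (star v)) := by
  let sE : E →L[ℝ] E := (starL' ℝ : E ≃L[ℝ] E).toContinuousLinearMap
  let sF : F →L[ℝ] F := (starL' ℝ : F ≃L[ℝ] F).toContinuousLinearMap
  have h1 := ((analyticAt_star_star hf).differentiableAt.hasFDerivAt).restrictScalars ℝ
  have h2 : HasFDerivAt (fun w => star (f (star w)))
      (sF.comp (((fderiv ℂ f (star z)).restrictScalars ℝ).comp sE)) z :=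
    sF.hasFDerivAt.comp z ((hf.differentiableAt.hasFDerivAt.restrictScalars ℝ).comp z sE.hasFDerivAt)
  exact congrArg (fun L => L v) (h1.unique h2)

end Conjugation

/-! ### Conjugate distributions. -/

section Tau

variable {d : ℕ}

theorem mem_tauDist {S : CSpace d → Submodule ℂ (CSpace d)} {q x : CSpace d} :
    x ∈ tauDist S q ↔ star x ∈ S (star q) := Iff.rfl

theorem tauDist_tauDist (S : CSpace d → Submodule ℂ (CSpace d)) : tauDist (tauDist S) = S := by
  ext q x; simp [mem_tauDist]

theorem tauDist_mono {S S' : CSpace d → Submodule ℂ (CSpace d)} {q : CSpace d}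
    (h : S (star q) ≤ S' (star q)) : tauDist S q ≤ tauDist S' q := fun _ hx => h hx

theorem tauDist_sup (S S' : CSpace d → Submodule ℂ (CSpace d)) (q : CSpace d) :
    tauDist (fun z => S z ⊔ S' z) q = tauDist S q ⊔ tauDist S' q := by
  refine le_antisymm (fun x hx => ?_) (sup_le ?_ ?_)
  · obtain ⟨a, ha, b, hb, hab⟩ := Submodule.mem_sup.1 (mem_tauDist.1 hx)
    refine Submodule.mem_sup.2 ⟨star a, ?_, star b, ?_, ?_⟩
    · simpa [mem_tauDist] using ha
    · simpa [mem_tauDist] using hb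
    · rw [← star_add, hab, star_star]
  · exact fun x hx => (le_sup_left : S (star q) ≤ S (star q) ⊔ S' (star q)) hx
  · exact fun x hx => (le_sup_right : S' (star q) ≤ S (star q) ⊔ S' (star q)) hx

theorem continuous_starC : Continuous (star : CSpace d → CSpace d) := continuous_star

theorem eventually_star {z : CSpace d} {p : CSpace d → Prop} (h : ∀ᶠ w in 𝓝 (star z), p w) :
    ∀ᶠ w in 𝓝 z, p (star w) := continuous_starC.continuousAt.eventually h

theorem eventually_star_toC {x : RSpace d} {p : CSpace d → Prop} (h : ∀ᶠ w in 𝓝 (toC d x), p w) :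
    ∀ᶠ w in 𝓝 (toC d x), p (star w) := eventually_star (by rwa [star_toC])

theorem IsFrameAt.tau {ι : Type*} {X : ι → CSpace d → CSpace d}
    {D : CSpace d → Submodule ℂ (CSpace d)} {z : CSpace d} (h : IsFrameAt X D (star z)) :
    IsFrameAt (fun i w => star (X i (star w))) (tauDist D) z := by
  refine ⟨fun i => analyticAt_star_star (h.analyticAt i), ?_, ?_⟩
  · rw [linearIndependent_iff'] at *
    intro s g hg i hi
    have := h.linearIndependent
    rw [linearIndependent_iff'] at this
    have h1 := this s (fun i => star (g i)) (by
      have := congrArg star hg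
      simpa [star_sum, star_smul] using this) i hi
    simpa using h1
  · filter_upwards [eventually_star h.span_eq] with w hw
    refine le_antisymm (Submodule.span_le.2 ?_) (fun x hx => ?_)
    · rintro _ ⟨i, rfl⟩
      change star (star (X i (star w))) ∈ D (star w)
      rw [star_star, ← hw]
      exact Submodule.subset_span ⟨i, rfl⟩
    · have hx' : star x ∈ D (star w) := hx
      rw [← hw] at hx'
      have : ∀ y ∈ Submodule.span ℂ (Set.range fun i => X i (star w)),
          star y ∈ Submodule.span ℂ (Set.range fun i => star (X i (star w))) := by
        intro y hy
        induction hy using Submodule.span_induction with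
        | mem y hy => obtain ⟨i, rfl⟩ := hy; exact Submodule.subset_span ⟨i, rfl⟩
        | zero => simp
        | add a b _ _ ha hb => rw [star_add]; exact add_mem ha hb
        | smul c a _ ha => rw [star_smul]; exact Submodule.smul_mem _ _ ha
      simpa using this _ hx'

theorem IsDistAt.tau {D : CSpace d → Submodule ℂ (CSpace d)} {z : CSpace d}
    (h : IsDistAt D (star z)) : IsDistAt (tauDist D) z := by
  obtain ⟨X, hX⟩ := h.exists_frame rfl
  exact hX.tau.isDistAt

theorem IsDistAt.tau_toC {D : CSpace d → Submodule ℂ (CSpace d)} {x : RSpace d}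
    (h : IsDistAt D (toC d x)) : IsDistAt (tauDist D) (toC d x) :=
  IsDistAt.tau (by rwa [star_toC])

theorem IsSec.tau {D : CSpace d → Submodule ℂ (CSpace d)} {X : CSpace d → CSpace d}
    {z : CSpace d} (h : IsSec D X (star z)) : IsSec (tauDist D) (fun w => star (X (star w))) z := by
  refine ⟨analyticAt_star_star h.1, ?_⟩
  filter_upwards [eventually_star h.2] with w hw
  simpa [mem_tauDist] using hw

theorem lieBracket_tau {X Y : CSpace d → CSpace d} {z : CSpace d} (hX : AnalyticAt ℂ X (star z))
    (hY : AnalyticAt ℂ Y (star z)) :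
    VectorField.lieBracket ℂ (fun w => star (X (star w))) (fun w => star (Y (star w))) z =
      star (VectorField.lieBracket ℂ X Y (star z)) := by
  simp only [VectorField.lieBracket]
  rw [fderiv_star_star hX, fderiv_star_star hY, star_sub, star_star, star_star]

/-- The curvature of a distribution and that of its conjugate vanish at the same vectors. -/
theorem curv_tau {m m' : ℕ} {P : CSpace d → CSpace d →L[ℂ] (Fin m → ℂ)}
    {P' : CSpace d → CSpace d →L[ℂ] (Fin m' → ℂ)} {C C' : CSpace d → Submodule ℂ (CSpace d)}
    {z : CSpace d} (h : IsCoframeAt P C z) (h' : IsCoframeAt P' C' (star z))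
    (hC : ∀ᶠ w in 𝓝 z, tauDist C' w = C w) {v w : CSpace d} (hv : star v ∈ C' (star z))
    (hw : star w ∈ C' (star z)) (h0 : curv P' (star z) (star v) (star w) = 0) :
    curv P z v w = 0 := by
  obtain ⟨X, hX, hXv⟩ := h'.isDistAt.exists_sec hv
  obtain ⟨Y, hY, hYw⟩ := h'.isDistAt.exists_sec hw
  have h1 := (h'.lieBracket_mem_iff hX hY).2 (by rw [hXv, hYw, h0])
  have hle : ∀ᶠ w in 𝓝 z, tauDist C' w ≤ C w := hC.mono fun w hw => hw.le
  have h2 := (h.lieBracket_mem_iff (hX.tau.mono hle) (hY.tau.mono hle)).1 (by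
    rw [lieBracket_tau hX.1 hY.1]
    apply hle.self_of_nhds
    simpa [mem_tauDist] using h1)
  simpa [hXv, hYw] using h2

end Tau
end LeviCR

namespace LeviCR

set_option linter.unusedSectionVars false

/-! ## Complex vector fields in a chart -/

section TensorLemmas

variable {V : Type*} [AddCommGroup V] [Module ℝ V]

@[simp] theorem tRe_tMk (a b : V) : tRe (tMk a b) = a := by simp [tRe, tMk]

@[simp] theorem tIm_tMk (a b : V) : tIm (tMk a b) = b := by simp [tIm, tMk]

theorem tMk_tRe_tIm (x : ℂ ⊗[ℝ] V) : tMk (tRe x) (tIm x) = x := by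
  induction x with
  | zero => simp [tMk]
  | tmul z v =>
    have h : z ⊗ₜ[ℝ] v = (1 : ℂ) ⊗ₜ[ℝ] (z.re • v) + Complex.I ⊗ₜ[ℝ] (z.im • v) := by
      rw [← TensorProduct.smul_tmul, ← TensorProduct.smul_tmul, ← TensorProduct.add_tmul]
      congr 1
      apply Complex.ext <;> simp
    conv_rhs => rw [h]
    simp [tMk, tRe, tIm]
  | add x y hx hy => rw [map_add, map_add, tMk_add, hx, hy]

theorem tConj_tMk (a b : V) : tConj (tMk a b) = tMk a (-b) := by
  simp [tConj, tMk, TensorProduct.neg_tmul, TensorProduct.tmul_neg]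

theorem tConj_tConj (x : ℂ ⊗[ℝ] V) : tConj (tConj x) = x := by
  rw [← tMk_tRe_tIm x, tConj_tMk, tConj_tMk, neg_neg]

end TensorLemmas

section Chart

variable {d : ℕ} {M : Type*} [TopologicalSpace M] [ChartedSpace (RSpace d) M]
  [IsManifold (𝓡 d) ω M]

/-- The differential at `y` of the chart at `p`. -/
noncomputable def chartD (p y : M) : TangentSpace (𝓡 d) y →L[ℝ] RSpace d :=
  mfderiv (𝓡 d) (𝓡 d) (chartAt (RSpace d) p) y

theorem chartDiff_tMk (p y : M) (a b : TangentSpace (𝓡 d) y) :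
    chartDiff p y (tMk a b) = toC d (chartD p y a) + Complex.I • toC d (chartD p y b) := by
  simp [chartDiff, tMk, chartD]
  rfl

theorem reC_add_smul (a b : RSpace d) : reC d (toC d a + Complex.I • toC d b) = a := by
  ext i; simp [toC_apply]

theorem imC_add_smul (a b : RSpace d) : imC d (toC d a + Complex.I • toC d b) = b := by
  ext i; simp [toC_apply]

theorem reC_chartDiff (p y : M) (x : CTangent d y) :
    reC d (chartDiff p y x) = chartD p y (tRe x) := by
  rw [← tMk_tRe_tIm x, chartDiff_tMk, reC_add_smul, tRe_tMk]

theorem imC_chartDiff (p y : M) (x : CTangent d y) :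
    imC d (chartDiff p y x) = chartD p y (tIm x) := by
  rw [← tMk_tRe_tIm x, chartDiff_tMk, imC_add_smul, tIm_tMk]

theorem chartDiff_tConj (p y : M) (x : CTangent d y) :
    chartDiff p y (tConj x) = star (chartDiff p y x) := by
  rw [← tMk_tRe_tIm x, tConj_tMk, chartDiff_tMk, chartDiff_tMk, star_add, star_smul, star_toC,
    star_toC, map_neg, map_neg]
  simp

theorem chartD_isInvertible {p y : M} (hy : y ∈ (chartAt (RSpace d) p).source) :
    (chartD (d := d) p y).IsInvertible :=
  ⟨(mdifferentiable_chart (I := 𝓡 d) p).mfderiv hy, rfl⟩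

theorem chartDiff_bijective {p y : M} (hy : y ∈ (chartAt (RSpace d) p).source) :
    Function.Bijective (chartDiff (d := d) p y) := by
  have hi := chartD_isInvertible hy
  refine ⟨(injective_iff_map_eq_zero _).2 fun x hx => ?_, fun z => ?_⟩
  · have h1 : chartD p y (tRe x) = 0 := by rw [← reC_chartDiff, hx, map_zero]
    have h2 : chartD p y (tIm x) = 0 := by rw [← imC_chartDiff, hx, map_zero]
    rw [← tMk_tRe_tIm x, (map_eq_zero_iff _ hi.injective).1 h1,
      (map_eq_zero_iff _ hi.injective).1 h2, tMk_zero]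
  · obtain ⟨a, ha⟩ := hi.surjective (reC d z)
    obtain ⟨b, hb⟩ := hi.surjective (imC d z)
    exact ⟨tMk a b, by rw [chartDiff_tMk, ha, hb, toC_reC_add]⟩

/-- The coordinate representation of a complex vector field in the chart at `p`. -/
noncomputable def fieldRep (p : M) (X : CField d M) (x : RSpace d) : CSpace d :=
  chartDiff p ((chartAt (RSpace d) p).symm x) (X ((chartAt (RSpace d) p).symm x))

/-- The complex vector field with a given coordinate representation. -/
noncomputable def ofRep (p : M) (Z : RSpace d → CSpace d) : CField d M := fun y =>
  tMk ((chartD p y).inverse (reC d (Z (chartAt (RSpace d) p y))))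
    ((chartD p y).inverse (imC d (Z (chartAt (RSpace d) p y))))

theorem chartDiff_ofRep {p y : M} (hy : y ∈ (chartAt (RSpace d) p).source)
    (Z : RSpace d → CSpace d) :
    chartDiff p y (ofRep p Z y) = Z (chartAt (RSpace d) p y) := by
  have hi := chartD_isInvertible hy
  rw [ofRep, chartDiff_tMk, hi.self_apply_inverse, hi.self_apply_inverse, toC_reC_add]

theorem fieldRep_apply {p y : M} (hy : y ∈ (chartAt (RSpace d) p).source) (X : CField d M) :
    fieldRep p X (chartAt (RSpace d) p y) = chartDiff p y (X y) := by
  rw [fieldRep, (chartAt (RSpace d) p).left_inv hy]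

theorem eventually_chart {p q : M} (hq : q ∈ (chartAt (RSpace d) p).source)
    {φ : RSpace d → Prop} (h : ∀ᶠ x in 𝓝 (chartAt (RSpace d) p q), φ x) :
    ∀ᶠ y in 𝓝 q, φ (chartAt (RSpace d) p y) :=
  ((chartAt (RSpace d) p).continuousAt hq).eventually h

theorem eventually_chart_symm {p q : M} (hq : q ∈ (chartAt (RSpace d) p).source)
    {φ : M → Prop} (h : ∀ᶠ y in 𝓝 q, φ y) :
    ∀ᶠ x in 𝓝 (chartAt (RSpace d) p q), φ ((chartAt (RSpace d) p).symm x) := by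
  have := (chartAt (RSpace d) p).continuousAt_symm ((chartAt (RSpace d) p).map_source hq)
  rw [ContinuousAt, (chartAt (RSpace d) p).left_inv hq] at this
  exact this.eventually h

theorem inverse_mfderiv_chart_symm {p : M} {x : RSpace d}
    (hx : x ∈ (chartAt (RSpace d) p).target) :
    (mfderiv (𝓡 d) (𝓡 d) (chartAt (RSpace d) p).symm x).inverse =
      chartD p ((chartAt (RSpace d) p).symm x) := by
  have h := mdifferentiable_chart (I := 𝓡 d) p
  have h1 := h.comp_symm_deriv hx
  have h2 := h.symm_comp_deriv ((chartAt (RSpace d) p).map_target hx)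
  rw [(chartAt (RSpace d) p).right_inv hx] at h2
  exact ContinuousLinearMap.inverse_eq h2 h1

theorem mpullback_chart_symm {p : M} {x : RSpace d} (hx : x ∈ (chartAt (RSpace d) p).target)
    (V : (y : M) → TangentSpace (𝓡 d) y) :
    VectorField.mpullback (𝓡 d) (𝓡 d) (chartAt (RSpace d) p).symm V x =
      chartD p ((chartAt (RSpace d) p).symm x) (V ((chartAt (RSpace d) p).symm x)) := by
  rw [VectorField.mpullback, inverse_mfderiv_chart_symm hx]
  rfl

theorem contMDiffAt_chart_symm {p : M} {x : RSpace d} (hx : x ∈ (chartAt (RSpace d) p).target) :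
    ContMDiffAt (𝓡 d) (𝓡 d) ω (chartAt (RSpace d) p).symm x :=
  (contMDiffOn_chart_symm (I := 𝓡 d) (n := ω)).contMDiffAt
    ((chartAt (RSpace d) p).open_target.mem_nhds hx)

theorem contMDiffAt_chart {p y : M} (hy : y ∈ (chartAt (RSpace d) p).source) :
    ContMDiffAt (𝓡 d) (𝓡 d) ω (chartAt (RSpace d) p) y :=
  (contMDiffOn_chart (I := 𝓡 d) (n := ω)).contMDiffAt
    ((chartAt (RSpace d) p).open_source.mem_nhds hy)

theorem contDiffAt_rep {m : WithTop ℕ∞} {p y : M} (hy : y ∈ (chartAt (RSpace d) p).source)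
    {V : (y : M) → TangentSpace (𝓡 d) y}
    (hV : ContMDiffAt (𝓡 d) (𝓡 d).tangent m (fun y => (⟨y, V y⟩ : TangentBundle (𝓡 d) M)) y) :
    ContDiffAt ℝ m (fun x => chartD p ((chartAt (RSpace d) p).symm x)
      (V ((chartAt (RSpace d) p).symm x))) (chartAt (RSpace d) p y) := by
  have hx := (chartAt (RSpace d) p).map_source hy
  have hl := (chartAt (RSpace d) p).left_inv hy
  have h1 : ContMDiffAt (𝓡 d) (𝓡 d).tangent m
      (fun x => (⟨x, VectorField.mpullback (𝓡 d) (𝓡 d) (chartAt (RSpace d) p).symm V x⟩ :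
        TangentBundle (𝓡 d) (RSpace d))) (chartAt (RSpace d) p y) := by
    refine ContMDiffAt.mpullback_vectorField_preimage (n := ω) (by rw [hl]; exact hV)
      (contMDiffAt_chart_symm hx) ?_ le_top
    exact ⟨(mdifferentiable_chart (I := 𝓡 d) p).symm.mfderiv hx, rfl⟩
  have h2 := contMDiffAt_vectorSpace_iff_contDiffAt.1 h1
  refine h2.congr_of_eventuallyEq ?_
  filter_upwards [(chartAt (RSpace d) p).open_target.mem_nhds hx] with x hx
  exact (mpullback_chart_symm hx V).symm

theorem contMDiffAt_of_rep {m : WithTop ℕ∞} {p y : M} (hy : y ∈ (chartAt (RSpace d) p).source)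
    {Z : RSpace d → RSpace d} (hZ : ContDiffAt ℝ m Z (chartAt (RSpace d) p y)) :
    ContMDiffAt (𝓡 d) (𝓡 d).tangent m (fun y => (⟨y, (chartD p y).inverse
      (Z (chartAt (RSpace d) p y))⟩ : TangentBundle (𝓡 d) M)) y :=
  ContMDiffAt.mpullback_vectorField_preimage (n := ω) (V := Z)
    (contMDiffAt_vectorSpace_iff_contDiffAt.2 hZ) (contMDiffAt_chart hy)
    (chartD_isInvertible hy) le_top

theorem RegularNear.contDiffAt {m : WithTop ℕ∞} {p q : M} {X : CField d M}
    (hq : q ∈ (chartAt (RSpace d) p).source) (hX : RegularNear m X q) :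
    ContDiffAt ℝ m (fieldRep p X) (chartAt (RSpace d) p q) := by
  have h1 := contDiffAt_rep hq hX.self_of_nhds.1
  have h2 := contDiffAt_rep hq hX.self_of_nhds.2
  have h3 := ((toCL d).contDiff.contDiffAt.comp _ h1).add
    (((toCL d).contDiff.contDiffAt.comp _ h2).const_smul Complex.I)
  refine h3.congr_of_eventuallyEq (Filter.Eventually.of_forall fun x => ?_)
  simp only [fieldRep]
  rw [← tMk_tRe_tIm (X ((chartAt (RSpace d) p).symm x)), chartDiff_tMk]
  simp [toCL_apply]

theorem regularNear_ofRep {m : WithTop ℕ∞} {p q : M} {Z : RSpace d → CSpace d}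
    (hq : q ∈ (chartAt (RSpace d) p).source)
    (hZ : ∀ᶠ x in 𝓝 (chartAt (RSpace d) p q), ContDiffAt ℝ m Z x) :
    RegularNear m (ofRep p Z) q := by
  filter_upwards [eventually_chart hq hZ, (chartAt (RSpace d) p).open_source.mem_nhds hq]
    with y h1 h2
  simp only [ofRep, tRe_tMk, tIm_tMk]
  exact ⟨contMDiffAt_of_rep h2 ((reC d).contDiff.contDiffAt.comp _ h1),
    contMDiffAt_of_rep h2 ((imC d).contDiff.contDiffAt.comp _ h1)⟩

theorem mlieBracket_rSpace (V W : RSpace d → RSpace d) (x : RSpace d) :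
    VectorField.mlieBracket (𝓡 d) V W x = VectorField.lieBracket ℝ V W x := by
  refine (congrFun (VectorField.mlieBracketWithin_univ (I := 𝓡 d)).symm x).trans ?_
  refine (congrFun (VectorField.mlieBracketWithin_eq_lieBracketWithin (V := V) (W := W)) x).trans ?_
  exact congrFun VectorField.lieBracketWithin_univ x

theorem chartD_mlieBracket {p q : M} (hq : q ∈ (chartAt (RSpace d) p).source)
    {V W : (y : M) → TangentSpace (𝓡 d) y}
    (hV : MDifferentiableAt (𝓡 d) (𝓡 d).tangent
      (fun y => (⟨y, V y⟩ : TangentBundle (𝓡 d) M)) q)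
    (hW : MDifferentiableAt (𝓡 d) (𝓡 d).tangent
      (fun y => (⟨y, W y⟩ : TangentBundle (𝓡 d) M)) q) :
    chartD p q (VectorField.mlieBracket (𝓡 d) V W q) =
      VectorField.lieBracket ℝ
        (fun x => chartD p ((chartAt (RSpace d) p).symm x) (V ((chartAt (RSpace d) p).symm x)))
        (fun x => chartD p ((chartAt (RSpace d) p).symm x) (W ((chartAt (RSpace d) p).symm x)))
        (chartAt (RSpace d) p q) := by
  have hx := (chartAt (RSpace d) p).map_source hq
  have hl := (chartAt (RSpace d) p).left_inv hq
  have h := VectorField.mpullback_mlieBracket (I := 𝓡 d) (I' := 𝓡 d) (n := ω)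
    (f := (chartAt (RSpace d) p).symm) (x₀ := chartAt (RSpace d) p q) (V := V) (W := W)
    (by rw [hl]; exact hV) (by rw [hl]; exact hW) (contMDiffAt_chart_symm hx) le_top
  rw [mpullback_chart_symm hx, hl] at h
  rw [h]
  have hev : ∀ V : (y : M) → TangentSpace (𝓡 d) y,
      (VectorField.mpullback (𝓡 d) (𝓡 d) (chartAt (RSpace d) p).symm V : RSpace d → RSpace d)
        =ᶠ[𝓝 (chartAt (RSpace d) p q)] (fun x => chartD p ((chartAt (RSpace d) p).symm x)
          (V ((chartAt (RSpace d) p).symm x))) := fun V => by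
    filter_upwards [(chartAt (RSpace d) p).open_target.mem_nhds hx] with x hx
    exact mpullback_chart_symm hx V
  exact (mlieBracket_rSpace _ _ _).trans
    (Filter.EventuallyEq.lieBracket_vectorField_eq (E := RSpace d) (hev V) (hev W))

theorem reC_I_smul (z : CSpace d) : reC d (Complex.I • z) = -imC d z := by
  ext i; simp [reC_apply, imC_apply]

theorem imC_I_smul (z : CSpace d) : imC d (Complex.I • z) = reC d z := by
  ext i; simp [reC_apply, imC_apply]

/-- The complex-linear extension of the differential of a map defined on real points. -/
noncomputable def cderiv (Z : RSpace d → CSpace d) (x : RSpace d) (w : CSpace d) : CSpace d :=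
  fderiv ℝ Z x (reC d w) + Complex.I • fderiv ℝ Z x (imC d w)

/-- The left side is the complex-bilinear bracket assembled from four real brackets. Expanding `X`
and `Y` into real and imaginary parts turns it into the usual coordinate formula, with the
derivatives along real directions extended complex-linearly. -/
theorem lieBracket_reC_imC {X Y : RSpace d → CSpace d} {x : RSpace d}
    (dX : DifferentiableAt ℝ X x) (dY : DifferentiableAt ℝ Y x) :
    toC d (VectorField.lieBracket ℝ (fun x => reC d (X x)) (fun x => reC d (Y x)) x -
        VectorField.lieBracket ℝ (fun x => imC d (X x)) (fun x => imC d (Y x)) x) +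
      Complex.I • toC d
        (VectorField.lieBracket ℝ (fun x => reC d (X x)) (fun x => imC d (Y x)) x +
          VectorField.lieBracket ℝ (fun x => imC d (X x)) (fun x => reC d (Y x)) x) =
      cderiv Y x (X x) - cderiv X x (Y x) := by
  have fre : ∀ Z : RSpace d → CSpace d, DifferentiableAt ℝ Z x → ∀ u,
      fderiv ℝ (fun x => reC d (Z x)) x u = reC d (fderiv ℝ Z x u) := fun Z hZ u =>
    congrArg (fun L => L u) ((reC d).hasFDerivAt.comp x hZ.hasFDerivAt).fderiv
  have fim : ∀ Z : RSpace d → CSpace d, DifferentiableAt ℝ Z x → ∀ u,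
      fderiv ℝ (fun x => imC d (Z x)) x u = imC d (fderiv ℝ Z x u) := fun Z hZ u =>
    congrArg (fun L => L u) ((imC d).hasFDerivAt.comp x hZ.hasFDerivAt).fderiv
  simp only [VectorField.lieBracket, fre _ dX, fre _ dY, fim _ dX, fim _ dY]
  rw [← toC_reC_add (cderiv Y x (X x) - cderiv X x (Y x))]
  refine congrArg₂ (fun a b => toC d a + Complex.I • toC d b) ?_ ?_
  · simp only [cderiv, map_add, map_sub, reC_I_smul]
    abel
  · simp only [cderiv, map_add, map_sub, imC_I_smul]
    abel

theorem chartDiff_cBracket {p q : M} (hq : q ∈ (chartAt (RSpace d) p).source)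
    {X Y : CField d M} (hX : RegularNear ∞ X q) (hY : RegularNear ∞ Y q) :
    chartDiff p q (cBracket X Y q) =
      cderiv (fieldRep p Y) (chartAt (RSpace d) p q) (chartDiff p q (X q)) -
        cderiv (fieldRep p X) (chartAt (RSpace d) p q) (chartDiff p q (Y q)) := by
  have dX := (hX.contDiffAt hq).differentiableAt (by simp)
  have dY := (hY.contDiffAt hq).differentiableAt (by simp)
  have hre : ∀ Z : CField d M, (fun x => reC d (fieldRep p Z x)) =
      (fun x => chartD p ((chartAt (RSpace d) p).symm x)
        (tRe (Z ((chartAt (RSpace d) p).symm x)))) :=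
    fun Z => funext fun x => reC_chartDiff _ _ _
  have him : ∀ Z : CField d M, (fun x => imC d (fieldRep p Z x)) =
      (fun x => chartD p ((chartAt (RSpace d) p).symm x)
        (tIm (Z ((chartAt (RSpace d) p).symm x)))) :=
    fun Z => funext fun x => imC_chartDiff _ _ _
  rw [← fieldRep_apply hq X, ← fieldRep_apply hq Y, ← lieBracket_reC_imC dX dY]
  simp only [hre, him]
  rw [← chartD_mlieBracket hq hX.mdiff.1 hY.mdiff.1, ← chartD_mlieBracket hq hX.mdiff.2 hY.mdiff.2,
    ← chartD_mlieBracket hq hX.mdiff.1 hY.mdiff.2, ← chartD_mlieBracket hq hX.mdiff.2 hY.mdiff.1,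
    cBracket, chartDiff_tMk, ← map_sub (chartD p q), ← map_add (chartD p q)]

/-- Sections of a CR structure are only smooth and need not extend holomorphically. It is enough to
differentiate `P Z = 0` along real directions: `P` is holomorphic, so both sides extend
complex-linearly in `w`. -/
theorem apply_cderiv {F : Type*} [NormedAddCommGroup F] [NormedSpace ℂ F]
    {P : CSpace d → CSpace d →L[ℂ] F} {Z : RSpace d → CSpace d} {x : RSpace d}
    (hP : AnalyticAt ℂ P (toC d x)) (hZ : DifferentiableAt ℝ Z x)
    (h : ∀ᶠ y in 𝓝 x, P (toC d y) (Z y) = 0) (w : CSpace d) :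
    P (toC d x) (cderiv Z x w) = -fderiv ℂ P (toC d x) w (Z x) := by
  let _ : NormedSpace ℝ F := NormedSpace.restrictScalars ℝ ℂ F
  have _ : IsScalarTower ℝ ℂ F := IsScalarTower.of_algebraMap_smul fun _ _ => rfl
  have h1 : HasFDerivAt (fun y => P (toC d y))
      (((fderiv ℂ P (toC d x)).restrictScalars ℝ).comp (toCL d)) x :=
    (hP.differentiableAt.hasFDerivAt.restrictScalars ℝ).comp x (toCL d).hasFDerivAt
  have key : ∀ u, fderiv ℂ P (toC d x) (toC d u) (Z x) + P (toC d x) (fderiv ℝ Z x u) = 0 := by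
    intro u
    have h2 := (ContinuousLinearMap.restrictScalarsL ℂ (CSpace d) F ℝ ℝ).hasFDerivAt.comp x h1
    have h3 := h2.clm_apply hZ.hasFDerivAt
    have h4 := (h3.congr_of_eventuallyEq (f₁ := fun _ => (0 : F))
      (by filter_upwards [h] with y hy using hy.symm)).unique (hasFDerivAt_const (0 : F) x)
    have := congrArg (fun L => L u) h4
    simpa [add_comm, toCL_apply] using this
  rw [cderiv, map_add, map_smul, eq_neg_of_add_eq_zero_right (key _),
    eq_neg_of_add_eq_zero_right (key _)]
  conv_rhs => rw [← toC_reC_add w]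
  rw [map_add, map_smul, add_apply, smul_apply, smul_neg, neg_add]

/-- For sections of the kernel of `P` over the real points, the image under `P` of the bracket is
given by the curvature of `P`. -/
theorem apply_chartDiff_cBracket {F : Type*} [NormedAddCommGroup F] [NormedSpace ℂ F]
    {P : CSpace d → CSpace d →L[ℂ] F} {p q : M} (hq : q ∈ (chartAt (RSpace d) p).source)
    (hP : AnalyticAt ℂ P (toC d (chartAt (RSpace d) p q)))
    {X Y : CField d M} (hX : RegularNear ∞ X q) (hY : RegularNear ∞ Y q)
    (h1 : ∀ᶠ y in 𝓝 q, P (toC d (chartAt (RSpace d) p y)) (chartDiff p y (X y)) = 0)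
    (h2 : ∀ᶠ y in 𝓝 q, P (toC d (chartAt (RSpace d) p y)) (chartDiff p y (Y y)) = 0) :
    P (toC d (chartAt (RSpace d) p q)) (chartDiff p q (cBracket X Y q)) =
      curv P (toC d (chartAt (RSpace d) p q)) (chartDiff p q (X q)) (chartDiff p q (Y q)) := by
  have ht := (chartAt (RSpace d) p).open_target.mem_nhds ((chartAt (RSpace d) p).map_source hq)
  have key : ∀ Z : CField d M,
      (∀ᶠ y in 𝓝 q, P (toC d (chartAt (RSpace d) p y)) (chartDiff p y (Z y)) = 0) →
      ∀ᶠ x in 𝓝 (chartAt (RSpace d) p q), P (toC d x) (fieldRep p Z x) = 0 := fun Z h => by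
    filter_upwards [eventually_chart_symm hq h, ht] with x hx hxt
    rwa [(chartAt (RSpace d) p).right_inv hxt] at hx
  rw [chartDiff_cBracket hq hX hY, map_sub,
    apply_cderiv hP ((hX.contDiffAt hq).differentiableAt (by simp)) (key X h1),
    apply_cderiv hP ((hY.contDiffAt hq).differentiableAt (by simp)) (key Y h2),
    fieldRep_apply hq, fieldRep_apply hq, curv_apply]
  abel

end Chart
end LeviCR

namespace LeviCR

set_option linter.unusedSectionVars false

/-! ## CR structures in a complexified chart -/

/-- Evaluated on holomorphic frames the curvature is a finite family of holomorphic functions, to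
which the identity theorem applies; bilinearity does the rest. -/
theorem curv_eq_zero_of_real {d m : ℕ} {P : CSpace d → CSpace d →L[ℂ] (Fin m → ℂ)}
    {D D' : CSpace d → Submodule ℂ (CSpace d)} {x₀ : RSpace d}
    (hP : AnalyticAt ℂ P (toC d x₀)) (hD : IsDistAt D (toC d x₀)) (hD' : IsDistAt D' (toC d x₀))
    (h : ∀ᶠ x in 𝓝 x₀, ∀ v ∈ D (toC d x), ∀ w ∈ D' (toC d x), curv P (toC d x) v w = 0) :
    ∀ᶠ z in 𝓝 (toC d x₀), ∀ v ∈ D z, ∀ w ∈ D' z, curv P z v w = 0 := by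
  obtain ⟨X, hX⟩ := hD.exists_frame rfl
  obtain ⟨Y, hY⟩ := hD'.exists_frame rfl
  have h1 : ∀ i j, ∀ᶠ z in 𝓝 (toC d x₀), curv P z (X i z) (Y j z) = 0 := fun i j => by
    refine eventually_eq_zero_of_real (analyticAt_clm_apply (analyticAt_clm_apply
      (analyticAt_curv hP) (hX.analyticAt i)) (hY.analyticAt j)) ?_
    filter_upwards [h, eventually_toC (hX.isSec i).2, eventually_toC (hY.isSec j).2]
      with x h1 h2 h3 using h1 _ h2 _ h3
  filter_upwards [hX.span_eq, hY.span_eq,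
    Filter.eventually_all.2 fun i => Filter.eventually_all.2 fun j => h1 i j] with z h2 h3 h4 v hv w hw
  rw [← h2] at hv
  rw [← h3] at hw
  have h5 : ∀ i, curv P z (X i z) w = 0 := fun i => by
    have : Submodule.span ℂ (Set.range fun j => Y j z) ≤
        LinearMap.ker (curv P z (X i z)).toLinearMap := by
      rw [Submodule.span_le]; rintro _ ⟨j, rfl⟩; exact h4 i j
    exact this hw
  have : Submodule.span ℂ (Set.range fun i => X i z) ≤
      LinearMap.ker ((curv P z).flip w).toLinearMap := by
    rw [Submodule.span_le]; rintro _ ⟨i, rfl⟩; exact h5 i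
  exact this hv

section Chart

variable {d : ℕ} {M : Type*} [TopologicalSpace M] [ChartedSpace (RSpace d) M]
  [IsManifold (𝓡 d) ω M]

theorem RegularNear.of_le {m m' : WithTop ℕ∞} {X : CField d M} {p : M} (h : RegularNear m X p)
    (hm : m' ≤ m) : RegularNear m' X p := by
  filter_upwards [h] with q hq using ⟨hq.1.of_le hm, hq.2.of_le hm⟩

theorem tRe_tConj {V : Type*} [AddCommGroup V] [Module ℝ V] (x : ℂ ⊗[ℝ] V) :
    tRe (tConj x) = tRe x := by
  rw [← tMk_tRe_tIm x, tConj_tMk, tRe_tMk, tRe_tMk]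

theorem tIm_tConj {V : Type*} [AddCommGroup V] [Module ℝ V] (x : ℂ ⊗[ℝ] V) :
    tIm (tConj x) = -tIm x := by
  rw [← tMk_tRe_tIm x, tConj_tMk, tIm_tMk, tIm_tMk]

theorem RegularNear.bar {m : WithTop ℕ∞} {X : CField d M} {p : M} (h : RegularNear m X p) :
    RegularNear m (barField X) p := by
  filter_upwards [h] with q hq
  simp only [barField, tRe_tConj, tIm_tConj]
  exact ⟨hq.1, hq.2.neg_section⟩

theorem mem_barSub {V : Type*} [AddCommGroup V] [Module ℝ V] {S : Submodule ℂ (ℂ ⊗[ℝ] V)}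
    {x : ℂ ⊗[ℝ] V} : x ∈ barSub S ↔ tConj x ∈ S := Iff.rfl

theorem IsSectionNear.bar {H : CDist d M} {X : CField d M} {p : M} (h : IsSectionNear H X p) :
    IsSectionNear (barDist H) (barField X) p :=
  ⟨h.1.bar, by filter_upwards [h.2] with q hq; rwa [barDist, barField, mem_barSub, tConj_tConj]⟩

/-- The point of the complexified chart at `p` that corresponds to `q`. -/
noncomputable abbrev realPoint (d : ℕ) {M : Type*} [TopologicalSpace M] [ChartedSpace (RSpace d) M]
    (p q : M) : CSpace d := toC d (chartAt (RSpace d) p q)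

/-- Near `q`, the field `Dc` restricts to the field `D` on real points of the chart at `p`. -/
def ExtendsAt (p q : M) (D : CDist d M) (Dc : CSpace d → Submodule ℂ (CSpace d)) : Prop :=
  ∀ᶠ y in 𝓝 q, Dc (realPoint d p y) = (D y).map (chartDiff p y)

variable {p q : M} {D D' : CDist d M} {Dc Dc' : CSpace d → Submodule ℂ (CSpace d)}

theorem ExtendsAt.eventually (h : ExtendsAt p q D Dc) : ∀ᶠ y in 𝓝 q, ExtendsAt p y D Dc :=
  h.eventually_nhds

theorem ExtendsAt.sup (h : ExtendsAt p q D Dc) (h' : ExtendsAt p q D' Dc') :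
    ExtendsAt p q (fun y => D y ⊔ D' y) (fun z => Dc z ⊔ Dc' z) := by
  filter_upwards [h, h'] with y h1 h2
  rw [h1, h2, Submodule.map_sup]

theorem ExtendsAt.tau (h : ExtendsAt p q D Dc) : ExtendsAt p q (barDist D) (tauDist Dc) := by
  filter_upwards [h] with y h1
  ext v
  rw [mem_tauDist, star_toC, h1]
  constructor
  · rintro ⟨x, hx, hv⟩
    refine ⟨tConj x, ?_, ?_⟩
    · rw [SetLike.mem_coe, barDist, mem_barSub, tConj_tConj]; exact hx
    · rw [chartDiff_tConj, hv, star_star]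
  · rintro ⟨x, hx, rfl⟩
    exact ⟨tConj x, hx, chartDiff_tConj _ _ _⟩

theorem ExtendsAt.mem_iff (h : ExtendsAt p q D Dc) (hq : q ∈ (chartAt (RSpace d) p).source)
    {x : CTangent d q} : chartDiff p q x ∈ Dc (realPoint d p q) ↔ x ∈ D q := by
  rw [h.self_of_nhds]
  constructor
  · rintro ⟨y, hy, hyx⟩
    rwa [← (chartDiff_bijective hq).1 hyx]
  · exact fun hx => ⟨x, hx, rfl⟩

theorem ExtendsAt.exists_eq (h : ExtendsAt p q D Dc) {v : CSpace d}
    (hv : v ∈ Dc (realPoint d p q)) : ∃ x ∈ D q, chartDiff p q x = v := by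
  rw [h.self_of_nhds] at hv
  exact hv

/-- A holomorphic section through the corresponding complex vector is restricted to real points.
This makes tests over all smooth sections equivalent to tests over all vectors of the fibre. -/
theorem ExtendsAt.exists_section (h : ExtendsAt p q D Dc)
    (hq : q ∈ (chartAt (RSpace d) p).source) (hD : IsDistAt Dc (realPoint d p q))
    {x : CTangent d q} (hx : x ∈ D q) : ∃ X : CField d M, IsSectionNear D X q ∧ X q = x := by
  obtain ⟨Z, hZ, hZq⟩ := hD.exists_sec ((h.mem_iff hq).2 hx)
  refine ⟨ofRep p fun x => Z (toC d x), ⟨?_, ?_⟩, ?_⟩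
  · refine RegularNear.of_le (m := ω) (regularNear_ofRep hq ?_) le_top
    filter_upwards [eventually_toC hZ.1.eventually_analyticAt] with x hx
    exact (AnalyticAt.comp (hx.restrictScalars (𝕜 := ℝ)) ((toCL d).analyticAt x)).contDiffAt
  · filter_upwards [h.eventually, eventually_chart hq (eventually_toC hZ.2),
      (chartAt (RSpace d) p).open_source.mem_nhds hq] with y h1 h2 h3
    rw [← h1.mem_iff h3, chartDiff_ofRep h3]
    exact h2
  · apply (chartDiff_bijective (d := d) hq).1
    rw [chartDiff_ofRep hq]
    exact hZq

theorem ExtendsAt.eventually_apply_eq_zero (h : ExtendsAt p q D Dc)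
    (hq : q ∈ (chartAt (RSpace d) p).source) {m : ℕ} {P : CSpace d → CSpace d →L[ℂ] (Fin m → ℂ)}
    (hP : IsCoframeAt P Dc (realPoint d p q)) {X : CField d M} (hX : ∀ᶠ y in 𝓝 q, X y ∈ D y) :
    ∀ᶠ y in 𝓝 q, P (realPoint d p y) (chartDiff p y (X y)) = 0 := by
  filter_upwards [h, hX, eventually_chart hq (eventually_toC hP.mem_iff)] with y h1 h2 h3
  exact (h3 _).1 (by rw [h1]; exact ⟨_, h2, rfl⟩)

theorem ExtendsAt.apply_cBracket (h : ExtendsAt p q D Dc)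
    (hq : q ∈ (chartAt (RSpace d) p).source) {m : ℕ} {P : CSpace d → CSpace d →L[ℂ] (Fin m → ℂ)}
    (hP : IsCoframeAt P Dc (realPoint d p q)) {X Y : CField d M} (hX : RegularNear ∞ X q)
    (hY : RegularNear ∞ Y q) (hXD : ∀ᶠ y in 𝓝 q, X y ∈ D y) (hYD : ∀ᶠ y in 𝓝 q, Y y ∈ D y) :
    P (realPoint d p q) (chartDiff p q (cBracket X Y q)) =
      curv P (realPoint d p q) (chartDiff p q (X q)) (chartDiff p q (Y q)) :=
  apply_chartDiff_cBracket hq hP.analyticAt hX hY (h.eventually_apply_eq_zero hq hP hXD)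
    (h.eventually_apply_eq_zero hq hP hYD)

theorem ExtendsAt.cBracket_mem_iff (h : ExtendsAt p q D Dc)
    (hq : q ∈ (chartAt (RSpace d) p).source) {m : ℕ} {P : CSpace d → CSpace d →L[ℂ] (Fin m → ℂ)}
    (hP : IsCoframeAt P Dc (realPoint d p q)) {X Y : CField d M} (hX : RegularNear ∞ X q)
    (hY : RegularNear ∞ Y q) (hXD : ∀ᶠ y in 𝓝 q, X y ∈ D y) (hYD : ∀ᶠ y in 𝓝 q, Y y ∈ D y) :
    cBracket X Y q ∈ D q ↔
      curv P (realPoint d p q) (chartDiff p q (X q)) (chartDiff p q (Y q)) = 0 := by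
  rw [← h.mem_iff hq, hP.mem_iff.self_of_nhds, h.apply_cBracket hq hP hX hY hXD hYD]

/-- Involutivity of a distribution in a complexified chart. -/
theorem ExtendsAt.involutive_iff (h : ExtendsAt p q D Dc)
    (hq : q ∈ (chartAt (RSpace d) p).source) {m : ℕ} {P : CSpace d → CSpace d →L[ℂ] (Fin m → ℂ)}
    (hP : IsCoframeAt P Dc (realPoint d p q)) :
    (∀ X Y : CField d M, IsSectionNear D X q → IsSectionNear D Y q → cBracket X Y q ∈ D q) ↔
      ∀ v ∈ Dc (realPoint d p q), ∀ w ∈ Dc (realPoint d p q), curv P (realPoint d p q) v w = 0 := by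
  constructor
  · intro hb v hv w hw
    obtain ⟨x, hx, rfl⟩ := h.exists_eq hv
    obtain ⟨y, hy, rfl⟩ := h.exists_eq hw
    obtain ⟨X, hX, rfl⟩ := h.exists_section hq hP.isDistAt hx
    obtain ⟨Y, hY, rfl⟩ := h.exists_section hq hP.isDistAt hy
    exact (h.cBracket_mem_iff hq hP hX.1 hY.1 hX.2 hY.2).1 (hb X Y hX hY)
  · intro hb X Y hX hY
    exact (h.cBracket_mem_iff hq hP hX.1 hY.1 hX.2 hY.2).2
      (hb _ ((h.mem_iff hq).2 hX.2.self_of_nhds) _ ((h.mem_iff hq).2 hY.2.self_of_nhds))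

variable {H : CDist d M} {Hc Kc : CSpace d → Submodule ℂ (CSpace d)}

/-- The Levi kernel in a complexified chart. -/
theorem ExtendsAt.mem_leviKernel_iff (h : ExtendsAt p q H Hc)
    (hq : q ∈ (chartAt (RSpace d) p).source) {m : ℕ} {P : CSpace d → CSpace d →L[ℂ] (Fin m → ℂ)}
    (hH : IsDistAt Hc (realPoint d p q))
    (hP : IsCoframeAt P (fun z => Hc z ⊔ tauDist Hc z) (realPoint d p q)) {x : CTangent d q} :
    x ∈ leviKernel H q ↔ x ∈ H q ∧ ∀ w ∈ tauDist Hc (realPoint d p q),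
      curv P (realPoint d p q) (chartDiff p q x) w = 0 := by
  have hC := h.sup h.tau
  have hI : (Complex.I / 2 : ℂ) ≠ 0 := by simp
  have key : ∀ X Y : CField d M, IsSectionNear H X q → IsSectionNear H Y q →
      (leviRep X Y q ∈ H q ⊔ barDist H q ↔ curv P (realPoint d p q) (chartDiff p q (X q))
        (chartDiff p q (barField Y q)) = 0) := fun X Y hX hY => by
    rw [leviRep, Submodule.smul_mem_iff _ hI]
    exact hC.cBracket_mem_iff hq hP hX.1 hY.1.bar
      (by filter_upwards [hX.2] with y hy using Submodule.mem_sup_left hy)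
      (by filter_upwards [hY.bar.2] with y hy using Submodule.mem_sup_right hy)
  constructor
  · rintro ⟨X, hX, rfl, hb⟩
    refine ⟨hX.2.self_of_nhds, fun w hw => ?_⟩
    obtain ⟨y, hy, rfl⟩ := h.tau.exists_eq hw
    obtain ⟨Y, hY, hYy⟩ := h.exists_section hq hH (x := tConj y) hy
    have := (key X Y hX hY).1 (hb Y hY)
    rwa [barField, hYy, tConj_tConj] at this
  · rintro ⟨hx, hb⟩
    obtain ⟨X, hX, rfl⟩ := h.exists_section hq hH hx
    refine ⟨X, hX, rfl, fun Y hY => (key X Y hX hY).2 (hb _ ?_)⟩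
    exact (h.tau.mem_iff hq).2 hY.bar.2.self_of_nhds

/-- Nondegeneracy in a complexified chart. -/
theorem isTwoNondegenerateAt_iff (h : ExtendsAt p q H Hc) (h' : ExtendsAt p q (leviKernel H) Kc)
    (hq : q ∈ (chartAt (RSpace d) p).source) {m : ℕ} {P : CSpace d → CSpace d →L[ℂ] (Fin m → ℂ)}
    (hH : IsDistAt Hc (realPoint d p q)) (hK : IsDistAt Kc (realPoint d p q))
    (hP : IsCoframeAt P (fun z => Hc z ⊔ tauDist Kc z) (realPoint d p q)) :
    IsTwoNondegenerateAt H q ↔ leviKernel H q ≠ ⊥ ∧ ∀ v ∈ tauDist Kc (realPoint d p q), v ≠ 0 →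
      ∃ w ∈ Hc (realPoint d p q), curv P (realPoint d p q) v w ≠ 0 := by
  have hS := h.sup h'.tau
  have key : ∀ X Y : CField d M, IsSectionNear H X q → IsSectionNear (leviKernel H) Y q →
      (cBracket X (barField Y) q ∈ H q ⊔ leviKernelBar H q ↔ curv P (realPoint d p q)
        (chartDiff p q (barField Y q)) (chartDiff p q (X q)) = 0) := fun X Y hX hY => by
    rw [curv_swap, neg_eq_zero]
    exact hS.cBracket_mem_iff hq hP hX.1 hY.1.bar
      (by filter_upwards [hX.2] with y hy using Submodule.mem_sup_left hy)
      (by filter_upwards [hY.bar.2] with y hy using Submodule.mem_sup_right hy)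
  refine and_congr_right fun _ => ⟨fun hn v hv hv0 => ?_, fun hn Y hY hY0 => ?_⟩
  · obtain ⟨y, hy, rfl⟩ := h'.tau.exists_eq hv
    obtain ⟨Y, hY, hYy⟩ := h'.exists_section hq hK (x := tConj y) hy
    have hYb : barField Y q = y := by rw [barField, hYy, tConj_tConj]
    obtain ⟨X, hX, hXY⟩ := hn Y hY fun h0 => hv0 (by
      rw [← hYb, barField, h0, map_zero, map_zero])
    refine ⟨_, (h.mem_iff hq).2 hX.2.self_of_nhds, ?_⟩
    rw [key X Y hX hY, hYb] at hXY
    exact hXY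
  · obtain ⟨w, hw, hvw⟩ := hn (chartDiff p q (barField Y q))
      ((h'.tau.mem_iff hq).2 hY.bar.2.self_of_nhds) fun h0 => hY0 (by
        have := (map_eq_zero_iff _ (chartDiff_bijective (d := d) hq).1).1 h0
        rw [← tConj_tConj (Y q), show tConj (Y q) = 0 from this, map_zero])
    obtain ⟨x, hx, rfl⟩ := h.exists_eq hw
    obtain ⟨X, hX, rfl⟩ := h.exists_section hq hH hx
    exact ⟨X, hX, fun hb => hvw ((key X Y hX hY).1 hb)⟩

/-- The condition that `ad K̄` is generated by an operator of rank greater than one, in a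
complexified chart. -/
theorem adKbar_eq_span_iff (h : ExtendsAt p q H Hc) (h' : ExtendsAt p q (leviKernel H) Kc)
    (hq : q ∈ (chartAt (RSpace d) p).source) {m l : ℕ}
    {P : CSpace d → CSpace d →L[ℂ] (Fin m → ℂ)} {Q : CSpace d → CSpace d →L[ℂ] (Fin l → ℂ)}
    (hH : IsDistAt Hc (realPoint d p q)) (hK : IsDistAt Kc (realPoint d p q))
    (hP : IsCoframeAt P (fun z => Hc z ⊔ tauDist Kc z) (realPoint d p q))
    (hQ : IsCoframeAt Q (fun z => Hc z ⊔ tauDist Hc z) (realPoint d p q))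
    (htr : Hc (realPoint d p q) ⊓ tauDist Hc (realPoint d p q) = ⊥)
    (hKH : ∀ᶠ z in 𝓝 (realPoint d p q), Kc z ≤ Hc z)
    (hKK : ∀ v ∈ tauDist Kc (realPoint d p q), ∀ w ∈ Kc (realPoint d p q),
      curv P (realPoint d p q) v w = 0)
    (hKC : ∀ v ∈ tauDist Kc (realPoint d p q), ∀ w ∈ Hc (realPoint d p q),
      curv Q (realPoint d p q) v w = 0)
    (h1 : Module.finrank ℂ (leviKernel H q) = 1) :
    (∃ A : HmodK H q →ₗ[ℂ] HbarModKbar H q,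
      adKbar H q = Submodule.span ℂ {A} ∧ 1 < Module.finrank ℂ A.range) ↔
    ∃ v ∈ tauDist Kc (realPoint d p q), ∃ w₁ ∈ Hc (realPoint d p q),
      ∃ w₂ ∈ Hc (realPoint d p q), LinearIndependent ℂ
        ![curv P (realPoint d p q) v w₁, curv P (realPoint d p q) v w₂] := by
  set z := realPoint d p q with hz
  have hS := h.sup h'.tau
  have hC := h.sup h.tau
  have hτKH : ∀ᶠ y in 𝓝 q, barDist (leviKernel H) y ≤ barDist H y := by
    filter_upwards [h, h', eventually_chart hq (eventually_toC hKH),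
      (chartAt (RSpace d) p).open_source.mem_nhds hq] with y e1 e2 e3 e4 x hx
    have : chartDiff p y (tConj x) ∈ Kc (realPoint d p y) := by rw [e2]; exact ⟨_, hx, rfl⟩
    have := e3 this
    rw [e1] at this
    obtain ⟨x', hx', he⟩ := this
    rw [barDist, mem_barSub, ← (chartDiff_bijective e4).1 he]
    exact hx'
  -- A vector of `H̄` killed by `P` lies in `H ⊕ K̄`; its `H`-part is in `H ∩ H̄ = 0`, so it lies in
  -- `K̄`. Hence `P` embeds `H̄ / K̄` in the space of curvature values.
  let ψ₀ : barDist H q →ₗ[ℂ] (Fin m → ℂ) :=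
    (P z).toLinearMap ∘ₗ chartDiff p q ∘ₗ (barDist H q).subtype
  have hψ₀ : (leviKernelBar H q).submoduleOf (barDist H q) = LinearMap.ker ψ₀ := by
    ext x
    change (x : CTangent d q) ∈ leviKernelBar H q ↔ P z (chartDiff p q x) = 0
    rw [← hP.mem_iff.self_of_nhds, hS.mem_iff hq]
    refine ⟨fun hx => Submodule.mem_sup_right hx, fun hx => ?_⟩
    obtain ⟨a, ha, b, hb, hab⟩ := Submodule.mem_sup.1 hx
    have h0 : chartDiff p q a ∈ Hc z ⊓ tauDist Hc z := by
      refine ⟨(h.mem_iff hq).2 ha, (h.tau.mem_iff hq).2 ?_⟩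
      rw [eq_sub_of_add_eq hab]
      exact sub_mem x.2 (hτKH.self_of_nhds hb)
    rw [htr, Submodule.mem_bot, map_eq_zero_iff _ (chartDiff_bijective (d := d) hq).1] at h0
    rw [← hab, h0, zero_add]
    exact hb
  let ψ : HbarModKbar H q →ₗ[ℂ] (Fin m → ℂ) := Submodule.liftQ _ ψ₀ hψ₀.le
  have hψ : Function.Injective ψ :=
    LinearMap.ker_eq_bot.1 (Submodule.ker_liftQ_eq_bot' _ _ hψ₀)
  have hVS : ∀ V : CField d M, IsSectionNear (leviKernelBar H) V q →
      ∀ Y : CField d M, IsSectionNear H Y q → P z (chartDiff p q (cBracket V Y q)) =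
        curv P z (chartDiff p q (V q)) (chartDiff p q (Y q)) := fun V hV Y hY =>
    hS.apply_cBracket hq hP hV.1 hY.1
      (by filter_upwards [hV.2] with y hy using Submodule.mem_sup_right hy)
      (by filter_upwards [hY.2] with y hy using Submodule.mem_sup_left hy)
  -- Through the embedding `ψ`, the operator `ad_V` is the curvature form with first argument `V`.
  have hAd : ∀ V : CField d M, IsSectionNear (leviKernelBar H) V q →
      ∀ A : HmodK H q →ₗ[ℂ] HbarModKbar H q, IsAd H q V A ↔ ∀ x : H q,
        ψ (A (Submodule.Quotient.mk x)) = curv P z (chartDiff p q (V q)) (chartDiff p q x) := by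
    intro V hV A
    constructor
    · rintro hA ⟨x, hx⟩
      obtain ⟨Y, hY, rfl⟩ := h.exists_section hq hH hx
      obtain ⟨t, ht, ht'⟩ := hA Y hY hx
      rw [ht, ← hVS V hV Y hY]
      rw [← hS.mem_iff hq, hP.mem_iff.self_of_nhds, map_sub, map_sub, sub_eq_zero] at ht'
      exact ht'.symm
    · intro hA Y hY hYq
      obtain ⟨t, ht⟩ := Submodule.Quotient.mk_surjective _ (A (Submodule.Quotient.mk ⟨Y q, hYq⟩))
      refine ⟨t, ht.symm, ?_⟩
      rw [← hS.mem_iff hq, hP.mem_iff.self_of_nhds, map_sub, map_sub, sub_eq_zero, hVS V hV Y hY,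
        ← hA ⟨Y q, hYq⟩, ← ht]
      rfl
  -- Existence of `ad_V`: the form descends to `H / K` because `K ⊕ K̄` is isotropic (`hKK`), and
  -- its values come from `H̄ / K̄` because `[K̄, H] ⊆ H ⊕ H̄` (`hKC`).
  have hex : ∀ V : CField d M, IsSectionNear (leviKernelBar H) V q →
      ∃ A : HmodK H q →ₗ[ℂ] HbarModKbar H q, IsAd H q V A := by
    intro V hV
    have hVq := (h'.tau.mem_iff hq).2 hV.2.self_of_nhds
    let B₀ : H q →ₗ[ℂ] (Fin m → ℂ) :=
      (curv P z (chartDiff p q (V q))).toLinearMap ∘ₗ chartDiff p q ∘ₗ (H q).subtype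
    have hB₀ : (leviKernel H q).submoduleOf (H q) ≤ LinearMap.ker B₀ := fun x hx =>
      hKK _ hVq _ ((h'.mem_iff hq).2 hx)
    let B : HmodK H q →ₗ[ℂ] (Fin m → ℂ) := Submodule.liftQ _ B₀ hB₀
    have hB : ∀ t, B t ∈ LinearMap.range ψ := by
      intro t
      obtain ⟨⟨x, hx⟩, rfl⟩ := Submodule.Quotient.mk_surjective _ t
      obtain ⟨Y, hY, rfl⟩ := h.exists_section hq hH hx
      have hmem : cBracket V Y q ∈ H q ⊔ barDist H q := by
        refine (hC.cBracket_mem_iff hq hQ hV.1 hY.1 ?_ ?_).2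
          (hKC _ hVq _ ((h.mem_iff hq).2 hx))
        · filter_upwards [hV.2, hτKH] with y hy hy' using Submodule.mem_sup_right (hy' hy)
        · filter_upwards [hY.2] with y hy using Submodule.mem_sup_left hy
      obtain ⟨a, ha, b, hb, hab⟩ := Submodule.mem_sup.1 hmem
      refine ⟨Submodule.Quotient.mk ⟨b, hb⟩, ?_⟩
      have e1 : P z (chartDiff p q a) = 0 :=
        (hP.mem_iff.self_of_nhds _).1 (Submodule.mem_sup_left ((h.mem_iff hq).2 ha))
      have e2 := hVS V hV Y hY
      rw [← hab, map_add, map_add, e1, zero_add] at e2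
      exact e2
    refine ⟨(LinearEquiv.ofInjective ψ hψ).symm.toLinearMap ∘ₗ B.codRestrict _ hB,
      (hAd V hV _).2 fun x => ?_⟩
    have := congrArg Subtype.val ((LinearEquiv.ofInjective ψ hψ).apply_symm_apply
      (B.codRestrict _ hB (Submodule.Quotient.mk x)))
    exact this
  constructor
  · rintro ⟨A, hA, hr⟩
    have hmem : A ∈ adKbar H q := hA ▸ Submodule.mem_span_singleton_self A
    obtain ⟨V, hV, hVA⟩ := hmem
    rw [hAd V hV] at hVA
    have : Nontrivial A.range := Module.nontrivial_of_finrank_pos (R := ℂ) (by omega)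
    obtain ⟨a, ha⟩ := exists_ne (0 : A.range)
    obtain ⟨b, hab⟩ := exists_linearIndependent_pair_of_one_lt_finrank hr ha
    obtain ⟨_, s, rfl⟩ := a
    obtain ⟨_, t, rfl⟩ := b
    obtain ⟨x, rfl⟩ := Submodule.Quotient.mk_surjective _ s
    obtain ⟨y, rfl⟩ := Submodule.Quotient.mk_surjective _ t
    have h2 := hab.map' (ψ ∘ₗ A.range.subtype)
      (LinearMap.ker_eq_bot.2 (hψ.comp A.range.injective_subtype))
    refine ⟨_, (h'.tau.mem_iff hq).2 hV.2.self_of_nhds, _, (h.mem_iff hq).2 x.2, _,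
      (h.mem_iff hq).2 y.2, ?_⟩
    rw [← hVA x, ← hVA y]
    have e : (ψ ∘ₗ A.range.subtype) ∘ ![(⟨A (Submodule.Quotient.mk x), Submodule.Quotient.mk x, rfl⟩ : A.range),
        ⟨A (Submodule.Quotient.mk y), Submodule.Quotient.mk y, rfl⟩] =
        ![ψ (A (Submodule.Quotient.mk x)), ψ (A (Submodule.Quotient.mk y))] := by
      ext i; fin_cases i <;> rfl
    exact e ▸ h2
  · rintro ⟨v, hv, w₁, hw₁, w₂, hw₂, hli⟩
    obtain ⟨v', hv', rfl⟩ := h'.tau.exists_eq hv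
    obtain ⟨x, hx, rfl⟩ := h.exists_eq hw₁
    obtain ⟨y, hy, rfl⟩ := h.exists_eq hw₂
    obtain ⟨V, hV, rfl⟩ := h'.tau.exists_section hq hK.tau_toC hv'
    obtain ⟨A, hA⟩ := hex V hV
    have hA' := (hAd V hV A).1 hA
    have hV0 : V q ≠ 0 := fun h0 => by
      have := hli.ne_zero 0
      simp [h0] at this
    refine ⟨A, le_antisymm ?_ ?_, ?_⟩
    · rintro A' ⟨V', hV', hA''⟩
      have hA'' := (hAd V' hV' A').1 hA''
      -- As `K` is a line, any other section of `K̄` is a multiple of `V` at `q`, so its operator is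
      -- the same multiple of `A`.
      have hc0 : tConj (V q) ≠ 0 := fun h0 => hV0 (by rw [← tConj_tConj (V q), h0, map_zero])
      obtain ⟨c, hc⟩ := (finrank_eq_one_iff_of_nonzero' (⟨tConj (V q), hV.2.self_of_nhds⟩ :
        leviKernel H q) fun h0 => hc0 (congrArg Subtype.val h0)).1 h1 ⟨tConj (V' q), hV'.2.self_of_nhds⟩
      have hc' : V' q = (starRingEnd ℂ) c • V q := by
        rw [← tConj_tConj (V q), ← tConj_smul, ← tConj_tConj (V' q)]
        exact congrArg tConj (congrArg Subtype.val hc).symm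
      refine Submodule.mem_span_singleton.2 ⟨(starRingEnd ℂ) c, ?_⟩
      ext t
      apply hψ
      change ψ ((starRingEnd ℂ) c • A (Submodule.Quotient.mk t)) =
        ψ (A' (Submodule.Quotient.mk t))
      rw [hA'' t, map_smul, hA' t, hc', map_smul, map_smul, smul_apply]
    · rw [Submodule.span_singleton_le_iff_mem]
      exact ⟨V, hV, hA⟩
    · have : Module.Finite ℂ (HbarModKbar H q) := Module.Finite.of_injective ψ hψ
      let u : Fin 2 → A.range := ![⟨_, Submodule.Quotient.mk ⟨x, hx⟩, rfl⟩,
        ⟨_, Submodule.Quotient.mk ⟨y, hy⟩, rfl⟩]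
      have hu : LinearIndependent ℂ u := by
        refine LinearIndependent.of_comp (ψ ∘ₗ A.range.subtype) ?_
        have e : (ψ ∘ₗ A.range.subtype) ∘ u =
            ![ψ (A (Submodule.Quotient.mk ⟨x, hx⟩)), ψ (A (Submodule.Quotient.mk ⟨y, hy⟩))] := by
          ext i; fin_cases i <;> rfl
        rw [e, hA', hA']
        exact hli
      have := hu.fintype_card_le_finrank
      rwa [Fintype.card_fin] at this

end Chart
end LeviCR

namespace LeviCR

set_option linter.unusedSectionVars false

/-! ## Germs of CR structures in a complexified chart -/

section Germ

variable {d : ℕ} {M : Type*} [TopologicalSpace M] [ChartedSpace (RSpace d) M]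
  [IsManifold (𝓡 d) ω M]

/-- `Hc` and `Kc` are the holomorphic extensions of a CR structure `H` and of its Levi kernel near
the point `p`. -/
structure IsCRGerm (H : CDist d M) (p : M) (Hc Kc : CSpace d → Submodule ℂ (CSpace d)) :
    Prop where
  ext_H : ExtendsAt p p H Hc
  ext_K : ExtendsAt p p (leviKernel H) Kc
  dist_H : IsDistAt Hc (realPoint d p p)
  dist_K : IsDistAt Kc (realPoint d p p)
  transversal : Hc (realPoint d p p) ⊓ tauDist Hc (realPoint d p p) = ⊥
  involutive : ∀ᶠ q in 𝓝 p, ∀ X Y : CField d M, IsSectionNear H X q → IsSectionNear H Y q →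
    cBracket X Y q ∈ H q

theorem eventually_toC_of_realPoint {p : M} {φ : CSpace d → Prop}
    (h : ∀ᶠ y in 𝓝 p, y ∈ (chartAt (RSpace d) p).source → φ (realPoint d p y)) :
    ∀ᶠ x in 𝓝 (chartAt (RSpace d) p p), φ (toC d x) := by
  have hp := mem_chart_source (RSpace d) p
  filter_upwards [eventually_chart_symm hp h, (chartAt (RSpace d) p).open_target.mem_nhds
    ((chartAt (RSpace d) p).map_source hp)] with x hx hxt
  have := hx ((chartAt (RSpace d) p).map_target hxt)
  rwa [realPoint, (chartAt (RSpace d) p).right_inv hxt] at this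

theorem eventually_realPoint {p : M} {φ : CSpace d → Prop}
    (h : ∀ᶠ z in 𝓝 (realPoint d p p), φ z) : ∀ᶠ y in 𝓝 p, φ (realPoint d p y) :=
  eventually_chart (mem_chart_source (RSpace d) p) (eventually_toC h)

namespace IsCRGerm

variable {p : M} {H : CDist d M} {Hc Kc : CSpace d → Submodule ℂ (CSpace d)}

theorem K_le_H (h : IsCRGerm H p Hc Kc) : ∀ᶠ z in 𝓝 (realPoint d p p), Kc z ≤ Hc z := by
  refine eventually_le_of_real h.dist_K h.dist_H (eventually_toC_of_realPoint
      (φ := fun z => Kc z ≤ Hc z) ?_)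
  filter_upwards [h.ext_H, h.ext_K] with y h1 h2 _
  rw [h1, h2]
  refine Submodule.map_mono fun x hx => ?_
  obtain ⟨X, hX, rfl, -⟩ := hx
  exact hX.2.self_of_nhds

theorem dist_C (h : IsCRGerm H p Hc Kc) :
    IsDistAt (fun z => Hc z ⊔ tauDist Hc z) (realPoint d p p) :=
  h.dist_H.sup h.dist_H.tau_toC h.transversal

theorem inf_τK (h : IsCRGerm H p Hc Kc) :
    Hc (realPoint d p p) ⊓ tauDist Kc (realPoint d p p) = ⊥ := by
  refine le_bot_iff.1 (le_trans (inf_le_inf_left _ (tauDist_mono ?_)) h.transversal.le)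
  rw [star_toC]
  exact h.K_le_H.self_of_nhds

theorem dist_S (h : IsCRGerm H p Hc Kc) :
    IsDistAt (fun z => Hc z ⊔ tauDist Kc z) (realPoint d p p) :=
  h.dist_H.sup h.dist_K.tau_toC h.inf_τK

theorem dist_D (h : IsCRGerm H p Hc Kc) :
    IsDistAt (fun z => Kc z ⊔ tauDist Kc z) (realPoint d p p) :=
  h.dist_K.sup h.dist_K.tau_toC
    (le_bot_iff.1 ((inf_le_inf_right _ h.K_le_H.self_of_nhds).trans h.inf_τK.le))

theorem τK_le_τH (h : IsCRGerm H p Hc Kc) :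
    ∀ᶠ z in 𝓝 (realPoint d p p), tauDist Kc z ≤ tauDist Hc z := by
  filter_upwards [eventually_star_toC h.K_le_H] with z hz using tauDist_mono hz

theorem S_le_C (h : IsCRGerm H p Hc Kc) :
    ∀ᶠ z in 𝓝 (realPoint d p p), Hc z ⊔ tauDist Kc z ≤ Hc z ⊔ tauDist Hc z := by
  filter_upwards [h.τK_le_τH] with z hz using sup_le_sup_left hz _

theorem D_le_S (h : IsCRGerm H p Hc Kc) :
    ∀ᶠ z in 𝓝 (realPoint d p p), Kc z ⊔ tauDist Kc z ≤ Hc z ⊔ tauDist Kc z := by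
  filter_upwards [h.K_le_H] with z hz using sup_le_sup_right hz _

variable {m : ℕ} {P : CSpace d → CSpace d →L[ℂ] (Fin m → ℂ)}

theorem curv_H (h : IsCRGerm H p Hc Kc) (hP : IsCoframeAt P Hc (realPoint d p p)) :
    ∀ᶠ z in 𝓝 (realPoint d p p), ∀ v ∈ Hc z, ∀ w ∈ Hc z, curv P z v w = 0 := by
  refine curv_eq_zero_of_real hP.analyticAt h.dist_H h.dist_H (eventually_toC_of_realPoint
      (φ := fun z => ∀ v ∈ Hc z, ∀ w ∈ Hc z, curv P z v w = 0) ?_)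
  filter_upwards [h.ext_H.eventually, h.involutive, eventually_realPoint hP.eventually]
    with y h1 h2 h3 h4
  exact (h1.involutive_iff h4 h3).1 h2

theorem curv_H_of_le (h : IsCRGerm H p Hc Kc) {C : CSpace d → Submodule ℂ (CSpace d)}
    (hP : IsCoframeAt P C (realPoint d p p))
    (hC : ∀ᶠ z in 𝓝 (realPoint d p p), Hc z ≤ C z) :
    ∀ᶠ z in 𝓝 (realPoint d p p), ∀ v ∈ Hc z, ∀ w ∈ Hc z, curv P z v w = 0 := by
  obtain ⟨l, Q, hQ⟩ := h.dist_H
  filter_upwards [h.curv_H hQ, hQ.eventually, hP.eventually, hC.eventually_nhds]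
    with z h1 h2 h3 h4 v hv w hw using curv_eq_zero_of_le h3 h2 h4 hv hw (h1 v hv w hw)

theorem tauDist_C (Hc : CSpace d → Submodule ℂ (CSpace d)) (z : CSpace d) :
    tauDist (fun z => Hc z ⊔ tauDist Hc z) z = Hc z ⊔ tauDist Hc z := by
  rw [tauDist_sup, tauDist_tauDist, sup_comm]

theorem mem_C_star {z v : CSpace d} (hv : v ∈ Hc z ⊔ tauDist Hc z) :
    star v ∈ Hc (star z) ⊔ tauDist Hc (star z) := by
  rw [← tauDist_C] at hv
  exact hv

/-- The conjugate of a curvature identity for `H ⊕ H̄`. -/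
theorem curv_C_star {p : M} {Hc : CSpace d → Submodule ℂ (CSpace d)}
    (hP : IsCoframeAt P (fun z => Hc z ⊔ tauDist Hc z) (realPoint d p p)) :
    ∀ᶠ z in 𝓝 (realPoint d p p), ∀ v ∈ Hc z ⊔ tauDist Hc z, ∀ w ∈ Hc z ⊔ tauDist Hc z,
      curv P (star z) (star v) (star w) = 0 → curv P z v w = 0 := by
  filter_upwards [hP.eventually, eventually_star_toC hP.eventually] with z h1 h2 v hv w hw h0
  exact curv_tau h1 h2 (Filter.Eventually.of_forall fun w => tauDist_C Hc w) (mem_C_star hv)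
    (mem_C_star hw) h0

/-- At real points `K` annihilates `H̄` by the definition of the Levi kernel, and the identity
theorem extends this; that `K` annihilates `H` is involutivity. -/
theorem curv_K_C (h : IsCRGerm H p Hc Kc)
    (hP : IsCoframeAt P (fun z => Hc z ⊔ tauDist Hc z) (realPoint d p p)) :
    ∀ᶠ z in 𝓝 (realPoint d p p), ∀ v ∈ Kc z, ∀ w ∈ Hc z ⊔ tauDist Hc z, curv P z v w = 0 := by
  have h0 : ∀ᶠ z in 𝓝 (realPoint d p p), ∀ v ∈ Kc z, ∀ w ∈ tauDist Hc z, curv P z v w = 0 := by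
    refine curv_eq_zero_of_real hP.analyticAt h.dist_K h.dist_H.tau_toC
      (eventually_toC_of_realPoint
      (φ := fun z => ∀ v ∈ Kc z, ∀ w ∈ tauDist Hc z, curv P z v w = 0) ?_)
    filter_upwards [h.ext_H.eventually, h.ext_K.eventually, eventually_realPoint hP.eventually,
      eventually_realPoint h.dist_H.eventually] with y h1 h2 h3 h4 hy v hv w hw
    obtain ⟨x, hx, rfl⟩ := h2.exists_eq hv
    exact ((h1.mem_leviKernel_iff hy h4 h3).1 hx).2 w hw
  filter_upwards [h0, h.curv_H_of_le hP (Filter.Eventually.of_forall fun z => le_sup_left),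
    h.K_le_H] with z h1 h2 h3 v hv w hw
  obtain ⟨a, ha, b, hb, rfl⟩ := Submodule.mem_sup.1 hw
  rw [map_add, h1 v hv b hb, h2 v (h3 hv) a ha, add_zero]

theorem curv_τK_C (h : IsCRGerm H p Hc Kc)
    (hP : IsCoframeAt P (fun z => Hc z ⊔ tauDist Hc z) (realPoint d p p)) :
    ∀ᶠ z in 𝓝 (realPoint d p p), ∀ v ∈ tauDist Kc z, ∀ w ∈ Hc z ⊔ tauDist Hc z,
      curv P z v w = 0 := by
  filter_upwards [curv_C_star hP, eventually_star_toC (h.curv_K_C hP), h.τK_le_τH]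
    with z h1 h2 h3 v hv w hw
  exact h1 v (Submodule.mem_sup_right (h3 hv)) w hw (h2 _ hv _ (mem_C_star hw))

theorem curv_D_C (h : IsCRGerm H p Hc Kc)
    (hP : IsCoframeAt P (fun z => Hc z ⊔ tauDist Hc z) (realPoint d p p)) :
    ∀ᶠ z in 𝓝 (realPoint d p p), ∀ v ∈ Kc z ⊔ tauDist Kc z, ∀ w ∈ Hc z ⊔ tauDist Hc z,
      curv P z v w = 0 := by
  filter_upwards [h.curv_K_C hP, h.curv_τK_C hP] with z h1 h2 v hv w hw
  obtain ⟨a, ha, b, hb, rfl⟩ := Submodule.mem_sup.1 hv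
  rw [map_add, add_apply, h1 a ha w hw, h2 b hb w hw, add_zero]

/-- At real points, `K ⊕ K̄` is the Cauchy characteristic of `H ⊕ H̄`. -/
theorem mem_D_of_curv_C (h : IsCRGerm H p Hc Kc)
    (hP : IsCoframeAt P (fun z => Hc z ⊔ tauDist Hc z) (realPoint d p p)) :
    ∀ᶠ y in 𝓝 p, ∀ v ∈ Hc (realPoint d p y) ⊔ tauDist Hc (realPoint d p y),
      (∀ w ∈ Hc (realPoint d p y) ⊔ tauDist Hc (realPoint d p y),
        curv P (realPoint d p y) v w = 0) →
      v ∈ Kc (realPoint d p y) ⊔ tauDist Kc (realPoint d p y) := by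
  have hs := (chartAt (RSpace d) p).open_source.mem_nhds (mem_chart_source (RSpace d) p)
  filter_upwards [h.ext_H.eventually, h.ext_K.eventually, eventually_realPoint hP.eventually,
      eventually_realPoint h.dist_H.eventually, eventually_realPoint (curv_C_star hP), hs,
      eventually_realPoint (h.curv_H_of_le hP (Filter.Eventually.of_forall fun z => le_sup_left))]
    with y h1 h2 h3 h4 h5 hy h6 v hv hvw
  simp only [star_toC] at h5
  set z := realPoint d p y with hz
  have hsz : star z = z := star_toC _
  -- vectors of `H` annihilating `H̄` lie in `K`
  have key : ∀ a ∈ Hc z, (∀ w ∈ tauDist Hc z, curv P z a w = 0) → a ∈ Kc z := fun a ha haw => by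
    obtain ⟨x, hx, rfl⟩ := h1.exists_eq ha
    exact (h2.mem_iff hy).2 ((h1.mem_leviKernel_iff hy h4 h3).2 ⟨hx, haw⟩)
  have h7 : ∀ a ∈ tauDist Hc z, ∀ b ∈ tauDist Hc z, curv P z a b = 0 := fun a ha b hb => by
    refine h5 a (Submodule.mem_sup_right ha) b (Submodule.mem_sup_right hb) (h6 _ ?_ _ ?_)
    · rw [mem_tauDist, hsz] at ha; exact ha
    · rw [mem_tauDist, hsz] at hb; exact hb
  obtain ⟨a, ha, b, hb, rfl⟩ := Submodule.mem_sup.1 hv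
  refine add_mem (Submodule.mem_sup_left (key a ha fun w hw => ?_)) (Submodule.mem_sup_right ?_)
  · have := hvw w (Submodule.mem_sup_right hw)
    rwa [map_add, add_apply, h7 b hb w hw, add_zero] at this
  · rw [mem_tauDist, hsz]
    have hb' : star b ∈ Hc z := by rw [mem_tauDist, hsz] at hb; exact hb
    refine key _ hb' fun w hw => h5 _ (Submodule.mem_sup_left hb') _ (Submodule.mem_sup_right hw) ?_
    have hw' : star w ∈ Hc z := by rw [mem_tauDist, hsz] at hw; exact hw
    have := hvw (star w) (Submodule.mem_sup_left hw')
    rwa [map_add, add_apply, h6 a ha _ hw', zero_add, ← star_star b] at this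

/-- `K ⊕ K̄` consists of Cauchy characteristics of `H ⊕ H̄`, so brackets of its sections are Cauchy
characteristic as well. At real points all Cauchy characteristics lie in `K ⊕ K̄`, which gives
involutivity there; the identity theorem gives it nearby. -/
theorem curv_D (h : IsCRGerm H p Hc Kc)
    (hP : IsCoframeAt P (fun z => Kc z ⊔ tauDist Kc z) (realPoint d p p)) :
    ∀ᶠ z in 𝓝 (realPoint d p p), ∀ v ∈ Kc z ⊔ tauDist Kc z, ∀ w ∈ Kc z ⊔ tauDist Kc z,
      curv P z v w = 0 := by
  obtain ⟨l, Q, hQ⟩ := h.dist_C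
  have hDC : ∀ᶠ z in 𝓝 (realPoint d p p), Kc z ⊔ tauDist Kc z ≤ Hc z ⊔ tauDist Hc z := by
    filter_upwards [h.D_le_S, h.S_le_C] with z h1 h2 using h1.trans h2
  have hca := lieBracket_cauchy hQ hDC (h.curv_D_C hQ)
  refine curv_eq_zero_of_real hP.analyticAt h.dist_D h.dist_D (eventually_toC_of_realPoint
      (φ := fun z => ∀ v ∈ Kc z ⊔ tauDist Kc z, ∀ w ∈ Kc z ⊔ tauDist Kc z, curv P z v w = 0) ?_)
  filter_upwards [eventually_realPoint hca, h.mem_D_of_curv_C hQ,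
    eventually_realPoint hP.eventually] with y h1 h2 h3 hy v hv w hw
  obtain ⟨X, hX, rfl⟩ := h3.isDistAt.exists_sec hv
  obtain ⟨Y, hY, rfl⟩ := h3.isDistAt.exists_sec hw
  exact (h3.lieBracket_mem_iff hX hY).1 (h2 _ (h1 X Y hX hY).1 (h1 X Y hX hY).2)

theorem curv_D_of_le (h : IsCRGerm H p Hc Kc) {C : CSpace d → Submodule ℂ (CSpace d)}
    (hP : IsCoframeAt P C (realPoint d p p))
    (hC : ∀ᶠ z in 𝓝 (realPoint d p p), Kc z ⊔ tauDist Kc z ≤ C z) :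
    ∀ᶠ z in 𝓝 (realPoint d p p), ∀ v ∈ Kc z ⊔ tauDist Kc z, ∀ w ∈ Kc z ⊔ tauDist Kc z,
      curv P z v w = 0 := by
  obtain ⟨l, Q, hQ⟩ := h.dist_D
  filter_upwards [h.curv_D hQ, hQ.eventually, hP.eventually, hC.eventually_nhds]
    with z h1 h2 h3 h4 v hv w hw using curv_eq_zero_of_le h3 h2 h4 hv hw (h1 v hv w hw)

end IsCRGerm

end Germ
end LeviCR

namespace LeviCR

set_option linter.unusedSectionVars false

/-! ## Recovering the CR structure -/

/-- `H'` contains a displacement `h + f v` of every `h` in `H`. Isotropy of `H` and `H'` gives `f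
Ω(v, h') = f' Ω(v, h)` for any two such displacements. If `f ≠ 0` for some `h`, both `Ω(v, w₁)` and
`Ω(v, w₂)` would be multiples of `Ω(v, h)`, against their independence; so no displacement occurs.
-/
theorem le_of_linearIndependent_pair {E F : Type*} [AddCommGroup E] [Module ℂ E] [AddCommGroup F]
    [Module ℂ F] {Ω : E → E → F} (hadd : ∀ a b c, Ω (a + b) c = Ω a c + Ω b c)
    (hsmul : ∀ (r : ℂ) a b, Ω (r • a) b = r • Ω a b) (hswap : ∀ a b, Ω a b = -Ω b a)
    {H H' : Submodule ℂ E} {v : E} (hH : ∀ a ∈ H, ∀ b ∈ H, Ω a b = 0)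
    (hH' : ∀ a ∈ H', ∀ b ∈ H', Ω a b = 0) (hvv : Ω v v = 0)
    (hHH' : ∀ h ∈ H, ∃ f : ℂ, h + f • v ∈ H') {w₁ w₂ : E} (hw₁ : w₁ ∈ H) (hw₂ : w₂ ∈ H)
    (hli : LinearIndependent ℂ ![Ω v w₁, Ω v w₂]) : H ≤ H' := by
  have hadd' : ∀ a b c, Ω a (b + c) = Ω a b + Ω a c := fun a b c => by
    rw [hswap, hadd, hswap b, hswap c]; abel
  have hsmul' : ∀ (r : ℂ) a b, Ω a (r • b) = r • Ω a b := fun r a b => by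
    rw [hswap, hsmul, hswap b, smul_neg, neg_neg]
  have key : ∀ h ∈ H, ∀ h' ∈ H, ∀ f f' : ℂ, h + f • v ∈ H' → h' + f' • v ∈ H' →
      f • Ω v h' = f' • Ω v h := by
    intro h hh h' hh' f f' hf hf'
    have := hH' _ hf _ hf'
    rw [hadd, hadd', hadd', hsmul, hsmul, hsmul', hsmul', hH h hh h' hh', hvv, hswap h v] at this
    simp only [smul_zero, add_zero, zero_add, smul_neg] at this
    exact (neg_add_eq_zero.1 this).symm
  intro h hh
  obtain ⟨f, hf⟩ := hHH' h hh
  obtain ⟨f₁, hf₁⟩ := hHH' w₁ hw₁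
  obtain ⟨f₂, hf₂⟩ := hHH' w₂ hw₂
  have e₁ := key h hh w₁ hw₁ f f₁ hf hf₁
  have e₂ := key h hh w₂ hw₂ f f₂ hf hf₂
  have hli' := LinearIndependent.pair_iff.1 hli
  have h0 : (f₂ * f) • Ω v w₁ + (-(f₁ * f)) • Ω v w₂ = 0 := by
    rw [neg_smul, mul_smul, mul_smul, e₁, e₂, smul_comm, add_neg_cancel]
  have hf0 : f = 0 := by
    by_contra hne
    have h1 : f₁ = 0 := by
      have := (hli' _ _ h0).2
      simpa [hne] using this
    rw [h1, zero_smul] at e₁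
    exact hne (hli' f 0 (by rw [e₁, zero_smul, add_zero])).1
  rwa [hf0, zero_smul, add_zero] at hf

/-- The condition on a CR structure that `ad K̄` contains an operator of rank greater than one,
in terms of a coframe `P` of `H ⊕ K̄`. -/
def RankGtOne {d m : ℕ} (P : CSpace d → CSpace d →L[ℂ] (Fin m → ℂ))
    (Hc Kc : CSpace d → Submodule ℂ (CSpace d)) (z : CSpace d) : Prop :=
  ∃ v ∈ tauDist Kc z, ∃ w₁ ∈ Hc z, ∃ w₂ ∈ Hc z,
    LinearIndependent ℂ ![curv P z v w₁, curv P z v w₂]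

theorem finrank_tauDist {d : ℕ} (S : CSpace d → Submodule ℂ (CSpace d)) (z : CSpace d) {v : CSpace d}
    (h1 : Module.finrank ℂ (S (star z)) = 1) (hv : v ∈ tauDist S z) (hv0 : v ≠ 0) {w : CSpace d}
    (hw : w ∈ tauDist S z) : ∃ c : ℂ, w = c • v := by
  obtain ⟨c, hc⟩ := (finrank_eq_one_iff_of_nonzero' (⟨star v, hv⟩ : S (star z))
    (fun h0 => hv0 (star_eq_zero.1 (congrArg Subtype.val h0)))).1 h1 ⟨star w, hw⟩
  refine ⟨star c, ?_⟩
  have : c • star v = star w := congrArg Subtype.val hc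
  rw [← star_star w, ← this, star_smul, star_star]

/-! ### Rigidity of `H` under maps preserving the leaf space and `J⁻`. -/

section Recover

variable {d k : ℕ} {M M' : Type*} [TopologicalSpace M] [ChartedSpace (RSpace d) M]
  [IsManifold (𝓡 d) ω M] [TopologicalSpace M'] [ChartedSpace (RSpace d) M']
  [IsManifold (𝓡 d) ω M'] {p : M} {H : CDist d M} {Hc Kc : CSpace d → Submodule ℂ (CSpace d)}
  {p' : M'} {H' : CDist d M'} {Hc' Kc' : CSpace d → Submodule ℂ (CSpace d)}

/-- `G` matches `H ⊕ K̄` with its counterpart together with the curvatures, then the Levi kernels.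
At points where `ad K̄` has rank at least two the linear algebra of `le_of_linearIndependent_pair`
matches `H` as well, and density of such real points with analyticity finishes. -/
theorem map_fderiv_eq_of_dense_rankGtOne (h : IsCRGerm H p Hc Kc) (h' : IsCRGerm H' p' Hc' Kc')
    {π π' : CSpace d → CSpace k} {G : CSpace d → CSpace d}
    (hker : ∀ᶠ z in 𝓝 (realPoint d p p),
      (fderiv ℂ π z).toLinearMap.ker = Kc z ⊔ tauDist Kc z)
    (hker' : ∀ᶠ z in 𝓝 (realPoint d p' p'),
      (fderiv ℂ π' z).toLinearMap.ker = Kc' z ⊔ tauDist Kc' z)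
    (hπ' : ∀ᶠ z in 𝓝 (realPoint d p' p'), DifferentiableAt ℂ π' z)
    (hG : AnalyticAt ℂ G (realPoint d p p))
    (hbij : Function.Bijective (fderiv ℂ G (realPoint d p p)))
    (hG0 : G (realPoint d p p) = realPoint d p' p')
    (hπG : ∀ᶠ z in 𝓝 (realPoint d p p), π' (G z) = π z)
    (hJ : ∀ᶠ z in 𝓝 (realPoint d p p), (Hc' (G z)).map (fderiv ℂ π' (G z)).toLinearMap =
      (Hc z).map (fderiv ℂ π z).toLinearMap)
    (hK1 : Module.finrank ℂ (Kc (realPoint d p p)) = 1)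
    (hK1' : Module.finrank ℂ (Kc' (realPoint d p' p')) = 1)
    (hn : Module.finrank ℂ (Hc (realPoint d p p)) = Module.finrank ℂ (Hc' (realPoint d p' p')))
    (hnd : ∀ᶠ z in 𝓝 (realPoint d p p), ∀ v ∈ tauDist Kc z, v ≠ 0 → ∃ V X,
      IsSec (tauDist Kc) V z ∧ IsSec Hc X z ∧ V z = v ∧
        VectorField.lieBracket ℂ V X z ∉ Hc z ⊔ tauDist Kc z)
    (hR : ∀ (m : ℕ) (P : CSpace d → CSpace d →L[ℂ] (Fin m → ℂ)),
      IsCoframeAt P (fun z => Hc z ⊔ tauDist Kc z) (realPoint d p p) →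
        ∀ᶠ y in 𝓝 p, ∃ᶠ y' in 𝓝 y, RankGtOne P Hc Kc (realPoint d p y')) :
    ∀ᶠ z in 𝓝 (realPoint d p p), (Hc z).map (fderiv ℂ G z).toLinearMap = Hc' (G z) := by
  set z₀ := realPoint d p p with hz₀
  have hGc : ∀ {φ : CSpace d → Prop}, (∀ᶠ z in 𝓝 (realPoint d p' p'), φ z) →
      ∀ᶠ z in 𝓝 z₀, φ (G z) := fun {φ} hφ => hG.continuousAt.eventually (hG0 ▸ hφ)
  have hbij' : ∀ᶠ z in 𝓝 z₀, Function.Bijective (fderiv ℂ G z) := by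
    filter_upwards [eventually_injective hG.fderiv hbij.1, eventually_surjective hG.fderiv hbij.2]
      with z h1 h2 using ⟨h1, h2⟩
  have hcomp : ∀ᶠ z in 𝓝 z₀, ∀ v, fderiv ℂ π z v = fderiv ℂ π' (G z) (fderiv ℂ G z v) := by
    filter_upwards [hπG.eventually_nhds, hGc hπ', hG.eventually_analyticAt] with z h1 h2 h3 v
    have e : π =ᶠ[𝓝 z] fun w => π' (G w) := by filter_upwards [h1] with w hw using hw.symm
    rw [e.fderiv_eq]
    exact congrArg (fun L => L v) (fderiv_comp z h2 h3.differentiableAt)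
  obtain ⟨m, P', hP'⟩ := h'.dist_S
  -- Because `K ⊆ H` and the kernel of `dπ` is `K ⊕ K̄`, the space `H ⊕ K̄` is the full preimage of
  -- `J⁻` under `dπ`, on both sides.
  have hS : ∀ᶠ z in 𝓝 z₀, ∀ v, v ∈ Hc z ⊔ tauDist Kc z ↔
      fderiv ℂ G z v ∈ Hc' (G z) ⊔ tauDist Kc' (G z) := by
    filter_upwards [hcomp, hker, hGc hker', h.K_le_H, hGc h'.K_le_H, hJ] with z h1 h2 h3 h4 h5 h6 v
    have e1 : Hc z ⊔ tauDist Kc z =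
        ((Hc z).map (fderiv ℂ π z).toLinearMap).comap (fderiv ℂ π z).toLinearMap := by
      rw [Submodule.comap_map_eq, h2, ← sup_assoc, sup_eq_left.2 h4]
    have e2 : Hc' (G z) ⊔ tauDist Kc' (G z) =
        ((Hc' (G z)).map (fderiv ℂ π' (G z)).toLinearMap).comap (fderiv ℂ π' (G z)).toLinearMap := by
      rw [Submodule.comap_map_eq, h3, ← sup_assoc, sup_eq_left.2 h5]
    rw [e1, e2, h6, Submodule.mem_comap, Submodule.mem_comap]
    change fderiv ℂ π z v ∈ _ ↔ fderiv ℂ π' (G z) (fderiv ℂ G z v) ∈ _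
    rw [h1]
  let P := pullForm G P'
  have hP : IsCoframeAt P (fun z => Hc z ⊔ tauDist Kc z) z₀ := by
    refine ⟨analyticAt_pullForm (by rw [hG0]; exact hP'.analyticAt) hG, ?_, ?_⟩
    · have := hP'.surjective
      rw [← hG0] at this
      exact this.comp hbij.2
    · filter_upwards [hS, hGc hP'.mem_iff] with z h1 h2 v
      rw [h1, h2]; rfl
  have hcurv : ∀ᶠ z in 𝓝 z₀, ∀ v w, curv P z v w =
      curv P' (G z) (fderiv ℂ G z v) (fderiv ℂ G z w) := by
    filter_upwards [hG.eventually_analyticAt, hGc hP'.analyticAt.eventually_analyticAt]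
      with z h1 h2 v w using curv_pullForm h2.differentiableAt h1 v w
  have hH0 := h.curv_H_of_le hP (Filter.Eventually.of_forall fun z => le_sup_left)
  have hH0' := h'.curv_H_of_le hP' (Filter.Eventually.of_forall fun z => le_sup_left)
  have hD0 := h.curv_D_of_le hP h.D_le_S
  have hD0' := h'.curv_D_of_le hP' h'.D_le_S
  -- the Levi kernels correspond
  have hKK' : ∀ᶠ z in 𝓝 z₀, ∀ v ∈ Kc z, fderiv ℂ G z v ∈ Kc' (G z) := by
    filter_upwards [hcomp, hker, hGc hker', hbij', hcurv, hS, hP.eventually, hH0, hGc hH0',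
      hGc hD0', hnd, hGc h'.K_le_H, h.dist_K.finrank_eventually,
      hGc h'.dist_K.finrank_eventually, h.K_le_H]
      with z h1 h2 h3 h4 h5 h6 h7 h8 h9 h10 h11 h12 h13 h14 h15 v hv
    rw [hK1] at h13
    rw [hK1'] at h14
    have : Nontrivial (Kc' (G z)) := Module.nontrivial_of_finrank_pos (R := ℂ) (by omega)
    obtain ⟨⟨u, hu⟩, hu0⟩ := exists_ne (0 : Kc' (G z))
    obtain ⟨x, rfl⟩ := h4.2 u
    have hx0 : x ≠ 0 := fun h0 => hu0 (Subtype.ext (by simp [h0]))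
    have hxD : x ∈ Kc z ⊔ tauDist Kc z := by
      rw [← h2]
      change fderiv ℂ π z x = 0
      rw [h1]
      have : fderiv ℂ G z x ∈ (fderiv ℂ π' (G z)).toLinearMap.ker := by
        rw [h3]; exact Submodule.mem_sup_left hu
      exact this
    -- The image of `x` lies in `K'`, which annihilates `H' ⊕ K̄'`: it annihilates `H'` by
    -- involutivity of `H'` and `K̄'` by involutivity of `K' ⊕ K̄'`. Once `x` annihilates `H`,
    -- nondegeneracy removes its `K̄`-component, so `x` lies in `K`; both kernels being lines, this
    -- suffices.
    have hxS : ∀ s ∈ Hc z, curv P z x s = 0 := fun s hs => by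
      rw [h5]
      obtain ⟨a, ha, b, hb, hab⟩ := Submodule.mem_sup.1 ((h6 s).1 (Submodule.mem_sup_left hs))
      rw [← hab, map_add, h9 _ (h12 hu) _ ha, h10 _ (Submodule.mem_sup_left hu) _
        (Submodule.mem_sup_right hb), add_zero]
    obtain ⟨a, ha, b, hb, rfl⟩ := Submodule.mem_sup.1 hxD
    have haH : a ∈ Hc z := h15 ha
    have hb0 : b = 0 := by
      by_contra hne
      obtain ⟨V, X, hV, hX, rfl, hVX⟩ := h11 b hb hne
      apply hVX
      rw [h7.lieBracket_mem_iff (hV.mono (Filter.Eventually.of_forall fun z => le_sup_right))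
        (hX.mono (Filter.Eventually.of_forall fun z => le_sup_left))]
      have := hxS _ hX.mem
      rwa [map_add, add_apply, h8 a haH _ hX.mem, zero_add] at this
    rw [hb0, add_zero] at hu hx0
    obtain ⟨c, hc⟩ := (finrank_eq_one_iff_of_nonzero' (⟨a, ha⟩ : Kc z)
      (fun h0 => hx0 (congrArg Subtype.val h0))).1 h13 ⟨v, hv⟩
    rw [← show c • a = v from congrArg Subtype.val hc, map_smul]
    exact Submodule.smul_mem _ _ hu
  have hmain : ∀ᶠ z in 𝓝 z₀, RankGtOne P Hc Kc z → ∀ v ∈ Hc z, fderiv ℂ G z v ∈ Hc' (G z) := by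
    filter_upwards [hcomp, hker, hGc hker', hbij', hcurv, hS, hH0, hGc hH0', hKK', hGc h'.K_le_H,
      eventually_star_toC h.dist_K.finrank_eventually] with z h1 h2 h3 h4 h5 h6 h7 h8 h9 h10 h11 hr
    obtain ⟨v, hv, w₁, hw₁, w₂, hw₂, hli⟩ := hr
    have hv0 : v ≠ 0 := fun h0 => by
      have := hli.ne_zero 0
      simp [h0] at this
    refine le_of_linearIndependent_pair (Ω := fun a b => curv P z a b)
      (H' := (Hc' (G z)).comap (fderiv ℂ G z).toLinearMap) (v := v)
      (fun a b c => by rw [map_add, add_apply]) (fun r a b => by rw [map_smul, smul_apply])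
      (fun a b => curv_swap _ _ _ _) h7 (fun a ha b hb => ?_) (curv_self _ _ _) (fun u hu => ?_)
      hw₁ hw₂ hli
    · rw [h5]; exact h8 _ ha _ hb
    -- The image of `u` is `a + b'` with `a` in `H'` and `b'` in `K̄'`. The preimage of `b'` is `x +
    -- c v` with `x` in `K`, so `u - c v` has image `a` plus the image of `x`, which lies in `H'`.
    · obtain ⟨a, ha, b', hb', hab⟩ := Submodule.mem_sup.1 ((h6 u).1 (Submodule.mem_sup_left hu))
      obtain ⟨b, rfl⟩ := h4.2 b'
      have hbD : b ∈ Kc z ⊔ tauDist Kc z := by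
        rw [← h2]
        change fderiv ℂ π z b = 0
        rw [h1]
        have : fderiv ℂ G z b ∈ (fderiv ℂ π' (G z)).toLinearMap.ker := by
          rw [h3]; exact Submodule.mem_sup_right hb'
        exact this
      obtain ⟨x, hx, y, hy, rfl⟩ := Submodule.mem_sup.1 hbD
      obtain ⟨c, rfl⟩ := finrank_tauDist Kc z (h11.trans hK1) hv hv0 hy
      refine ⟨-c, ?_⟩
      change fderiv ℂ G z (u + -c • v) ∈ Hc' (G z)
      have e : fderiv ℂ G z (u + -c • v) = a + fderiv ℂ G z x := by
        rw [map_add, ← hab, map_add, neg_smul, map_neg]; abel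
      rw [e]
      exact add_mem ha (h10 (h9 x hx))
  obtain ⟨l, Q', hQ'⟩ := h'.dist_H
  obtain ⟨X, hX⟩ := h.dist_H.exists_frame rfl
  have hQ : AnalyticAt ℂ (pullForm G Q') z₀ :=
    analyticAt_pullForm (by rw [hG0]; exact hQ'.analyticAt) hG
  -- A holomorphic expression which vanishes on a dense set of real points vanishes at all real
  -- points by continuity, hence in a neighbourhood.
  have hz : ∀ i, ∀ᶠ z in 𝓝 z₀, pullForm G Q' z (X i z) = 0 := fun i => by
    refine eventually_eq_zero_of_real (analyticAt_clm_apply hQ (hX.analyticAt i))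
      (eventually_toC_of_realPoint (φ := fun z => pullForm G Q' z (X i z) = 0) ?_)
    have hgood : ∀ᶠ z in 𝓝 z₀, RankGtOne P Hc Kc z → pullForm G Q' z (X i z) = 0 := by
      filter_upwards [hmain, (hX.isSec i).2, hGc hQ'.mem_iff] with z h1 h2 h3 h4
      exact (h3 _).1 (h1 h4 _ h2)
    filter_upwards [hR m P hP, (eventually_realPoint hgood).eventually_nhds, eventually_realPoint
      (analyticAt_clm_apply hQ (hX.analyticAt i)).eventually_analyticAt] with y h1 h2 h3 hy
    by_contra hne
    have hev := eventually_chart hy (eventually_toC (h3.continuousAt.eventually_ne hne))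
    obtain ⟨y', h4, h5, h6⟩ := (h1.and_eventually (h2.and hev)).exists
    exact h6 (h5 h4)
  filter_upwards [hX.span_eq, Filter.eventually_all.2 hz, hGc hQ'.mem_iff, hbij',
    h.dist_H.finrank_eventually, hGc h'.dist_H.finrank_eventually] with z h1 h2 h3 h4 h5 h6
  refine Submodule.eq_of_le_of_finrank_eq ?_ ?_
  · rw [← h1, Submodule.map_le_iff_le_comap, Submodule.span_le]
    rintro _ ⟨i, rfl⟩
    exact (h3 _).2 (h2 i)
  · rw [h6, ← hn, ← h5]
    exact (Submodule.equivMapOfInjective _ h4.1 _).finrank_eq.symm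

end Recover

end LeviCR

namespace LeviCR

set_option linter.unusedSectionVars false

/-! ### Generic rank greater than one implies recoverability. -/

section Sufficiency

variable {d : ℕ} {M : Type*} [TopologicalSpace M] [ChartedSpace (RSpace d) M]
  [IsManifold (𝓡 d) ω M] {p : M} {H : CDist d M} {Hc Kc : CSpace d → Submodule ℂ (CSpace d)}

theorem IsCRGerm.rankGtOne_iff (h : IsCRGerm H p Hc Kc)
    (h1 : ∀ᶠ q in 𝓝 p, Module.finrank ℂ (leviKernel H q) = 1) {m : ℕ}
    {P : CSpace d → CSpace d →L[ℂ] (Fin m → ℂ)}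
    (hP : IsCoframeAt P (fun z => Hc z ⊔ tauDist Kc z) (realPoint d p p)) :
    ∀ᶠ q in 𝓝 p, (∃ A : HmodK H q →ₗ[ℂ] HbarModKbar H q,
      adKbar H q = Submodule.span ℂ {A} ∧ 1 < Module.finrank ℂ A.range) ↔
        RankGtOne P Hc Kc (realPoint d p q) := by
  obtain ⟨l, Q, hQ⟩ := h.dist_C
  filter_upwards [h1, h.ext_H.eventually, h.ext_K.eventually,
    (chartAt (RSpace d) p).open_source.mem_nhds (mem_chart_source (RSpace d) p),
    eventually_realPoint h.dist_H.eventually, eventually_realPoint h.dist_K.eventually,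
    eventually_realPoint hP.eventually, eventually_realPoint hQ.eventually,
    eventually_realPoint (h.dist_H.eventually_inf_eq_bot h.dist_H.tau_toC h.transversal),
    eventually_realPoint h.K_le_H.eventually_nhds,
    eventually_realPoint (h.curv_D_of_le hP h.D_le_S), eventually_realPoint (h.curv_τK_C hQ)]
    with q e1 e2 e3 e4 e5 e6 e7 e8 e9 e10 e11 e12
  exact adKbar_eq_span_iff e2 e3 e4 e5 e6 e7 e8 e9 e10
    (fun v hv w hw => e11 v (Submodule.mem_sup_right hv) w (Submodule.mem_sup_left hw))
    (fun v hv w hw => e12 v hv w (Submodule.mem_sup_left hw)) e1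

theorem IsHolDistOn.exists_frame {r : ℕ} {S : CSpace d → Submodule ℂ (CSpace d)}
    {W : Set (CSpace d)} (h : IsHolDistOn r S W) {z : CSpace d} (hz : z ∈ W) :
    ∃ X : Fin r → CSpace d → CSpace d, IsFrameAt X S z := by
  obtain ⟨X, hX, hXS⟩ := h z hz
  exact ⟨X, hX, hXS.self_of_nhds.1, by filter_upwards [hXS] with w hw using hw.2⟩

namespace LeviLeafSpace

variable {n r k : ℕ} {U : Set M}

theorem eventually_mem (R : LeviLeafSpace n r k H U p) :
    ∀ᶠ y in 𝓝 p, y ∈ (chartAt (RSpace d) p).source ∧ realPoint d p y ∈ R.W := by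
  filter_upwards [(chartAt (RSpace d) p).open_source.mem_nhds (mem_chart_source (RSpace d) p),
    eventually_realPoint (R.isOpen_W.mem_nhds R.base_mem)] with y h1 h2 using ⟨h1, h2⟩

theorem isCRGerm (R : LeviLeafSpace n r k H U p) (hU : IsOpen U) (hp : p ∈ U)
    (hH : IsCRStructureOn n H U) : IsCRGerm H p R.Hc R.Kc := by
  obtain ⟨X, hX⟩ := R.hol_H.exists_frame R.base_mem
  obtain ⟨Y, hY⟩ := R.hol_K.exists_frame R.base_mem
  refine ⟨?_, ?_, hX.isDistAt, hY.isDistAt, R.transversal _ R.base_mem, ?_⟩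
  · filter_upwards [R.eventually_mem] with y hy using R.extends_H y hy.1 hy.2
  · filter_upwards [R.eventually_mem] with y hy using R.extends_K y hy.1 hy.2
  · filter_upwards [hU.mem_nhds hp] with q hq using hH.involutive q hq

theorem finrank_Hc (R : LeviLeafSpace n r k H U p) :
    Module.finrank ℂ (R.Hc (realPoint d p p)) = n := by
  obtain ⟨X, hX⟩ := R.hol_H.exists_frame R.base_mem
  exact hX.finrank_eq.trans (Fintype.card_fin _)

theorem finrank_Kc (R : LeviLeafSpace n r k H U p) :
    Module.finrank ℂ (R.Kc (realPoint d p p)) = r := by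
  obtain ⟨X, hX⟩ := R.hol_K.exists_frame R.base_mem
  exact hX.finrank_eq.trans (Fintype.card_fin _)

theorem finrank_leviKernel (R : LeviLeafSpace n r k H U p) :
    Module.finrank ℂ (leviKernel H p) = r := by
  have h1 := R.extends_K p (mem_chart_source _ p) R.base_mem
  rw [← R.finrank_Kc]
  change _ = Module.finrank ℂ (R.Kc (toC d (chartAt (RSpace d) p p)))
  rw [h1]
  exact (Submodule.equivMapOfInjective _
    (chartDiff_bijective (mem_chart_source (RSpace d) p)).1 _).finrank_eq

theorem eventually_ker (R : LeviLeafSpace n r k H U p) :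
    ∀ᶠ z in 𝓝 (realPoint d p p),
      (fderiv ℂ R.π z).toLinearMap.ker = R.Kc z ⊔ tauDist R.Kc z := by
  filter_upwards [R.isOpen_W.mem_nhds R.base_mem] with z hz using R.ker_π z hz

end LeviLeafSpace

end Sufficiency

theorem isRecoverable_of_dense (n : ℕ) {M : Type*} [TopologicalSpace M]
    [ChartedSpace (RSpace (2 * n + 1)) M] [IsManifold (𝓡 (2 * n + 1)) ω M]
    (H : CDist (2 * n + 1) M) (hH : IsCRStructureOn n H Set.univ)
    (hK : ∀ p : M, Module.finrank ℂ (leviKernel H p) = 1) {O : Set M} (hO : Dense O)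
    (hA : ∀ p ∈ O, ∃ A : HmodK H p →ₗ[ℂ] HbarModKbar H p,
      adKbar H p = Submodule.span ℂ {A} ∧ 1 < Module.finrank ℂ A.range) :
    IsRecoverable n H := by
  intro p M' _ _ _ H' U' p' r k hU' hp' hH' _ _ R R' _ G hG hbij hG0 hcan
  have h := R.isCRGerm isOpen_univ (Set.mem_univ p) hH
  have h' := R'.isCRGerm hU' hp' hH'
  -- Both leaf spaces carry the same `r`, so the rank assumption on `K` also fixes that of `K'`.
  have hr : r = 1 := R.finrank_leviKernel.symm.trans (hK p)
  refine map_fderiv_eq_of_dense_rankGtOne h h' R.eventually_ker R'.eventually_ker ?_ hG hbij hG0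
    ?_ ?_ (R.finrank_Kc.trans hr) (R'.finrank_Kc.trans hr) (R.finrank_Hc.trans R'.finrank_Hc.symm)
    ?_ ?_
  · filter_upwards [R'.isOpen_W.mem_nhds R'.base_mem] with z hz
    exact R'.hol_π.differentiableAt (R'.isOpen_W.mem_nhds hz)
  · filter_upwards [hcan] with z hz using congrArg Prod.fst hz
  · filter_upwards [hcan] with z hz using congrArg (fun x => x.2.1) hz
  · filter_upwards [R.isOpen_W.mem_nhds R.base_mem] with z hz v hv hv0
    obtain ⟨V, X, hV, hX, hVK, hXH, hVv, hVX⟩ := R.nondegenerate z hz v hv hv0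
    exact ⟨V, X, ⟨hV, hVK⟩, ⟨hX, hXH⟩, hVv, hVX⟩
  · intro m P hP
    filter_upwards [(h.rankGtOne_iff (Filter.Eventually.of_forall hK) hP).eventually_nhds]
      with y hy
    have := (mem_closure_iff_frequently.1 (hO y)).and_eventually hy
    exact this.mono fun y' hy' => hy'.2.1 (hA y' hy'.1)

end LeviCR

namespace LeviCR

set_option linter.unusedSectionVars false

/-! ## Normalised coframes of distributions containing the fibres of a submersion -/

section Normalised

variable {E B F G : Type*} [NormedAddCommGroup E] [NormedSpace ℂ E] [FiniteDimensional ℂ E]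
  [CompleteSpace E] [NormedAddCommGroup B] [NormedSpace ℂ B] [FiniteDimensional ℂ B]
  [CompleteSpace B] [NormedAddCommGroup F] [NormedSpace ℂ F] [FiniteDimensional ℂ F]
  [CompleteSpace F] [NormedAddCommGroup G] [NormedSpace ℂ G] [FiniteDimensional ℂ G]

/-- As `P` vanishes on `ker dρ`, it factors through `dρ`. Normalising the factor to be inverted on
the right by a fixed `T` makes `Q z` depend only on its kernel, the image of `S z` under `dρ`: `Q`
is that moving subspace read in an affine chart of the Grassmannian. -/
theorem exists_normalised_coframe {ρ : E → B} {P : E → E →L[ℂ] F} {D S : E → Submodule ℂ E}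
    {z₀ : E} (hρ : IsCoframeAt (fderiv ℂ ρ) D z₀) (hP : IsCoframeAt P S z₀)
    (hDS : ∀ᶠ z in 𝓝 z₀, D z ≤ S z) :
    ∃ (Q : E → B →L[ℂ] F) (T : F →L[ℂ] B), AnalyticAt ℂ Q z₀ ∧
      (∀ᶠ z in 𝓝 z₀, ∀ f, Q z (T f) = f) ∧
      IsCoframeAt (fun z => (Q z).comp (fderiv ℂ ρ z)) S z₀ := by
  obtain ⟨R, hR, hρR⟩ := exists_analytic_rightInverse hρ.analyticAt hρ.surjective
  have hQ₀ : AnalyticAt ℂ (fun z => (P z).comp (R z)) z₀ := analyticAt_clm_comp hP.analyticAt hR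
  have hfac : ∀ᶠ z in 𝓝 z₀, ∀ v, P z (R z (fderiv ℂ ρ z v)) = P z v := by
    filter_upwards [hρR, hρ.mem_iff, hP.mem_iff, hDS] with z h1 h2 h3 h4 v
    rw [← sub_eq_zero, ← map_sub, ← h3]
    refine h4 ((h2 _).2 ?_)
    rw [map_sub, h1, sub_self]
  have hsurj : Function.Surjective ((P z₀).comp (R z₀)) := fun f => by
    obtain ⟨v, rfl⟩ := hP.surjective f
    exact ⟨fderiv ℂ ρ z₀ v, hfac.self_of_nhds v⟩
  obtain ⟨T₀, hT₀⟩ := ((P z₀).comp (R z₀)).toLinearMap.exists_rightInverse_of_surjective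
    (LinearMap.range_eq_top.2 hsurj)
  let T : F →L[ℂ] B := LinearMap.toContinuousLinearMap T₀
  have hM : AnalyticAt ℂ (fun z => ((P z).comp (R z)).comp T) z₀ :=
    analyticAt_clm_comp hQ₀ analyticAt_const
  have hM0 : ((P z₀).comp (R z₀)).comp T = ContinuousLinearMap.id ℂ F := by
    ext f; exact LinearMap.congr_fun hT₀ f
  obtain ⟨hMi, hMinv⟩ := analyticAt_clm_inverse hM
    (by rw [hM0]; exact ⟨ContinuousLinearEquiv.refl ℂ F, rfl⟩)
  refine ⟨fun z => (((P z).comp (R z)).comp T).inverse.comp ((P z).comp (R z)), T,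
    analyticAt_clm_comp hMi hQ₀, ?_, analyticAt_clm_comp (analyticAt_clm_comp hMi hQ₀)
      hρ.analyticAt, ?_, ?_⟩
  · filter_upwards [hMinv] with z hz f
    exact hz.inverse_apply_self f
  · intro f
    obtain ⟨v, hv⟩ := hP.surjective (((P z₀).comp (R z₀)).comp T f)
    refine ⟨v, ?_⟩
    change (((P z₀).comp (R z₀)).comp T).inverse (P z₀ (R z₀ (fderiv ℂ ρ z₀ v))) = f
    rw [hfac.self_of_nhds, hv, hMinv.self_of_nhds.inverse_apply_self]
  · filter_upwards [hMinv, hfac, hP.mem_iff] with z h1 h2 h3 v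
    change _ ↔ (((P z).comp (R z)).comp T).inverse (P z (R z (fderiv ℂ ρ z v))) = 0
    rw [h2, h3]
    refine ⟨fun h0 => by rw [h0, map_zero], fun h0 => ?_⟩
    rw [← h1.self_apply_inverse (P z v), h0, map_zero]

/-- Here `d(Q dρ) = dQ ∧ dρ`, as `dρ` is closed. The derivative of the moving subspace along a fibre
of `ρ` is therefore a curvature, which is how 2-nondegeneracy becomes an immersion property. -/
theorem curv_comp_fderiv {ρ : E → B} {Q : E → B →L[ℂ] F} {z : E} (hρ : AnalyticAt ℂ ρ z)
    (hQ : AnalyticAt ℂ Q z) {v : E} (hv : fderiv ℂ ρ z v = 0) (w : E) :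
    curv (fun z => (Q z).comp (fderiv ℂ ρ z)) z v w = -fderiv ℂ Q z v (fderiv ℂ ρ z w) := by
  have h2 := hQ.differentiableAt.hasFDerivAt.clm_comp hρ.fderiv.differentiableAt.hasFDerivAt
  have h3 : IsSymmSndFDerivAt ℂ ρ z := hρ.contDiffAt.isSymmSndFDerivAt (n := ω) (by simp)
  rw [curv_apply, h2.fderiv]
  simp [h3.eq v w, hv]

theorem eq_of_ker_eq {Q Q' : B →L[ℂ] F} {T : F →L[ℂ] B} (h : ∀ f, Q (T f) = f)
    (h' : ∀ f, Q' (T f) = f) (hk : ∀ x, Q x = 0 ↔ Q' x = 0) : Q = Q' := by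
  ext x
  have h1 : Q (x - T (Q x)) = 0 := by rw [map_sub, h, sub_self]
  have h2 := (hk _).1 h1
  rw [map_sub, h', sub_eq_zero] at h2
  exact h2.symm

theorem exists_injOn_of_fderiv_injective {g : E → G} {z₀ : E} (hg : AnalyticAt ℂ g z₀)
    (hinj : Function.Injective (fderiv ℂ g z₀)) : ∃ N ∈ 𝓝 z₀, Set.InjOn g N := by
  obtain ⟨L, hL⟩ := (fderiv ℂ g z₀).toLinearMap.exists_leftInverse_of_injective
    (LinearMap.ker_eq_bot.2 hinj)
  let L' : G →L[ℂ] E := LinearMap.toContinuousLinearMap L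
  have h1 : HasStrictFDerivAt (fun z => L' (g z))
      ((ContinuousLinearEquiv.refl ℂ E : E ≃L[ℂ] E) : E →L[ℂ] E) z₀ := by
    have := L'.hasStrictFDerivAt.comp z₀ hg.hasStrictFDerivAt
    convert this using 1
    ext v
    exact (LinearMap.congr_fun hL v).symm
  refine ⟨_, (h1.toOpenPartialHomeomorph _).open_source.mem_nhds
    h1.mem_toOpenPartialHomeomorph_source, fun x hx y hy hxy => ?_⟩
  exact (h1.toOpenPartialHomeomorph _).injOn hx hy (congrArg L' hxy)

end Normalised

/-! ## Construction of leaf spaces -/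

section Box

variable {d : ℕ}

/-- `W` is a `τ`-invariant neighbourhood of `z₀` on which `π` has connected fibres. -/
structure IsBox {k : ℕ} (π : CSpace d → CSpace k) (z₀ : CSpace d) (W : Set (CSpace d)) : Prop where
  isOpen : IsOpen W
  isConnected : IsConnected W
  star_mem : ∀ q ∈ W, star q ∈ W
  base_mem : z₀ ∈ W
  fibre_connected : ∀ γ, IsPreconnected (W ∩ π ⁻¹' {γ})

/-- `Φ` is a local chart commuting with conjugation, in which the projection is linear. The preimage
of a small ball about the real point `Φ z₀` is invariant, since `star` is an isometry, and its
fibres correspond to intersections of the ball with affine subspaces, which are convex. -/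
theorem exists_box {k : ℕ} {Φ : CSpace d → CSpace d} {A : CSpace d →L[ℂ] CSpace k} {z₀ : CSpace d}
    (hΦ : AnalyticAt ℂ Φ z₀) (hd : ∀ v, fderiv ℂ Φ z₀ v = v) (hstar : ∀ z, Φ (star z) = star (Φ z))
    (hz₀ : star z₀ = z₀) {N : Set (CSpace d)} (hN : N ∈ 𝓝 z₀) :
    ∃ W ⊆ N, IsBox (fun z => A (Φ z)) z₀ W := by
  have h1 : HasStrictFDerivAt Φ
      ((ContinuousLinearEquiv.refl ℂ (CSpace d) : CSpace d ≃L[ℂ] CSpace d) :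
        CSpace d →L[ℂ] CSpace d) z₀ := by
    have e : fderiv ℂ Φ z₀ = ((ContinuousLinearEquiv.refl ℂ (CSpace d) : CSpace d ≃L[ℂ] CSpace d) :
        CSpace d →L[ℂ] CSpace d) := ContinuousLinearMap.ext hd
    exact e ▸ hΦ.hasStrictFDerivAt
  set e := h1.toOpenPartialHomeomorph Φ with he
  have hez : z₀ ∈ e.source := h1.mem_toOpenPartialHomeomorph_source
  have heΦ : ∀ z, e z = Φ z := fun z => rfl
  have hsrc : e.source ∈ 𝓝 z₀ := e.open_source.mem_nhds hez
  have hsrc' : ∀ᶠ z in 𝓝 z₀, star z ∈ e.source :=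
    eventually_star (by rw [hz₀]; exact hsrc)
  have hsymm : ContinuousAt e.symm (Φ z₀) := e.continuousAt_symm (e.map_source hez)
  have hlim : ∀ᶠ y in 𝓝 (Φ z₀), y ∈ e.target ∧ e.symm y ∈ N ∧ star (e.symm y) ∈ e.source := by
    have h2 : Filter.Tendsto e.symm (𝓝 (Φ z₀)) (𝓝 z₀) := by
      have := e.left_inv hez
      rw [heΦ] at this
      rw [ContinuousAt, this] at hsymm
      exact hsymm
    filter_upwards [e.open_target.mem_nhds (e.map_source hez), h2.eventually hN,
      h2.eventually hsrc'] with y e1 e2 e3 using ⟨e1, e2, e3⟩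
  obtain ⟨ε, hε, hball⟩ := Metric.eventually_nhds_iff_ball.1 hlim
  have hsub : Metric.ball (Φ z₀) ε ⊆ e.target := fun y hy => (hball y hy).1
  have hcont : ContinuousOn e.symm (Metric.ball (Φ z₀) ε) := e.continuousOn_symm.mono hsub
  have hmem : ∀ z, z ∈ e.symm '' Metric.ball (Φ z₀) ε ↔ z ∈ e.source ∧
      Φ z ∈ Metric.ball (Φ z₀) ε := fun z => by
    constructor
    · rintro ⟨y, hy, rfl⟩
      refine ⟨e.map_target (hsub hy), ?_⟩
      rw [← heΦ (e.symm y), e.right_inv (hsub hy)]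
      exact hy
    · rintro ⟨hz, hy⟩
      exact ⟨Φ z, hy, by rw [← heΦ, e.left_inv hz]⟩
  refine ⟨e.symm '' Metric.ball (Φ z₀) ε, ?_, ?_, ?_, ?_, ?_, ?_⟩
  · rintro _ ⟨y, hy, rfl⟩
    exact (hball y hy).2.1
  · exact e.symm.isOpen_image_of_subset_source Metric.isOpen_ball hsub
  · refine ⟨⟨z₀, (hmem z₀).2 ⟨hez, Metric.mem_ball_self hε⟩⟩, ?_⟩
    exact (convex_ball (Φ z₀) ε).isPreconnected.image _ hcont
  · intro q hq
    have hq' := (hmem q).1 hq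
    refine (hmem _).2 ⟨?_, ?_⟩
    · obtain ⟨y, hy, rfl⟩ := hq
      exact (hball y hy).2.2
    · have h0 : star (Φ z₀) = Φ z₀ := by rw [← hstar, hz₀]
      rw [hstar, Metric.mem_ball, ← h0, dist_star_star]
      exact hq'.2
  · exact (hmem z₀).2 ⟨hez, Metric.mem_ball_self hε⟩
  · intro γ
    have hset : e.symm '' Metric.ball (Φ z₀) ε ∩ (fun z => A (Φ z)) ⁻¹' {γ} =
        e.symm '' (Metric.ball (Φ z₀) ε ∩ A ⁻¹' {γ}) := by
      ext z
      constructor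
      · rintro ⟨⟨y, hy, rfl⟩, hz⟩
        refine ⟨y, ⟨hy, ?_⟩, rfl⟩
        have hz : A (Φ (e.symm y)) = γ := hz
        rw [← heΦ, e.right_inv (hsub hy)] at hz
        exact hz
      · rintro ⟨y, ⟨hy, hz⟩, rfl⟩
        refine ⟨⟨y, hy, rfl⟩, ?_⟩
        change A (Φ (e.symm y)) = γ
        rw [← heΦ, e.right_inv (hsub hy)]
        exact hz
    rw [hset]
    refine IsPreconnected.image (Convex.isPreconnected ((convex_ball _ _).inter ?_)) _
      (hcont.mono Set.inter_subset_left)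
    exact (convex_singleton γ).linear_preimage (A.toLinearMap.restrictScalars ℝ)

theorem star_comp_linear (L : CSpace d →L[ℂ] CSpace d) :
    ∃ L' : CSpace d →L[ℂ] CSpace d, ∀ v, L' v = star (L (star v)) :=
  ⟨LinearMap.toContinuousLinearMap
    { toFun := fun v => star (L (star v))
      map_add' := fun v w => by simp
      map_smul' := fun c v => by simp }, fun _ => rfl⟩

/-- The leaves of an involutive `τ`-invariant distribution are the fibres of a submersion that
has arbitrarily small `τ`-invariant neighbourhoods with connected fibres. -/
theorem exists_submersion_box {m : ℕ} {P : CSpace d → CSpace d →L[ℂ] (Fin m → ℂ)}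
    {D : CSpace d → Submodule ℂ (CSpace d)} {z₀ : CSpace d} (hz₀ : star z₀ = z₀)
    (hP : IsCoframeAt P D z₀)
    (hinv : ∀ᶠ z in 𝓝 z₀, ∀ v ∈ D z, ∀ w ∈ D z, curv P z v w = 0) (hτ : ∀ z, tauDist D z = D z) :
    ∃ π : CSpace d → CSpace m, AnalyticAt ℂ π z₀ ∧ IsCoframeAt (fderiv ℂ π) D z₀ ∧
      ∀ N ∈ 𝓝 z₀, ∃ W ⊆ N, IsBox π z₀ W := by
  obtain ⟨ρ, hρ, hρD, hρ0⟩ := frobenius hP hinv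
  obtain ⟨T₀, hT₀⟩ := (P z₀).toLinearMap.exists_rightInverse_of_surjective
    (LinearMap.range_eq_top.2 hP.surjective)
  let T : (Fin m → ℂ) →L[ℂ] CSpace d := LinearMap.toContinuousLinearMap T₀
  have hPT : ∀ f, P z₀ (T f) = f := fun f => LinearMap.congr_fun hT₀ f
  have hker : ∀ v, P z₀ v = 0 → P z₀ (star v) = 0 := fun v hv => by
    rw [← hP.mem_iff.self_of_nhds] at hv ⊢
    rw [← hτ, mem_tauDist, star_star, hz₀]
    exact hv
  let N₀ : CSpace d →L[ℂ] CSpace d := ContinuousLinearMap.id ℂ _ - T.comp (P z₀)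
  have hN₀ : ∀ v, N₀ v = v - T (P z₀ v) := fun v => rfl
  obtain ⟨N₁, hN₁⟩ := star_comp_linear N₀
  -- Averaging a projection onto `D z₀` with its conjugate. As `D z₀` is invariant under
  -- conjugation, the average is again a projection onto `D z₀`, and it commutes with `star`.
  let N : CSpace d →L[ℂ] CSpace d := (1 / 2 : ℂ) • (N₀ + N₁)
  have hN : ∀ v, N v = (1 / 2 : ℂ) • (N₀ v + star (N₀ (star v))) := fun v => by
    rw [← hN₁]; rfl
  have hNstar : ∀ v, N (star v) = star (N v) := fun v => by
    rw [hN, hN, star_smul, star_add, star_star, star_star, add_comm]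
    simp
  have hPN₀ : ∀ v, P z₀ (N₀ v) = 0 := fun v => by rw [hN₀, map_sub, hPT, sub_self]
  have hPN : ∀ v, P z₀ (N v) = 0 := fun v => by
    rw [hN, map_smul, map_add, hPN₀, hker _ (hPN₀ _), add_zero, smul_zero]
  have hNker : ∀ v, P z₀ v = 0 → N v = v := fun v hv => by
    rw [hN, hN₀, hN₀, hv, hker v hv, map_zero, sub_zero, sub_zero, star_star, ← two_smul ℂ v,
      smul_smul]
    norm_num
  let f : CSpace d → CSpace d := fun z => T (ρ z)
  have hf : AnalyticAt ℂ f z₀ := (T.analyticAt _).comp hρ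
  have hf' : AnalyticAt ℂ (fun z => star (f (star z))) z₀ :=
    analyticAt_star_star (by rwa [hz₀])
  -- The symmetrised first integral: it commutes with `star`, its derivative still vanishes on `D`,
  -- which is `τ`-invariant, and its derivative at `z₀` is `1 - N`.
  let s : CSpace d → CSpace d := fun z => (1 / 2 : ℂ) • (f z + star (f (star z)))
  have hs : AnalyticAt ℂ s z₀ := (hf.fun_add hf').fun_const_smul
  have hsstar : ∀ z, s (star z) = star (s z) := fun z => by
    simp only [s]
    rw [star_smul, star_add, star_star, star_star, add_comm]
    simp
  -- `N` supplies coordinates along the leaves and `s` transverse to them, so the derivative at `z₀`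
  -- is the identity. Since `P z₀ ∘ N = 0`, the map `P z₀ ∘ Φ` equals `P z₀ ∘ s` and is constant
  -- along the leaves.
  let Φ : CSpace d → CSpace d := fun z => N z + (s z - N (s z))
  have hΦ : AnalyticAt ℂ Φ z₀ := (N.analyticAt _).add (hs.sub ((N.analyticAt _).comp hs))
  have hΦstar : ∀ z, Φ (star z) = star (Φ z) := fun z => by
    simp only [Φ]
    rw [hsstar, hNstar, hNstar, star_add, star_sub]
  have hfd : ∀ᶠ z in 𝓝 z₀, ∀ v, fderiv ℂ f z v = T (fderiv ℂ ρ z v) := by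
    filter_upwards [hρ.eventually_analyticAt] with z hz v
    exact congrArg (fun L => L v) (T.hasFDerivAt.comp z hz.differentiableAt.hasFDerivAt).fderiv
  have hsd : ∀ᶠ z in 𝓝 z₀, ∀ v, fderiv ℂ s z v =
      (1 / 2 : ℂ) • (T (fderiv ℂ ρ z v) + star (T (fderiv ℂ ρ (star z) (star v)))) := by
    filter_upwards [hfd, eventually_star (z := z₀) (by rw [hz₀]; exact hfd),
      hf.eventually_analyticAt, eventually_star (z := z₀)
        (by rw [hz₀]; exact hf.eventually_analyticAt)] with z h1 h2 h3 h4 v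
    have e : HasFDerivAt s ((1 / 2 : ℂ) • (fderiv ℂ f z +
        fderiv ℂ (fun z => star (f (star z))) z)) z :=
      (h3.differentiableAt.hasFDerivAt.fun_add
        (analyticAt_star_star h4).differentiableAt.hasFDerivAt).fun_const_smul _
    rw [e.fderiv, smul_apply, add_apply, fderiv_star_star h4, h1, h2]
  have hΦd : ∀ v, fderiv ℂ Φ z₀ v = v := fun v => by
    have e : HasFDerivAt Φ (N + (fderiv ℂ s z₀ - N.comp (fderiv ℂ s z₀))) z₀ :=
      N.hasFDerivAt.add (hs.differentiableAt.hasFDerivAt.sub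
        (N.hasFDerivAt.comp z₀ hs.differentiableAt.hasFDerivAt))
    have e2 : fderiv ℂ s z₀ v = v - N v := by
      rw [hsd.self_of_nhds, hz₀, hρ0, hN, hN₀, hN₀, star_sub, star_star, ← sub_eq_zero]
      module
    rw [e.fderiv, add_apply, sub_apply, ContinuousLinearMap.comp_apply, e2, map_sub,
      hNker (N v) (hPN v), sub_self, sub_zero, add_sub_cancel]
  refine ⟨fun z => P z₀ (Φ z), ((P z₀).analyticAt _).comp hΦ, ?_,
    fun M hM => exists_box hΦ hΦd hΦstar hz₀ hM⟩
  have hπ : (fun z => P z₀ (Φ z)) = fun z => P z₀ (s z) := by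
    funext z
    simp only [Φ]
    rw [map_add, map_sub, hPN, hPN, zero_add, sub_zero]
  have hπd : ∀ᶠ z in 𝓝 z₀, ∀ v, fderiv ℂ (fun z => P z₀ (Φ z)) z v = P z₀ (fderiv ℂ s z v) := by
    rw [hπ]
    filter_upwards [hs.eventually_analyticAt] with z hz v
    exact congrArg (fun L => L v)
      ((P z₀).hasFDerivAt.comp z hz.differentiableAt.hasFDerivAt).fderiv
  have hA : AnalyticAt ℂ (fun z => P z₀ (Φ z)) z₀ := ((P z₀).analyticAt _).comp hΦ
  have hsurj : Function.Surjective (fderiv ℂ (fun z => P z₀ (Φ z)) z₀) := fun y => by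
    obtain ⟨v, rfl⟩ := hP.surjective y
    refine ⟨v, ?_⟩
    rw [fderiv_fun_comp z₀ (P z₀).differentiableAt hΦ.differentiableAt]
    simp [hΦd]
  refine ⟨hA.fderiv, hsurj, ?_⟩
  filter_upwards [hπd, hsd, eventually_surjective hA.fderiv hsurj, hρD.eventually,
    eventually_star (z := z₀) (by rw [hz₀]; exact hρD.eventually)] with z h1 h2 h3 h4 h5
  let K : Submodule ℂ (CSpace d) := LinearMap.ker (fderiv ℂ (fun z => P z₀ (Φ z)) z).toLinearMap
  have hle : D z ≤ K := fun v hv => by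
    change fderiv ℂ (fun z => P z₀ (Φ z)) z v = 0
    have hv' : star v ∈ D (star z) := by rw [← hτ] at hv; exact hv
    rw [h1, h2, (h4.mem_iff.self_of_nhds _).1 hv, (h5.mem_iff.self_of_nhds _).1 hv']
    simp
  have hfr : Module.finrank ℂ (D z) = Module.finrank ℂ K := by
    have e1 := h4.finrank_add
    have e2 := LinearMap.finrank_range_add_finrank_ker
      (fderiv ℂ (fun z => P z₀ (Φ z)) z).toLinearMap
    rw [LinearMap.range_eq_top.2 h3, finrank_top] at e2
    have e3 : Module.finrank ℂ (Fin m → ℂ) + Module.finrank ℂ K =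
      Module.finrank ℂ (CSpace d) := e2
    omega
  intro v
  rw [Submodule.eq_of_le_of_finrank_eq hle hfr]
  rfl

end Box

end LeviCR

namespace LeviCR

set_option linter.unusedSectionVars false

/-! ### The canonical map is locally injective; existence of Levi leaf spaces. -/

section LeafSpace

variable {d k : ℕ} {M : Type*} [TopologicalSpace M] [ChartedSpace (RSpace d) M]
  [IsManifold (𝓡 d) ω M] {p : M} {H : CDist d M} {Hc Kc : CSpace d → Submodule ℂ (CSpace d)}

/-- The normalised coframes `Q` of `H ⊕ K̄` and `Q'` of `K ⊕ H̄` encode the two image subspaces. A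
vector killed by the derivative of `(π, Q, Q')` is `a + b` with `a` in `K` and `b` in `K̄`. By
`curv_comp_fderiv` it annihilates `H` under the curvature of `H ⊕ K̄`, which forces `b = 0` by
nondegeneracy; the conjugate argument gives `a = 0`. An immersion is locally injective. -/
theorem IsCRGerm.exists_injOn (h : IsCRGerm H p Hc Kc) (hn : IsTwoNondegenerateAt H p)
    {π : CSpace d → CSpace k} (hπ : AnalyticAt ℂ π (realPoint d p p))
    (hπD : IsCoframeAt (fderiv ℂ π) (fun z => Kc z ⊔ tauDist Kc z) (realPoint d p p)) :
    ∃ N ∈ 𝓝 (realPoint d p p), Set.InjOn (fun q => (π q, (Hc q).map (fderiv ℂ π q).toLinearMap,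
      (tauDist Hc q).map (fderiv ℂ π q).toLinearMap)) N := by
  set z₀ := realPoint d p p with hz₀
  have hsz : star z₀ = z₀ := star_toC _
  obtain ⟨m, P, hP⟩ := h.dist_S
  obtain ⟨m', P', hP'⟩ := h.dist_S.tau_toC
  have hτS : ∀ z, tauDist (fun z => Hc z ⊔ tauDist Kc z) z = tauDist Hc z ⊔ Kc z := fun z => by
    rw [tauDist_sup, tauDist_tauDist]
  have hnd := ((isTwoNondegenerateAt_iff h.ext_H h.ext_K (mem_chart_source _ p) h.dist_H h.dist_K
    hP).1 hn).2
  have hDS' : ∀ᶠ z in 𝓝 z₀, Kc z ⊔ tauDist Kc z ≤ tauDist (fun z => Hc z ⊔ tauDist Kc z) z := by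
    filter_upwards [h.τK_le_τH] with z hz
    rw [hτS, sup_comm]
    exact sup_le_sup_right hz _
  obtain ⟨Q, T, hQ, hQT, hQS⟩ := exists_normalised_coframe hπD hP h.D_le_S
  obtain ⟨Q', T', hQ', hQT', hQS'⟩ := exists_normalised_coframe hπD hP' hDS'
  have hg : AnalyticAt ℂ (fun z => (π z, Q z, Q' z)) z₀ := hπ.prod (hQ.prod hQ')
  have hgd : HasFDerivAt (fun z => (π z, Q z, Q' z))
      ((fderiv ℂ π z₀).prod ((fderiv ℂ Q z₀).prod (fderiv ℂ Q' z₀))) z₀ :=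
    hπ.differentiableAt.hasFDerivAt.prodMk (hQ.differentiableAt.hasFDerivAt.prodMk
      hQ'.differentiableAt.hasFDerivAt)
  have hinj : Function.Injective (fderiv ℂ (fun z => (π z, Q z, Q' z)) z₀) := by
    rw [injective_iff_map_eq_zero]
    intro v hv
    rw [hgd.fderiv] at hv
    have h1 : fderiv ℂ π z₀ v = 0 := congrArg Prod.fst hv
    have h2 : fderiv ℂ Q z₀ v = 0 := congrArg (fun x => x.2.1) hv
    have h3 : fderiv ℂ Q' z₀ v = 0 := congrArg (fun x => x.2.2) hv
    have e1 : ∀ w, curv (fun z => (Q z).comp (fderiv ℂ π z)) z₀ v w = 0 := fun w => by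
      rw [curv_comp_fderiv hπ hQ h1, h2, zero_apply, neg_zero]
    have e2 : ∀ w, curv (fun z => (Q' z).comp (fderiv ℂ π z)) z₀ v w = 0 := fun w => by
      rw [curv_comp_fderiv hπ hQ' h1, h3, zero_apply, neg_zero]
    have hnd' := ((isTwoNondegenerateAt_iff h.ext_H h.ext_K (mem_chart_source _ p) h.dist_H
      h.dist_K hQS).1 hn).2
    have hHH := (h.curv_H_of_le hQS (Filter.Eventually.of_forall fun z => le_sup_left)).self_of_nhds
    obtain ⟨a, ha, b, hb, rfl⟩ := Submodule.mem_sup.1 ((hπD.mem_iff.self_of_nhds v).2 h1)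
    have hKH := h.K_le_H.self_of_nhds
    have hb0 : b = 0 := by
      by_contra hne
      obtain ⟨w, hw, hbw⟩ := hnd' b hb hne
      have := e1 w
      rw [map_add, add_apply, hHH a (hKH ha) w hw, zero_add] at this
      exact hbw this
    rw [hb0, add_zero] at e2 ⊢
    by_contra hne
    -- Nondegeneracy concerns `K̄`, so it is applied to the conjugate of `a` and carried back by
    -- `curv_tau`.
    have ha' : star a ∈ tauDist Kc z₀ := by rw [mem_tauDist, star_star, hsz]; exact ha
    obtain ⟨w, hw, haw⟩ := hnd' (star a) ha' (by simpa using hne)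
    refine haw ?_
    have hQS'' : IsCoframeAt (fun z => (Q' z).comp (fderiv ℂ π z))
        (tauDist fun z => Hc z ⊔ tauDist Kc z) (star z₀) := by rw [hsz]; exact hQS'
    refine curv_tau hQS hQS'' (Filter.Eventually.of_forall fun w => by rw [tauDist_tauDist])
      ?_ ?_ ?_
    · rw [hτS, star_star, hsz]; exact Submodule.mem_sup_right ha
    · rw [hτS, hsz]
      refine Submodule.mem_sup_left ?_
      rw [mem_tauDist, star_star, hsz]
      exact hw
    · rw [star_star, hsz]; exact e2 _
  obtain ⟨N, hN, hNinj⟩ := exists_injOn_of_fderiv_injective hg hinj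
  have hQker : ∀ᶠ z in 𝓝 z₀, ∀ x, Q z x = 0 ↔ x ∈ (Hc z).map (fderiv ℂ π z).toLinearMap := by
    filter_upwards [hπD.eventually, hQS.mem_iff] with z h1 h2 x
    obtain ⟨v, rfl⟩ := h1.surjective x
    have h3 : (fderiv ℂ π z).toLinearMap.ker = Kc z ⊔ tauDist Kc z := by
      ext w; exact (h1.mem_iff.self_of_nhds w).symm
    have h4 : Q z (fderiv ℂ π z v) = 0 ↔ v ∈ Hc z ⊔ tauDist Kc z := (h2 v).symm
    rw [h4]
    constructor
    · intro hv
      obtain ⟨a, ha, b, hb, rfl⟩ := Submodule.mem_sup.1 hv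
      refine ⟨a, ha, ?_⟩
      have : fderiv ℂ π z b = 0 := (h1.mem_iff.self_of_nhds b).1 (Submodule.mem_sup_right hb)
      rw [map_add, this, add_zero]
      rfl
    · rintro ⟨a, ha, hav⟩
      rw [← h4, ← hav]
      exact (h2 a).1 (Submodule.mem_sup_left ha)
  have hQker' : ∀ᶠ z in 𝓝 z₀, ∀ x, Q' z x = 0 ↔
      x ∈ (tauDist Hc z).map (fderiv ℂ π z).toLinearMap := by
    filter_upwards [hπD.eventually, hQS'.mem_iff] with z h1 h2 x
    obtain ⟨v, rfl⟩ := h1.surjective x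
    have h4 : Q' z (fderiv ℂ π z v) = 0 ↔ v ∈ tauDist Hc z ⊔ Kc z := by
      rw [← hτS]; exact (h2 v).symm
    rw [h4]
    constructor
    · intro hv
      obtain ⟨a, ha, b, hb, rfl⟩ := Submodule.mem_sup.1 hv
      refine ⟨a, ha, ?_⟩
      have : fderiv ℂ π z b = 0 := (h1.mem_iff.self_of_nhds b).1 (Submodule.mem_sup_left hb)
      rw [map_add, this, add_zero]
      rfl
    · rintro ⟨a, ha, hav⟩
      rw [← h4, ← hav]
      refine (h2 a).1 ?_
      rw [hτS]
      exact Submodule.mem_sup_left ha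
  refine ⟨_, Filter.inter_mem (Filter.inter_mem hN (Filter.inter_mem hQker hQker'))
    (Filter.inter_mem hQT hQT'), fun x hx y hy hxy => hNinj hx.1.1 hy.1.1 ?_⟩
  have f1 : π x = π y := congrArg Prod.fst hxy
  have f2 : (Hc x).map (fderiv ℂ π x).toLinearMap = (Hc y).map (fderiv ℂ π y).toLinearMap :=
    congrArg (fun x => x.2.1) hxy
  have f3 : (tauDist Hc x).map (fderiv ℂ π x).toLinearMap =
    (tauDist Hc y).map (fderiv ℂ π y).toLinearMap := congrArg (fun x => x.2.2) hxy
  have g1 : Q x = Q y := eq_of_ker_eq hx.2.1 hy.2.1 fun t => by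
    rw [hx.1.2.1 t, hy.1.2.1 t]; rw [f2]
  have g2 : Q' x = Q' y := eq_of_ker_eq hx.2.2 hy.2.2 fun t => by
    rw [hx.1.2.2 t, hy.1.2.2 t]; rw [f3]
  simp only [f1, g1, g2]

/-- Every local requirement on a leaf space holds near the base point, so one neighbourhood `N`
works for all of them, and any box inside `N` will do. Leaving the box free allows two CR structures
to be given leaf spaces with the same domain. -/
theorem IsCRGerm.exists_leafSpace {n : ℕ} (h : IsCRGerm H p Hc Kc)
    (hn : IsTwoNondegenerateAt H p) (hHn : Module.finrank ℂ (Hc (realPoint d p p)) = n)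
    (hK1 : Module.finrank ℂ (Kc (realPoint d p p)) = 1)
    {π : CSpace d → CSpace k} (hπ : AnalyticAt ℂ π (realPoint d p p))
    (hπD : IsCoframeAt (fderiv ℂ π) (fun z => Kc z ⊔ tauDist Kc z) (realPoint d p p))
    {U : Set M} (hU : U ∈ 𝓝 p) :
    ∃ N ∈ 𝓝 (realPoint d p p), ∀ W ⊆ N, IsBox π (realPoint d p p) W →
      ∃ R : LeviLeafSpace n 1 k H U p, R.W = W ∧ R.Hc = Hc ∧ R.Kc = Kc ∧ R.π = π := by
  set z₀ := realPoint d p p with hz₀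
  have hp := mem_chart_source (RSpace d) p
  obtain ⟨N₀, hN₀, hinj⟩ := h.exists_injOn hn hπ hπD
  obtain ⟨X, hX⟩ := h.dist_H.exists_frame hHn
  obtain ⟨Y, hY⟩ := h.dist_K.exists_frame hK1
  obtain ⟨m, P, hP⟩ := h.dist_S
  have hnd := ((isTwoNondegenerateAt_iff h.ext_H h.ext_K hp h.dist_H h.dist_K hP).1 hn).2
  obtain ⟨y, hy, hy0⟩ : ∃ y ∈ tauDist Kc z₀, y ≠ 0 := by
    have : Nontrivial (Kc z₀) := Module.nontrivial_of_finrank_pos (R := ℂ) (by omega)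
    obtain ⟨⟨y, hy⟩, hy0⟩ := exists_ne (0 : Kc z₀)
    refine ⟨star y, ?_, fun h0 => hy0 (Subtype.ext (star_eq_zero.1 h0))⟩
    rw [mem_tauDist, star_star, star_toC]
    exact hy
  obtain ⟨w, hw, hyw⟩ := hnd y hy hy0
  obtain ⟨V, hV, rfl⟩ := h.dist_K.tau_toC.exists_sec hy
  obtain ⟨X₀, hX₀, rfl⟩ := h.dist_H.exists_sec hw
  have hc : AnalyticAt ℂ (fun z => curv P z (V z) (X₀ z)) z₀ :=
    analyticAt_clm_apply (analyticAt_clm_apply (analyticAt_curv hP.analyticAt) hV.1) hX₀.1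
  have hne := hc.continuousAt.eventually_ne hyw
  have hreal : ∀ {φ : M → Prop}, (∀ᶠ y in 𝓝 p, φ y) →
      ∀ᶠ z in 𝓝 z₀, φ ((chartAt (RSpace d) p).symm (reC d z)) := fun {φ} hφ =>
    eventually_reC (eventually_chart_symm hp hφ)
  have htar : ∀ᶠ z in 𝓝 z₀, reC d z ∈ (chartAt (RSpace d) p).target :=
    eventually_reC ((chartAt (RSpace d) p).open_target.mem_nhds
      ((chartAt (RSpace d) p).map_source hp))
  have hall := (((hπ.eventually_analyticAt.and hπD.eventually).and
    (hX.eventually.and hY.eventually)).and ((htar.and (hreal hU)).and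
    ((hreal h.ext_H).and (hreal h.ext_K)))).and
    (((h.dist_H.eventually_inf_eq_bot h.dist_H.tau_toC h.transversal).and hne).and
    ((hV.eventually.and hX₀.eventually).and (hP.eventually.and
      (eventually_star_toC h.dist_K.finrank_eventually))))
  refine ⟨N₀ ∩ _, Filter.inter_mem hN₀ hall, fun W hW hbox => ?_⟩
  have hback : ∀ y ∈ (chartAt (RSpace d) p).source,
      (chartAt (RSpace d) p).symm (reC d (toC d (chartAt (RSpace d) p y))) = y := fun y hy => by
    rw [reC_toC, (chartAt (RSpace d) p).left_inv hy]
  have hHol : ∀ {r : ℕ} {Z : Fin r → CSpace d → CSpace d} {S : CSpace d → Submodule ℂ (CSpace d)},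
      (∀ q ∈ W, IsFrameAt Z S q) → IsHolDistOn r S W := fun {r Z S} hZ q hq =>
    ⟨Z, (hZ q hq).analyticAt, by
      filter_upwards [(hZ q hq).eventually] with z hz
      exact ⟨hz.linearIndependent, hz.span_eq.self_of_nhds⟩⟩
  exact ⟨{
    W := W
    Hc := Hc
    Kc := Kc
    π := π
    isOpen_W := hbox.isOpen
    isConnected_W := hbox.isConnected
    star_mem := hbox.star_mem
    base_mem := hbox.base_mem
    real_mem := fun x hx => by
      have := (hW hx).2.1.2.1
      rw [reC_toC] at this
      exact this
    hol_H := hHol fun q hq => (hW hq).2.1.1.2.1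
    hol_K := hHol fun q hq => (hW hq).2.1.1.2.2
    extends_H := fun y hy hyW => by
      have := (hW hyW).2.1.2.2.1
      rw [hback y hy] at this
      exact this
    extends_K := fun y hy hyW => by
      have := (hW hyW).2.1.2.2.2
      rw [hback y hy] at this
      exact this
    transversal := fun q hq => (hW hq).2.2.1.1
    -- `K̄` is a line spanned by `V q`, and the curvature of `(V, X₀)` does not vanish on `N`; a
    -- nonzero `v` is a nonzero multiple of `V q`.
    nondegenerate := fun q hq v hv hv0 => by
      obtain ⟨⟨h1, h2⟩, ⟨h3, h4⟩, h5, h6⟩ := (hW hq).2.2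
      have hVq : V q ≠ 0 := fun h0 => h2 (by rw [h0, map_zero, zero_apply])
      obtain ⟨c, rfl⟩ := finrank_tauDist Kc q (h6.trans hK1) h3.mem hVq hv
      have h7 : IsSec (tauDist Kc) (fun z => c • V z) q :=
        ⟨h3.1.fun_const_smul, by
          filter_upwards [h3.2] with z hz using Submodule.smul_mem _ _ hz⟩
      refine ⟨fun z => c • V z, X₀, h7.1, h4.1, h7.2, h4.2, rfl, fun hb => ?_⟩
      have hc0 : c ≠ 0 := fun h0 => hv0 (by rw [h0, zero_smul])
      have := (h5.lieBracket_mem_iff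
        (h7.mono (Filter.Eventually.of_forall fun z => le_sup_right))
        (h4.mono (Filter.Eventually.of_forall fun z => le_sup_left))).1
        hb
      rw [map_smul, smul_apply, smul_eq_zero] at this
      exact this.elim hc0 h2
    hol_π := fun q hq => (hW hq).2.1.1.1.1.differentiableAt.differentiableWithinAt
    submersion := fun q hq => (hW hq).2.1.1.1.2.surjective
    ker_π := fun q hq => by
      ext v
      exact ((hW hq).2.1.1.1.2.mem_iff.self_of_nhds v).symm
    fibre_connected := hbox.fibre_connected
    canonical_injOn := hinj.mono fun q hq => (hW hq).1 }, rfl, rfl, rfl, rfl⟩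

end LeafSpace

end LeviCR

namespace LeviCR

set_option linter.unusedSectionVars false

/-! ## Existence of holomorphic extensions -/

/-- The rank is known to be constant at real points only. Composing `B` with a projection onto its
range at `x₀` gives a family of locally constant rank whose kernel contains that of `B`, with
equality at real points by dimension. A frame of the larger kernel is killed by `B` at real points,
hence nearby. This is how the Levi kernel gets its holomorphic extension. -/
theorem isDistAt_ker_of_real {d r : ℕ} {F : Type*} [NormedAddCommGroup F] [NormedSpace ℂ F]
    [FiniteDimensional ℂ F] [CompleteSpace F] {B : CSpace d → CSpace d →L[ℂ] F} {x₀ : RSpace d}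
    (hB : AnalyticAt ℂ B (toC d x₀))
    (hr : ∀ᶠ x in 𝓝 x₀, Module.finrank ℂ (LinearMap.ker (B (toC d x)).toLinearMap) = r) :
    IsDistAt (fun z => LinearMap.ker (B z).toLinearMap) (toC d x₀) := by
  set R := LinearMap.range (B (toC d x₀)).toLinearMap with hR
  obtain ⟨Λ₀, hΛ₀⟩ := R.subtype.exists_leftInverse_of_injective (Submodule.ker_subtype R)
  let Λ : F →L[ℂ] R := LinearMap.toContinuousLinearMap Λ₀
  have hΛ : ∀ y : R, Λ y = y := fun y => LinearMap.congr_fun hΛ₀ y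
  let P : CSpace d → CSpace d →L[ℂ] R := fun z => Λ.comp (B z)
  have hP : IsCoframeAt P (fun z => LinearMap.ker (P z).toLinearMap) (toC d x₀) :=
    ⟨analyticAt_clm_comp analyticAt_const hB, fun y => by
      obtain ⟨v, hv⟩ := y.2
      refine ⟨v, ?_⟩
      change Λ (B (toC d x₀) v) = y
      rw [← hΛ y, ← hv]
      rfl, Filter.Eventually.of_forall fun z v => Iff.rfl⟩
  have hle : ∀ z, LinearMap.ker (B z).toLinearMap ≤ LinearMap.ker (P z).toLinearMap :=
    fun z v hv => by
      have hv : B z v = 0 := hv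
      change Λ (B z v) = 0
      rw [hv, map_zero]
  have hker : LinearMap.ker (P (toC d x₀)).toLinearMap =
      LinearMap.ker (B (toC d x₀)).toLinearMap := by
    refine le_antisymm (fun v hv => ?_) (hle _)
    have hv : Λ (B (toC d x₀) v) = 0 := hv
    have := hΛ ⟨B (toC d x₀) v, v, rfl⟩
    rw [hv] at this
    exact (congrArg Subtype.val this).symm
  have h0 : Module.finrank ℂ (LinearMap.ker (P (toC d x₀)).toLinearMap) = r := by
    rw [hker]; exact hr.self_of_nhds
  obtain ⟨X, hX⟩ := hP.isDistAt.exists_frame rfl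
  have hBX : ∀ i, ∀ᶠ z in 𝓝 (toC d x₀), B z (X i z) = 0 := fun i => by
    refine eventually_eq_zero_of_real (analyticAt_clm_apply hB (hX.analyticAt i)) ?_
    filter_upwards [hr, eventually_toC hP.isDistAt.finrank_eventually,
      eventually_toC (hX.isSec i).2] with x h1 h2 h3
    have := Submodule.eq_of_le_of_finrank_eq (hle (toC d x)) (by rw [h1, h2, h0])
    rw [← this] at h3
    exact h3
  refine hP.isDistAt.congr ?_
  filter_upwards [hX.span_eq, Filter.eventually_all.2 hBX] with z h1 h2
  refine le_antisymm ?_ (hle z)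
  rw [← h1, Submodule.span_le]
  rintro _ ⟨i, rfl⟩
  exact h2 i

section Extension

variable {d : ℕ} {M : Type*} [TopologicalSpace M] [ChartedSpace (RSpace d) M]
  [IsManifold (𝓡 d) ω M] {p : M} {H : CDist d M}

theorem IsAnalyticDistOn.exists_extension {r : ℕ} {U : Set M} (h : IsAnalyticDistOn r H U)
    (hp : p ∈ U) : ∃ (Hc : CSpace d → Submodule ℂ (CSpace d)) (X : Fin r → CSpace d → CSpace d),
      IsFrameAt X Hc (realPoint d p p) ∧ ExtendsAt p p H Hc := by
  have hs := mem_chart_source (RSpace d) p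
  obtain ⟨X, hX, hXH⟩ := h p hp
  have hg : ∀ i, ∃ g : CSpace d → CSpace d, AnalyticAt ℂ g (realPoint d p p) ∧
      ∀ᶠ x in 𝓝 (chartAt (RSpace d) p p), g (toC d x) = fieldRep p (X i) x := fun i =>
    exists_holomorphic_extension ((hX i).contDiffAt hs).analyticAt
  choose g hg hgX using hg
  have hgy : ∀ᶠ y in 𝓝 p, ∀ i, g i (realPoint d p y) = chartDiff p y (X i y) := by
    filter_upwards [eventually_chart hs (Filter.eventually_all.2 hgX),
      (chartAt (RSpace d) p).open_source.mem_nhds hs] with y h1 h2 i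
    rw [h1 i, fieldRep_apply h2]
  refine ⟨fun z => Submodule.span ℂ (Set.range fun i => g i z), g,
    ⟨hg, ?_, Filter.Eventually.of_forall fun z => rfl⟩, ?_⟩
  · rw [show (fun i => g i (realPoint d p p)) = fun i => chartDiff p p (X i p) from
      funext hgy.self_of_nhds]
    exact hXH.self_of_nhds.1.map' _ (LinearMap.ker_eq_bot.2 (chartDiff_bijective hs).1)
  · filter_upwards [hgy, hXH] with y h1 h2
    rw [← h2.2, Submodule.map_span, ← Set.range_comp]
    congr 2
    exact funext h1

theorem map_chartDiff_inf_τ {q : M} {Hc : CSpace d → Submodule ℂ (CSpace d)}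
    (h : ExtendsAt p q H Hc) (hq : q ∈ (chartAt (RSpace d) p).source) :
    Hc (realPoint d p q) ⊓ tauDist Hc (realPoint d p q) = ⊥ ↔ H q ⊓ barDist H q = ⊥ := by
  rw [h.self_of_nhds, h.tau.self_of_nhds,
    ← Submodule.map_inf _ (chartDiff_bijective (d := d) hq).1]
  exact (Submodule.map_injective_of_injective (chartDiff_bijective hq).1).eq_iff'
    (Submodule.map_bot _)

theorem IsCRStructureOn.exists_germ {n : ℕ} {U : Set M} (hH : IsCRStructureOn n H U)
    (hU : U ∈ 𝓝 p) {r : ℕ} (hr : ∀ᶠ q in 𝓝 p, Module.finrank ℂ (leviKernel H q) = r) :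
    ∃ Hc Kc, IsCRGerm H p Hc Kc ∧ Module.finrank ℂ (Hc (realPoint d p p)) = n ∧
      Module.finrank ℂ (Kc (realPoint d p p)) = r := by
  have hs := mem_chart_source (RSpace d) p
  have hp := mem_of_mem_nhds hU
  obtain ⟨Hc, X, hX, hext⟩ := hH.analytic.exists_extension hp
  have hD := hX.isDistAt
  have htr := (map_chartDiff_inf_τ hext hs).2 (hH.totally_real p hp)
  obtain ⟨l, P, hP⟩ := hD
  obtain ⟨m, Q, hQ⟩ := hP.isDistAt.sup hP.isDistAt.tau_toC htr
  obtain ⟨N, hN, hNH⟩ := hP.isDistAt.tau_toC.exists_projection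
  -- Both defining conditions of the Levi kernel as one linear system: `P z v = 0` says that `v` is
  -- in `H`, and the second component is the curvature of `H ⊕ H̄` paired with `v` after projecting
  -- the other argument onto `H̄` by `N z`.
  let B : CSpace d → CSpace d →L[ℂ] (Fin l → ℂ) × (CSpace d →L[ℂ] (Fin m → ℂ)) := fun z =>
    (P z).prod (((ContinuousLinearMap.compL ℂ (CSpace d) (CSpace d) (Fin m → ℂ)).flip (N z)).comp
      (curv Q z))
  have hcomp := @ContinuousLinearMap.analyticAt ℂ _ (CSpace d →L[ℂ] CSpace d) _ _
    ((CSpace d →L[ℂ] (Fin m → ℂ)) →L[ℂ] CSpace d →L[ℂ] (Fin m → ℂ)) _ _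
    (ContinuousLinearMap.compL ℂ (CSpace d) (CSpace d) (Fin m → ℂ)).flip
    (N (realPoint d p p))
  have hB : AnalyticAt ℂ B (realPoint d p p) :=
    analyticAt_clm_prod hP.analyticAt (analyticAt_clm_comp (hcomp.comp hN)
      (analyticAt_curv hQ.analyticAt))
  have hBmem : ∀ᶠ z in 𝓝 (realPoint d p p), ∀ v, v ∈ LinearMap.ker (B z).toLinearMap ↔
      v ∈ Hc z ∧ ∀ w ∈ tauDist Hc z, curv Q z v w = 0 := by
    filter_upwards [hP.mem_iff, hNH] with z h1 h2 v
    have e : v ∈ LinearMap.ker (B z).toLinearMap ↔ P z v = 0 ∧ (curv Q z v).comp (N z) = 0 :=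
      Prod.ext_iff
    rw [e, ← h1]
    refine and_congr_right fun _ => ⟨fun h0 w hw => ?_, fun h0 => ?_⟩
    · have := congrArg (fun L => L w) h0
      rwa [ContinuousLinearMap.comp_apply, h2.2 w hw] at this
    · ext1 w
      exact h0 _ (h2.1 w)
  have hBK : ExtendsAt p p (leviKernel H) fun z => LinearMap.ker (B z).toLinearMap := by
    filter_upwards [eventually_realPoint hBmem, hext.eventually, eventually_realPoint
      hP.isDistAt.eventually, eventually_realPoint hQ.eventually,
      (chartAt (RSpace d) p).open_source.mem_nhds hs] with y h1 h2 h3 h4 h5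
    ext v
    rw [h1]
    constructor
    · rintro ⟨hv, hw⟩
      obtain ⟨x, hx, rfl⟩ := h2.exists_eq hv
      exact ⟨x, (h2.mem_leviKernel_iff h5 h3 h4).2 ⟨hx, hw⟩, rfl⟩
    · rintro ⟨x, hx, rfl⟩
      have := (h2.mem_leviKernel_iff h5 h3 h4).1 hx
      exact ⟨(h2.mem_iff h5).2 this.1, this.2⟩
  have hrank : ∀ᶠ y in 𝓝 p,
      Module.finrank ℂ (LinearMap.ker (B (realPoint d p y)).toLinearMap) = r := by
    filter_upwards [hBK, hr, (chartAt (RSpace d) p).open_source.mem_nhds hs] with y h1 h2 h3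
    have h1 : LinearMap.ker (B (realPoint d p y)).toLinearMap = _ := h1
    rw [h1, ← h2]
    exact (Submodule.equivMapOfInjective _ (chartDiff_bijective h3).1 _).finrank_eq.symm
  refine ⟨Hc, _, ⟨hext, hBK, hP.isDistAt, isDistAt_ker_of_real hB
    (eventually_toC_of_realPoint (φ := fun z => Module.finrank ℂ
      (LinearMap.ker (B z).toLinearMap) = r) ?_), htr, ?_⟩,
    hX.finrank_eq.trans (Fintype.card_fin n), hrank.self_of_nhds⟩
  · filter_upwards [hrank] with y hy _ using hy
  · filter_upwards [eventually_mem_nhds_iff.2 hU] with q hq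
    exact hH.involutive q (mem_of_mem_nhds hq)

end Extension

end LeviCR

namespace LeviCR

set_option linter.unusedSectionVars false

/-! ## Restriction of holomorphic distributions to real points -/

section Restriction

variable {d : ℕ} {M : Type*} [TopologicalSpace M] [ChartedSpace (RSpace d) M]
  [IsManifold (𝓡 d) ω M] {p : M} {Hc Kc : CSpace d → Submodule ℂ (CSpace d)}

/-- The field of subspaces near `p` with holomorphic extension `Dc`. -/
noncomputable def restrictDist (p : M) (Dc : CSpace d → Submodule ℂ (CSpace d)) : CDist d M :=
  fun y => (Dc (realPoint d p y)).comap (chartDiff p y)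

theorem extendsAt_restrictDist {q : M} (hq : q ∈ (chartAt (RSpace d) p).source)
    (Dc : CSpace d → Submodule ℂ (CSpace d)) : ExtendsAt p q (restrictDist p Dc) Dc := by
  filter_upwards [(chartAt (RSpace d) p).open_source.mem_nhds hq] with y hy
  exact (Submodule.map_comap_eq_of_surjective (chartDiff_bijective hy).2 _).symm

theorem ExtendsAt.exists_frame {q : M} {D : CDist d M} {r : ℕ} {X : Fin r → CSpace d → CSpace d}
    (h : ExtendsAt p q D Hc) (hq : q ∈ (chartAt (RSpace d) p).source)
    (hX : IsFrameAt X Hc (realPoint d p q)) :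
    ∃ Y : Fin r → CField d M, (∀ i, RegularNear ω (Y i) q) ∧
      ∀ᶠ y in 𝓝 q, LinearIndependent ℂ (fun i => Y i y) ∧
        Submodule.span ℂ (Set.range fun i => Y i y) = D y := by
  refine ⟨fun i => ofRep p fun x => X i (toC d x), fun i => regularNear_ofRep hq ?_, ?_⟩
  · filter_upwards [eventually_toC (hX.analyticAt i).eventually_analyticAt] with x hx
    exact (AnalyticAt.comp (hx.restrictScalars (𝕜 := ℝ)) ((toCL d).analyticAt x)).contDiffAt
  · filter_upwards [h, eventually_chart hq (eventually_toC hX.eventually),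
      (chartAt (RSpace d) p).open_source.mem_nhds hq] with y h1 h2 h3
    have e : (chartDiff p y ∘ fun i => ofRep p (fun x => X i (toC d x)) y) =
        fun i => X i (realPoint d p y) := funext fun i => chartDiff_ofRep h3 _
    constructor
    · refine LinearIndependent.of_comp (chartDiff p y) ?_
      rw [e]
      exact h2.linearIndependent
    · apply Submodule.map_injective_of_injective (chartDiff_bijective (d := d) h3).1
      rw [Submodule.map_span, ← Set.range_comp, e, h2.span_eq.self_of_nhds, h1]

/-- The conditions on a CR structure and on its Levi kernel are curvature conditions at real points,
equivalent to the bracket conditions on smooth sections. So they can be read back from the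
complexification to `M`. -/
theorem exists_CRStructureOn_of_holomorphic (p : M) {n : ℕ}
    (hH : IsDistAt Hc (realPoint d p p)) (hK : IsDistAt Kc (realPoint d p p))
    (hHn : Module.finrank ℂ (Hc (realPoint d p p)) = n)
    (hK1 : Module.finrank ℂ (Kc (realPoint d p p)) = 1)
    (htr : Hc (realPoint d p p) ⊓ tauDist Hc (realPoint d p p) = ⊥)
    {l m m' : ℕ} {P : CSpace d → CSpace d →L[ℂ] (Fin l → ℂ)}
    {Q : CSpace d → CSpace d →L[ℂ] (Fin m → ℂ)} {P' : CSpace d → CSpace d →L[ℂ] (Fin m' → ℂ)}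
    (hP : IsCoframeAt P Hc (realPoint d p p))
    (hQ : IsCoframeAt Q (fun z => Hc z ⊔ tauDist Hc z) (realPoint d p p))
    (hP' : IsCoframeAt P' (fun z => Hc z ⊔ tauDist Kc z) (realPoint d p p))
    (hinv : ∀ᶠ z in 𝓝 (realPoint d p p), ∀ v ∈ Hc z, ∀ w ∈ Hc z, curv P z v w = 0)
    (hker : ∀ᶠ y in 𝓝 p, ∀ v, v ∈ Kc (realPoint d p y) ↔ v ∈ Hc (realPoint d p y) ∧
      ∀ w ∈ tauDist Hc (realPoint d p y), curv Q (realPoint d p y) v w = 0)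
    (hnd : ∀ᶠ z in 𝓝 (realPoint d p p), ∀ v ∈ tauDist Kc z, v ≠ 0 →
      ∃ w ∈ Hc z, curv P' z v w ≠ 0) :
    ∃ (H : CDist d M) (U : Set M), IsOpen U ∧ p ∈ U ∧ IsCRStructureOn n H U ∧
      (∀ q ∈ U, Module.finrank ℂ (leviKernel H q) = 1) ∧ (∀ q ∈ U, IsTwoNondegenerateAt H q) ∧
      IsCRGerm H p Hc Kc := by
  have hs := mem_chart_source (RSpace d) p
  have hsrc := (chartAt (RSpace d) p).open_source.mem_nhds hs
  set H := restrictDist p Hc with hHdef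
  have hext : ∀ᶠ q in 𝓝 p, ExtendsAt p q H Hc := by
    filter_upwards [hsrc] with q hq using extendsAt_restrictDist hq Hc
  have hextK : ExtendsAt p p (leviKernel H) Kc := by
    filter_upwards [hext, hker, hsrc, eventually_realPoint hH.eventually,
      eventually_realPoint hQ.eventually] with y h1 h2 h3 h4 h5
    ext v
    rw [h2]
    constructor
    · rintro ⟨hv, hw⟩
      obtain ⟨x, hx, rfl⟩ := h1.exists_eq hv
      exact ⟨x, (h1.mem_leviKernel_iff h3 h4 h5).2 ⟨hx, hw⟩, rfl⟩
    · rintro ⟨x, hx, rfl⟩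
      have := (h1.mem_leviKernel_iff h3 h4 h5).1 hx
      exact ⟨(h1.mem_iff h3).2 this.1, this.2⟩
  have hrank : ∀ᶠ q in 𝓝 p, Module.finrank ℂ (leviKernel H q) = 1 := by
    filter_upwards [hextK, hsrc, eventually_realPoint hK.finrank_eventually] with q h1 h2 h3
    rw [h1, hK1] at h3
    rw [← h3]
    exact (Submodule.equivMapOfInjective _ (chartDiff_bijective h2).1 _).finrank_eq
  have hinv' : ∀ᶠ q in 𝓝 p, ∀ X Y : CField d M, IsSectionNear H X q → IsSectionNear H Y q →
      cBracket X Y q ∈ H q := by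
    filter_upwards [hext, hsrc, eventually_realPoint hP.eventually, eventually_realPoint hinv]
      with q h1 h2 h3 h4 using (h1.involutive_iff h2 h3).2 h4
  have htr' : ∀ᶠ q in 𝓝 p, H q ⊓ barDist H q = ⊥ := by
    filter_upwards [hext, hsrc,
      eventually_realPoint (hH.eventually_inf_eq_bot hH.tau_toC htr)] with q h1 h2 h3
    exact (map_chartDiff_inf_τ h1 h2).1 h3
  have hnd' : ∀ᶠ q in 𝓝 p, IsTwoNondegenerateAt H q := by
    filter_upwards [hext, hextK.eventually, hsrc, eventually_realPoint hH.eventually,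
      eventually_realPoint hK.eventually, eventually_realPoint hP'.eventually, hrank,
      eventually_realPoint hnd] with q h1 h2 h3 h4 h5 h6 h7 h8
    refine (isTwoNondegenerateAt_iff h1 h2 h3 h4 h5 h6).2 ⟨fun h0 => ?_, h8⟩
    rw [h0, finrank_bot] at h7
    omega
  obtain ⟨X, hX⟩ := hH.exists_frame hHn
  have hfr : ∀ᶠ q in 𝓝 p, ∃ Y : Fin n → CField d M, (∀ i, RegularNear ω (Y i) q) ∧
      ∀ᶠ y in 𝓝 q, LinearIndependent ℂ (fun i => Y i y) ∧
        Submodule.span ℂ (Set.range fun i => Y i y) = H y := by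
    filter_upwards [hext, hsrc, eventually_realPoint hX.eventually] with q h1 h2 h3
      using h1.exists_frame h2 h3
  obtain ⟨U, hU, hUo, hpU⟩ := eventually_nhds_iff.1
    (hrank.and (hinv'.and (htr'.and (hnd'.and hfr))))
  exact ⟨H, U, hUo, hpU, ⟨fun q hq => (hU q hq).2.2.2.2, fun q hq => (hU q hq).2.2.1,
    fun q hq => (hU q hq).2.1⟩, fun q hq => (hU q hq).1, fun q hq => (hU q hq).2.2.2.1,
    ⟨hext.self_of_nhds, hextK, hH, hK, htr, hinv'⟩⟩

end Restriction

end LeviCR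

namespace LeviCR

set_option linter.unusedSectionVars false

/-! ### Factoring analytic maps through submersions. -/

section Factor

variable {E B G : Type*} [NormedAddCommGroup E] [NormedSpace ℂ E] [FiniteDimensional ℂ E]
  [CompleteSpace E] [NormedAddCommGroup B] [NormedSpace ℂ B] [FiniteDimensional ℂ B]
  [CompleteSpace B] [NormedAddCommGroup G] [NormedSpace ℂ G] [CompleteSpace G]

theorem eq_of_fderiv_apply_sub_eq_zero {f : E → G} {z₀ : E} {δ : ℝ} {x y : E}
    (hx : x ∈ Metric.ball z₀ δ) (hy : y ∈ Metric.ball z₀ δ)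
    (hf : ∀ z ∈ Metric.ball z₀ δ, DifferentiableAt ℂ f z)
    (hd : ∀ z ∈ Metric.ball z₀ δ, fderiv ℂ f z (y - x) = 0) : f x = f y := by
  let _ : NormedSpace ℝ E := NormedSpace.restrictScalars ℝ ℂ E
  have hseg : ∀ t ∈ Set.Icc (0 : ℝ) 1, x + (t : ℂ) • (y - x) ∈ Metric.ball z₀ δ := fun t ht => by
    have := (convex_ball z₀ δ).add_smul_sub_mem hx hy ht
    exact this
  let u : ℝ → E := fun t => x + (t : ℂ) • (y - x)
  have hu : ∀ t, HasDerivAt u (y - x) t := fun t => by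
    have h1 : HasDerivAt (fun t : ℝ => (t : ℂ) • (y - x)) ((1 : ℂ) • (y - x)) t :=
      (Complex.ofRealCLM.hasDerivAt (x := t)).smul_const (y - x)
    rw [one_smul] at h1
    exact h1.const_add x
  let _ : NormedSpace ℝ G := NormedSpace.restrictScalars ℝ ℂ G
  have hcomp : ∀ t ∈ Set.Icc (0 : ℝ) 1, HasDerivWithinAt (fun t => f (u t)) 0 (Set.Icc 0 1) t :=
    fun t ht => by
      have h1 := ((hf _ (hseg t ht)).hasFDerivAt.restrictScalars ℝ).comp_hasDerivAt t (hu t)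
      have h2 : ((fderiv ℂ f (u t)).restrictScalars ℝ) (y - x) = 0 := hd _ (hseg t ht)
      rw [h2] at h1
      exact h1.hasDerivWithinAt
  have := (convex_Icc (0 : ℝ) 1).norm_image_sub_le_of_norm_hasDerivWithin_le (C := 0) hcomp
    (fun t _ => by simp) (Set.left_mem_Icc.2 zero_le_one) (Set.right_mem_Icc.2 zero_le_one)
  rw [zero_mul, norm_le_zero_iff, sub_eq_zero] at this
  simpa [u] using this.symm

/-- An analytic map that is constant along the fibres of a submersion factors through it. -/
theorem exists_analytic_factor {f : E → G} {ρ : E → B} {z₀ : E} (hf : AnalyticAt ℂ f z₀)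
    (hρ : AnalyticAt ℂ ρ z₀) (hsurj : Function.Surjective (fderiv ℂ ρ z₀))
    (hker : ∀ᶠ z in 𝓝 z₀, ∀ v, fderiv ℂ ρ z v = 0 → fderiv ℂ f z v = 0) :
    ∃ g : B → G, AnalyticAt ℂ g (ρ z₀) ∧ ∀ᶠ z in 𝓝 z₀, f z = g (ρ z) := by
  set A := fderiv ℂ ρ z₀ with hA
  obtain ⟨T₀, hT₀⟩ := A.toLinearMap.exists_rightInverse_of_surjective
    (LinearMap.range_eq_top.2 hsurj)
  let T : B →L[ℂ] E := LinearMap.toContinuousLinearMap T₀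
  have hAT : ∀ b, A (T b) = b := fun b => LinearMap.congr_fun hT₀ b
  -- A chart in which `ρ` becomes the linear map `A`. In it `f` is constant along `ker A`, hence a
  -- function of `A (Φ z) = ρ z`.
  let Φ : E → E := fun z => z + T (ρ z - A z)
  have hΦ : AnalyticAt ℂ Φ z₀ :=
    analyticAt_id.fun_add ((T.analyticAt _).fun_comp (hρ.fun_sub (A.analyticAt _)))
  have hAΦ : ∀ z, A (Φ z) = ρ z := fun z => by
    simp only [Φ]
    rw [map_add, hAT, add_sub_cancel]
  have hΦ' : HasFDerivAt Φ ((ContinuousLinearEquiv.refl ℂ E : E ≃L[ℂ] E) : E →L[ℂ] E) z₀ := by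
    have h1 : HasFDerivAt Φ (ContinuousLinearMap.id ℂ E + T.comp (A - A)) z₀ :=
      (hasFDerivAt_id z₀).add (T.hasFDerivAt.comp z₀
        (hρ.differentiableAt.hasFDerivAt.sub A.hasFDerivAt))
    rw [sub_self, ContinuousLinearMap.comp_zero, add_zero] at h1
    exact h1
  have hc : ContDiffAt ℂ ω Φ z₀ := hΦ.contDiffAt
  let g := hc.localInverse hΦ' (by simp)
  have hg : AnalyticAt ℂ g (Φ z₀) := (hc.to_localInverse hΦ' (by simp)).analyticAt
  have hg0 : g (Φ z₀) = z₀ := hc.localInverse_apply_image hΦ' (by simp)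
  have hr : ∀ᶠ w in 𝓝 (Φ z₀), Φ (g w) = w :=
    (hc.hasStrictFDerivAt' hΦ' (by simp)).eventually_right_inverse
  have hl : ∀ᶠ z in 𝓝 z₀, g (Φ z) = z :=
    (hc.hasStrictFDerivAt' hΦ' (by simp)).eventually_left_inverse
  have hgc : ∀ {φ : E → Prop}, (∀ᶠ z in 𝓝 z₀, φ z) → ∀ᶠ w in 𝓝 (Φ z₀), φ (g w) := fun {φ} h =>
    hg.continuousAt.eventually (by rw [hg0]; exact h)
  have hfg : AnalyticAt ℂ (fun w => f (g w)) (Φ z₀) :=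
    AnalyticAt.fun_comp (by rw [hg0]; exact hf) hg
  have hflat : ∀ᶠ w in 𝓝 (Φ z₀), DifferentiableAt ℂ (fun w => f (g w)) w ∧
      ∀ c, A c = 0 → fderiv ℂ (fun w => f (g w)) w c = 0 := by
    filter_upwards [hr.eventually_nhds, hgc hker, hgc hf.eventually_analyticAt,
      hgc hρ.eventually_analyticAt, hg.eventually_analyticAt, hfg.eventually_analyticAt]
      with w h1 h2 h3 h4 h5 h6
    refine ⟨h6.differentiableAt, fun c hAc => ?_⟩
    have e1 : HasFDerivAt (fun w => ρ (g w)) A w := by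
      refine A.hasFDerivAt.congr_of_eventuallyEq ?_
      filter_upwards [h1] with w hw
      rw [← hAΦ, hw]
    have e2 : HasFDerivAt (fun w => ρ (g w)) ((fderiv ℂ ρ (g w)).comp (fderiv ℂ g w)) w :=
      h4.differentiableAt.hasFDerivAt.comp w h5.differentiableAt.hasFDerivAt
    have e3 : HasFDerivAt (fun w => f (g w)) ((fderiv ℂ f (g w)).comp (fderiv ℂ g w)) w :=
      h3.differentiableAt.hasFDerivAt.comp w h5.differentiableAt.hasFDerivAt
    rw [e3.fderiv]
    refine h2 _ ?_
    have := congrArg (fun L => L c) (e2.unique e1)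
    exact this.trans hAc
  obtain ⟨δ, hδ, hball⟩ := Metric.eventually_nhds_iff_ball.1 hflat
  -- An affine section of `A` through `Φ z₀`: `j (ρ z)` and `Φ z` differ by an element of `ker A`,
  -- so `f` takes the same value over both.
  let j : B → E := fun y => Φ z₀ + T (y - ρ z₀)
  have hj : AnalyticAt ℂ j (ρ z₀) :=
    analyticAt_const.fun_add ((T.analyticAt _).fun_comp (analyticAt_id.fun_sub analyticAt_const))
  have hj0 : j (ρ z₀) = Φ z₀ := by simp [j]
  refine ⟨fun y => f (g (j y)), AnalyticAt.fun_comp (f := j) (by rw [hj0]; exact hfg) hj, ?_⟩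
  have h1 : ∀ᶠ z in 𝓝 z₀, Φ z ∈ Metric.ball (Φ z₀) δ :=
    hΦ.continuousAt.eventually (Metric.ball_mem_nhds _ hδ)
  have h2 : ∀ᶠ z in 𝓝 z₀, j (ρ z) ∈ Metric.ball (Φ z₀) δ := by
    have : AnalyticAt ℂ (fun z => j (ρ z)) z₀ := hj.fun_comp hρ
    refine this.continuousAt.eventually ?_
    change ∀ᶠ y in 𝓝 (j (ρ z₀)), y ∈ Metric.ball (Φ z₀) δ
    rw [hj0]
    exact Metric.ball_mem_nhds _ hδ
  filter_upwards [h1, h2, hl] with z e1 e2 e3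
  have h3 : A (j (ρ z) - Φ z) = 0 := by
    simp only [j]
    rw [map_sub, map_add, hAΦ, hAΦ, hAT, add_sub_cancel, sub_self]
  have := eq_of_fderiv_apply_sub_eq_zero (f := fun w => f (g w)) e1 e2 (fun w hw => (hball w hw).1)
    (fun w hw => (hball w hw).2 _ h3)
  simp only [e3] at this
  exact this

end Factor

end LeviCR

namespace LeviCR

set_option linter.unusedSectionVars false

/-! ### Descent along Cauchy characteristics and involutive extensions. -/

section Rotation

variable {E B F : Type*} [NormedAddCommGroup E] [NormedSpace ℂ E] [FiniteDimensional ℂ E]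
  [CompleteSpace E] [NormedAddCommGroup B] [NormedSpace ℂ B] [FiniteDimensional ℂ B]
  [CompleteSpace B] [NormedAddCommGroup F] [NormedSpace ℂ F] [FiniteDimensional ℂ F]
  [CompleteSpace F]

/-- The normalised coframe of a distribution having `D` among its Cauchy characteristics descends
to the space of leaves of `D`. -/
theorem exists_descent {ρ : E → B} {P : E → E →L[ℂ] F} {D S : E → Submodule ℂ E} {z₀ : E}
    (hρ : AnalyticAt ℂ ρ z₀) (hρD : IsCoframeAt (fderiv ℂ ρ) D z₀) (hP : IsCoframeAt P S z₀)
    (hDS : ∀ᶠ z in 𝓝 z₀, D z ≤ S z)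
    (hch : ∀ᶠ z in 𝓝 z₀, ∀ v ∈ D z, ∀ w ∈ S z, curv P z v w = 0) :
    ∃ q : B → B →L[ℂ] F, AnalyticAt ℂ q (ρ z₀) ∧ Function.Surjective (q (ρ z₀)) ∧
      ∀ᶠ z in 𝓝 z₀, ∀ v, v ∈ S z ↔ q (ρ z) (fderiv ℂ ρ z v) = 0 := by
  obtain ⟨Q, T, hQ, hQT, hQS⟩ := exists_normalised_coframe hρD hP hDS
  -- For `v` in `D` the derivative of `Q` vanishes on the image of `S` (`e1`), since `v` is a Cauchy
  -- characteristic, and on the range of `T` (`e2`), since `Q T` is constantly the identity. These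
  -- two subspaces span the target of `ρ`.
  have hker : ∀ᶠ z in 𝓝 z₀, ∀ v, fderiv ℂ ρ z v = 0 → fderiv ℂ Q z v = 0 := by
    filter_upwards [hQS.eventually, hP.eventually, hch, hρ.eventually_analyticAt,
      hQ.eventually_analyticAt, hρD.eventually, hQT.eventually_nhds, hDS]
      with z h1 h2 h3 h4 h5 h6 h7 h8 v hv
    have hvD : v ∈ D z := (h6.mem_iff.self_of_nhds v).2 hv
    have e1 : ∀ w ∈ S z, fderiv ℂ Q z v (fderiv ℂ ρ z w) = 0 := fun w hw => by
      have := curv_eq_zero_of_le h1 h2 (Filter.Eventually.of_forall fun _ => le_rfl) (h8 hvD) hw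
        (h3 v hvD w hw)
      rwa [curv_comp_fderiv h4 h5 hv, neg_eq_zero] at this
    have e2 : ∀ f, fderiv ℂ Q z v (T f) = 0 := fun f => by
      have h9 : HasFDerivAt (fun w => Q w (T f)) ((fderiv ℂ Q z).flip (T f)) z := by
        have := h5.differentiableAt.hasFDerivAt.clm_apply (hasFDerivAt_const (T f) z)
        refine this.congr_fderiv ?_
        ext w
        simp
      have h10 : HasFDerivAt (fun w => Q w (T f)) (0 : E →L[ℂ] F) z :=
        (hasFDerivAt_const f z).congr_of_eventuallyEq (by filter_upwards [h7] with w hw using hw f)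
      exact congrArg (fun L : E →L[ℂ] F => L v) (h9.unique h10)
    ext b
    obtain ⟨w, hw⟩ := h6.surjective (b - T (Q z b))
    have hwS : w ∈ S z := by
      refine (h1.mem_iff.self_of_nhds w).2 ?_
      change Q z (fderiv ℂ ρ z w) = 0
      rw [hw, map_sub, h7.self_of_nhds, sub_self]
    have := e1 w hwS
    rw [hw, map_sub, e2, sub_zero] at this
    rw [this, zero_apply]
  obtain ⟨q, hq, hqQ⟩ := exists_analytic_factor hQ hρ hρD.surjective hker
  refine ⟨q, hq, ?_, ?_⟩
  · rw [← hqQ.self_of_nhds]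
    exact fun f => ⟨T f, hQT.self_of_nhds f⟩
  · filter_upwards [hQS.mem_iff, hqQ] with z h1 h2 v
    rw [h1, ← h2]
    rfl

/-- An involutive family `D` of Cauchy characteristics of `S` is contained in an involutive
distribution `D' ⊆ S` of one more dimension, with any prescribed value at the base point. -/
theorem exists_involutive_extension {A : E → E →L[ℂ] B} {P : E → E →L[ℂ] F}
    {D S : E → Submodule ℂ E} {z₀ : E} (hA : IsCoframeAt A D z₀) (hP : IsCoframeAt P S z₀)
    (hinv : ∀ᶠ z in 𝓝 z₀, ∀ v ∈ D z, ∀ w ∈ D z, curv A z v w = 0)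
    (hDS : ∀ᶠ z in 𝓝 z₀, D z ≤ S z)
    (hch : ∀ᶠ z in 𝓝 z₀, ∀ v ∈ D z, ∀ w ∈ S z, curv P z v w = 0) {u₀ : E} (hu : u₀ ∈ S z₀)
    (hu' : u₀ ∉ D z₀) :
    ∃ (D' : E → Submodule ℂ E) (m : ℕ) (P' : E → E →L[ℂ] (Fin m → ℂ)), IsCoframeAt P' D' z₀ ∧
      (∀ᶠ z in 𝓝 z₀, ∀ v ∈ D' z, ∀ w ∈ D' z, curv P' z v w = 0) ∧
      (∀ᶠ z in 𝓝 z₀, D z ≤ D' z) ∧ (∀ᶠ z in 𝓝 z₀, D' z ≤ S z) ∧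
      D' z₀ = D z₀ ⊔ Submodule.span ℂ {u₀} := by
  obtain ⟨ρ, hρ, hρD, -⟩ := frobenius hA hinv
  obtain ⟨q, hq, hqs, hqS⟩ := exists_descent hρ hρD hP hDS hch
  have hqD : IsCoframeAt q (fun y => (q y).toLinearMap.ker) (ρ z₀) :=
    ⟨hq, hqs, Filter.Eventually.of_forall fun y v => Iff.rfl⟩
  obtain ⟨η, hη, hη0⟩ := hqD.isDistAt.exists_sec (v := fderiv ℂ ρ z₀ u₀)
    ((hqS.self_of_nhds u₀).1 hu)
  have hne : η (ρ z₀) ≠ 0 := fun h0 =>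
    hu' ((hρD.mem_iff.self_of_nhds u₀).2 (hη0.symm.trans h0))
  -- On the leaf space of `D` a line field is involutive for free. Choosing one inside the descended
  -- distribution, with value the image of `u₀`, and pulling it back gives the extension.
  have hfr : IsFrameAt (fun _ : Fin 1 => η) (fun y => Submodule.span ℂ {η y}) (ρ z₀) :=
    ⟨fun _ => hη.1, linearIndependent_unique_iff.2 hne, Filter.Eventually.of_forall fun y => by
      rw [Set.range_const]⟩
  obtain ⟨m, p', hp'⟩ := hfr.isDistAt
  have hcont := hρ.continuousAt
  refine ⟨fun z => (Submodule.span ℂ {η (ρ z)}).comap (fderiv ℂ ρ z).toLinearMap, m,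
    pullForm ρ p', ⟨analyticAt_pullForm hp'.analyticAt hρ, ?_, ?_⟩, ?_, ?_, ?_, ?_⟩
  · exact hp'.surjective.comp hρD.surjective
  · filter_upwards [hcont.eventually hp'.mem_iff] with z hz v using hz _
  · filter_upwards [hcont.eventually hp'.analyticAt.eventually_analyticAt,
      hρ.eventually_analyticAt] with z h1 h2 v hv w hw
    rw [curv_pullForm h1.differentiableAt h2]
    obtain ⟨a, ha⟩ := Submodule.mem_span_singleton.1 (show fderiv ℂ ρ z v ∈ _ from hv)
    obtain ⟨b, hb⟩ := Submodule.mem_span_singleton.1 (show fderiv ℂ ρ z w ∈ _ from hw)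
    rw [← ha, ← hb, map_smul, map_smul, smul_apply, curv_self, smul_zero, smul_zero]
  · filter_upwards [hρD.mem_iff] with z hz v hv
    rw [Submodule.mem_comap, ContinuousLinearMap.coe_coe, (hz v).1 hv]
    exact zero_mem _
  · filter_upwards [hqS, hcont.eventually hη.2] with z h1 h2 v hv
    obtain ⟨a, ha⟩ := Submodule.mem_span_singleton.1 (show fderiv ℂ ρ z v ∈ _ from hv)
    have h3 : q (ρ z) (η (ρ z)) = 0 := h2
    rw [h1, ← ha, map_smul, h3, smul_zero]
  · ext v
    rw [Submodule.mem_comap, hη0, Submodule.mem_sup]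
    constructor
    · intro hv
      obtain ⟨a, ha⟩ := Submodule.mem_span_singleton.1 hv
      refine ⟨v - a • u₀, (hρD.mem_iff.self_of_nhds _).2 ?_, a • u₀,
        Submodule.smul_mem _ _ (Submodule.mem_span_singleton_self _), sub_add_cancel _ _⟩
      rw [map_sub, map_smul, ha]
      exact sub_self _
    · rintro ⟨e, he, y, hy, rfl⟩
      obtain ⟨a, rfl⟩ := Submodule.mem_span_singleton.1 hy
      have := (hρD.mem_iff.self_of_nhds e).1 he
      refine Submodule.mem_span_singleton.2 ⟨a, ?_⟩
      change _ = fderiv ℂ ρ z₀ (e + a • u₀)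
      rw [map_add, map_smul, this, zero_add]

end Rotation

end LeviCR

namespace LeviCR

set_option linter.unusedSectionVars false

/-! ### The kernel of a rank-one `ad K̄`. -/

section Exact

variable {d : ℕ} {M : Type*} [TopologicalSpace M] [ChartedSpace (RSpace d) M]
  [IsManifold (𝓡 d) ω M] {p : M} {H : CDist d M} {Hc Kc : CSpace d → Submodule ℂ (CSpace d)}
  {m : ℕ} {P : CSpace d → CSpace d →L[ℂ] (Fin m → ℂ)}

/-- If `ad K̄` is generated by an operator of rank one, its kernel is an involutive distribution
of corank one in `H`, consisting of Cauchy characteristics of `H ⊕ K̄`. -/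
theorem IsCRGerm.exists_cauchy_dist (h : IsCRGerm H p Hc Kc) (hn : IsTwoNondegenerateAt H p)
    (hK1 : Module.finrank ℂ (Kc (realPoint d p p)) = 1)
    (hP : IsCoframeAt P (fun z => Hc z ⊔ tauDist Kc z) (realPoint d p p))
    (hR : ∀ᶠ y in 𝓝 p, ¬ RankGtOne P Hc Kc (realPoint d p y)) :
    ∃ (D : CSpace d → Submodule ℂ (CSpace d)) (l : ℕ)
      (A : CSpace d → CSpace d →L[ℂ] (Fin l → ℂ) × ℂ) (V X : CSpace d),
      IsCoframeAt A D (realPoint d p p) ∧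
      (∀ᶠ z in 𝓝 (realPoint d p p), ∀ v ∈ D z, ∀ w ∈ D z, curv A z v w = 0) ∧
      (∀ᶠ z in 𝓝 (realPoint d p p), Kc z ≤ D z) ∧ (∀ᶠ z in 𝓝 (realPoint d p p), D z ≤ Hc z) ∧
      (∀ᶠ z in 𝓝 (realPoint d p p), ∀ v ∈ D z, ∀ w ∈ Hc z ⊔ tauDist Kc z, curv P z v w = 0) ∧
      V ∈ tauDist Kc (realPoint d p p) ∧ V ≠ 0 ∧ X ∈ Hc (realPoint d p p) ∧
      X ∉ D (realPoint d p p) ∧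
      (∀ v ∈ Hc (realPoint d p p), ∃ e ∈ D (realPoint d p p), ∃ c : ℂ, v = e + c • X) := by
  set z₀ := realPoint d p p with hz₀
  have hsz : star z₀ = z₀ := star_toC _
  have hnd := ((isTwoNondegenerateAt_iff h.ext_H h.ext_K (mem_chart_source _ p) h.dist_H h.dist_K
    hP).1 hn).2
  obtain ⟨⟨k, hk⟩, hk0, -⟩ := finrank_eq_one_iff'.1 hK1
  have hkτ : star k ∈ tauDist Kc z₀ := by rwa [mem_tauDist, star_star, hsz]
  have hkne : star k ≠ 0 := fun h0 => hk0 (Subtype.ext (star_eq_zero.1 h0))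
  obtain ⟨x, hx, hkx⟩ := hnd _ hkτ hkne
  obtain ⟨V, hV, hV0⟩ := h.dist_K.tau_toC.exists_sec hkτ
  obtain ⟨X, hX, hX0⟩ := h.dist_H.exists_sec hx
  -- One nonzero coordinate of `Ω(V, X)` suffices: `D` is cut out of `H` by the scalar form `a`, the
  -- `i`-th coordinate of `Ω(V, ·)`. A scalar form makes `D` a distribution of corank one in `H`
  -- irrespective of the rank hypothesis.
  obtain ⟨i, hi⟩ := Function.ne_iff.1 hkx
  obtain ⟨l, R, hRH⟩ := h.dist_H
  let a : CSpace d → CSpace d →L[ℂ] ℂ := fun z =>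
    (ContinuousLinearMap.proj (R := ℂ) (φ := fun _ : Fin m => ℂ) i).comp (curv P z (V z))
  have ha_apply : ∀ z w, a z w = curv P z (V z) w i := fun _ _ => rfl
  have ha : AnalyticAt ℂ a z₀ :=
    analyticAt_clm_comp analyticAt_const (analyticAt_clm_apply (analyticAt_curv hP.analyticAt) hV.1)
  have haX : a z₀ x ≠ 0 := by rw [ha_apply, hV0]; exact hi
  have haX' : ∀ᶠ z in 𝓝 z₀, a z (X z) ≠ 0 :=
    (analyticAt_clm_apply ha hX.1).continuousAt.eventually_ne (by rw [hX0]; exact haX)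
  have hVne : ∀ᶠ z in 𝓝 z₀, V z ≠ 0 := hV.1.continuousAt.eventually_ne (by rwa [hV0])
  let A : CSpace d → CSpace d →L[ℂ] (Fin l → ℂ) × ℂ := fun z => (R z).prod (a z)
  let D : CSpace d → Submodule ℂ (CSpace d) := fun z => (A z).toLinearMap.ker
  have hmemD : ∀ z v, v ∈ D z ↔ R z v = 0 ∧ a z v = 0 := fun z v => Prod.mk_eq_zero
  have hA : IsCoframeAt A D z₀ := by
    refine ⟨analyticAt_clm_prod hRH.analyticAt ha, fun ⟨f, c⟩ => ?_,
      Filter.Eventually.of_forall fun z v => Iff.rfl⟩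
    obtain ⟨w, hw⟩ := hRH.surjective f
    have hRx : R z₀ x = 0 := (hRH.mem_iff.self_of_nhds x).1 hx
    refine ⟨w + ((c - a z₀ w) / a z₀ x) • x, Prod.ext ?_ ?_⟩
    · change R z₀ _ = f
      rw [map_add, map_smul, hRx, smul_zero, add_zero, hw]
    · change a z₀ _ = c
      rw [map_add, map_smul, smul_eq_mul, div_mul_cancel₀ _ haX, add_sub_cancel]
  have hDH : ∀ᶠ z in 𝓝 z₀, D z ≤ Hc z := by
    filter_upwards [hRH.mem_iff] with z hz v hv using (hz v).2 ((hmemD z v).1 hv).1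
  have hKD : ∀ᶠ z in 𝓝 z₀, Kc z ≤ D z := by
    filter_upwards [hRH.mem_iff, h.K_le_H, h.curv_D_of_le hP h.D_le_S, hV.2] with z h1 h2 h3 h4 v hv
    refine (hmemD z v).2 ⟨(h1 v).1 (h2 hv), ?_⟩
    rw [ha_apply, h3 _ (Submodule.mem_sup_right h4) v (Submodule.mem_sup_left hv), Pi.zero_apply]
  -- At real points `Ω(V, w)` and `Ω(V, X)` are dependent. The `i`-th coordinate of the first
  -- vanishes and that of the second does not, so the whole vector `Ω(V, w)` vanishes. The identity
  -- theorem extends this off the real points.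
  have hexact : ∀ᶠ z in 𝓝 z₀, ∀ v ∈ tauDist Kc z, ∀ w ∈ D z, curv P z v w = 0 := by
    refine curv_eq_zero_of_real hP.analyticAt h.dist_K.tau_toC hA.isDistAt
      (eventually_toC_of_realPoint
        (φ := fun z => ∀ v ∈ tauDist Kc z, ∀ w ∈ D z, curv P z v w = 0) ?_)
    filter_upwards [hR, eventually_realPoint haX', eventually_realPoint hVne,
      eventually_realPoint hV.2, eventually_realPoint hX.2, eventually_realPoint hDH,
      eventually_realPoint h.dist_K.finrank_eventually] with y h1 h2 h3 h4 h5 h6 h7 _ v hv w hw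
    have h8 : Module.finrank ℂ (Kc (star (realPoint d p y))) = 1 := by
      rw [realPoint, star_toC]
      exact h7.trans hK1
    obtain ⟨c, rfl⟩ := finrank_tauDist Kc _ h8 h4 h3 hv
    have h9 : ¬ LinearIndependent ℂ ![curv P (realPoint d p y) (V (realPoint d p y)) w,
        curv P (realPoint d p y) (V (realPoint d p y)) (X (realPoint d p y))] :=
      fun hli => h1 ⟨_, h4, _, h6 hw, _, h5, hli⟩
    rw [LinearIndependent.pair_iff] at h9
    push Not at h9
    obtain ⟨s, t, hst, hne⟩ := h9
    have haw : curv P (realPoint d p y) (V (realPoint d p y)) w i = 0 := ((hmemD _ w).1 hw).2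
    have ht : t = 0 := by
      have := congrFun hst i
      simp only [Pi.add_apply, Pi.smul_apply, haw, Pi.zero_apply, smul_eq_mul,
        mul_zero, zero_add] at this
      exact (mul_eq_zero.1 this).resolve_right h2
    have hs : s ≠ 0 := fun hs => hne hs ht
    rw [ht, zero_smul, add_zero, smul_eq_zero] at hst
    rw [map_smul, smul_apply, hst.resolve_left hs, smul_zero]
  have hch : ∀ᶠ z in 𝓝 z₀, ∀ v ∈ D z, ∀ w ∈ Hc z ⊔ tauDist Kc z, curv P z v w = 0 := by
    filter_upwards [hexact, hDH, h.curv_H_of_le hP (Filter.Eventually.of_forall fun z => le_sup_left)]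
      with z h1 h2 h3 v hv w hw
    obtain ⟨b, hb, c, hc, rfl⟩ := Submodule.mem_sup.1 hw
    rw [map_add, h3 v (h2 hv) b hb, zero_add, curv_swap, h1 c hc v hv, neg_zero]
  have hDS : ∀ᶠ z in 𝓝 z₀, D z ≤ Hc z ⊔ tauDist Kc z := by
    filter_upwards [hDH] with z hz using hz.trans le_sup_left
  refine ⟨D, l, A, star k, x, hA, ?_, hKD, hDH, hch, hkτ, hkne, hx, fun hxD => ?_, fun v hv => ?_⟩
  -- Involutivity of `D`: a bracket stays in `H` because `H` is involutive, and it is annihilated by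
  -- `Ω(V, ·)` because brackets of Cauchy characteristics are Cauchy characteristics of `H ⊕ K̄`.
  · filter_upwards [lieBracket_cauchy hP hDS hch, hA.eventually, h.curv_H hRH, hRH.eventually,
      hDH.eventually_nhds, hV.2] with z h1 h2 h3 h4 h5 h6 v hv w hw
    obtain ⟨Y, hY, rfl⟩ := h2.isDistAt.exists_sec hv
    obtain ⟨Z, hZ, rfl⟩ := h2.isDistAt.exists_sec hw
    refine (h2.lieBracket_mem_iff hY hZ).1 ((hmemD _ _).2 ⟨?_, ?_⟩)
    · rw [h4.apply_lieBracket (hY.mono h5) (hZ.mono h5)]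
      exact h3 _ (h5.self_of_nhds hv) _ (h5.self_of_nhds hw)
    · rw [ha_apply, curv_swap, (h1 Y Z hY hZ).2 _ (Submodule.mem_sup_right h6), neg_zero,
        Pi.zero_apply]
  · exact haX ((hmemD _ _).1 hxD).2
  · have hRx := (hRH.mem_iff.self_of_nhds x).1 hx
    have hRv := (hRH.mem_iff.self_of_nhds v).1 hv
    refine ⟨v - (a z₀ v / a z₀ x) • x, (hmemD _ _).2 ⟨?_, ?_⟩, a z₀ v / a z₀ x,
      (sub_add_cancel _ _).symm⟩
    · rw [map_sub, map_smul, hRx, hRv, smul_zero, sub_zero]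
    · rw [map_sub, map_smul, smul_eq_mul, div_mul_cancel₀ _ haX, sub_self]

end Exact

end LeviCR

namespace LeviCR

set_option linter.unusedSectionVars false

/-! ### A second CR structure in the rank-one case. -/

section Rotate

theorem finrank_tauDist_eventually {d : ℕ} {S : CSpace d → Submodule ℂ (CSpace d)}
    {x : RSpace d} (hS : IsDistAt S (toC d x)) :
    ∀ᶠ z in 𝓝 (toC d x), Module.finrank ℂ (tauDist S z) = Module.finrank ℂ (S (toC d x)) := by
  obtain ⟨X, hX⟩ := hS.exists_frame rfl
  have h1 : IsFrameAt _ (tauDist S) (toC d x) := IsFrameAt.tau (X := X) (by rwa [star_toC])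
  filter_upwards [hS.tau_toC.finrank_eventually] with z hz
  rw [hz, h1.finrank_eq, Fintype.card_fin]

variable {d : ℕ} {M : Type*} [TopologicalSpace M] [ChartedSpace (RSpace d) M]
  [IsManifold (𝓡 d) ω M] {p : M} {H : CDist d M} {Hc Kc : CSpace d → Submodule ℂ (CSpace d)}
  {m : ℕ} {P : CSpace d → CSpace d →L[ℂ] (Fin m → ℂ)}

/-- If `ad K̄` is generated by an operator of rank one, there is a second holomorphic distribution
with the same sums `H ⊕ K̄` and `H ⊕ H̄`. -/
theorem IsCRGerm.exists_rotation (h : IsCRGerm H p Hc Kc) (hn : IsTwoNondegenerateAt H p)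
    (hK1 : Module.finrank ℂ (Kc (realPoint d p p)) = 1)
    (hP : IsCoframeAt P (fun z => Hc z ⊔ tauDist Kc z) (realPoint d p p))
    (hR : ∀ᶠ y in 𝓝 p, ¬ RankGtOne P Hc Kc (realPoint d p y)) :
    ∃ (Hc' : CSpace d → Submodule ℂ (CSpace d)) (l : ℕ)
      (P' : CSpace d → CSpace d →L[ℂ] (Fin l → ℂ)), IsCoframeAt P' Hc' (realPoint d p p) ∧
      (∀ᶠ z in 𝓝 (realPoint d p p), ∀ v ∈ Hc' z, ∀ w ∈ Hc' z, curv P' z v w = 0) ∧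
      Module.finrank ℂ (Hc' (realPoint d p p)) = Module.finrank ℂ (Hc (realPoint d p p)) ∧
      Hc' (realPoint d p p) ⊓ tauDist Hc' (realPoint d p p) = ⊥ ∧
      (∀ᶠ z in 𝓝 (realPoint d p p), Kc z ≤ Hc' z) ∧
      (∀ᶠ z in 𝓝 (realPoint d p p), Hc' z ⊔ tauDist Kc z = Hc z ⊔ tauDist Kc z) ∧
      (∀ᶠ z in 𝓝 (realPoint d p p), Hc' z ⊔ tauDist Hc' z = Hc z ⊔ tauDist Hc z) ∧
      Hc' (realPoint d p p) ≠ Hc (realPoint d p p) := by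
  obtain ⟨D, _, A, V, X, hA, hinv, hKD, hDH, hch, hV, hV0, hX, hXD, hspan⟩ :=
    h.exists_cauchy_dist hn hK1 hP hR
  set z₀ := realPoint d p p with hz₀
  have hsz : star z₀ = z₀ := star_toC _
  have hDH₀ := hDH.self_of_nhds
  have hKD₀ := hKD.self_of_nhds
  have hVH : V ∉ Hc z₀ := fun hVH => hV0 ((Submodule.eq_bot_iff _).1 h.inf_τK V ⟨hVH, hV⟩)
  have huH : X + V ∉ Hc z₀ := fun hu => hVH ((Submodule.add_mem_iff_right _ hX).1 hu)
  have huS : X + V ∈ Hc z₀ ⊔ tauDist Kc z₀ := Submodule.add_mem_sup hX hV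
  -- The new distribution is `D ⊕ ⟨X + V⟩` at the base point instead of `H = D ⊕ ⟨X⟩`; tilting `X`
  -- by `V` in `K̄` leaves `H` but not `H ⊕ K̄`.
  obtain ⟨Hc', l, P', hP', hinv', hDH', hHS', hH'₀⟩ := exists_involutive_extension hA hP hinv
    (hDH.mono fun z hz => hz.trans le_sup_left) hch huS fun hu => huH (hDH₀ hu)
  have hfin : Module.finrank ℂ (Hc' z₀) = Module.finrank ℂ (Hc z₀) := by
    have e : Hc z₀ = D z₀ ⊔ Submodule.span ℂ {X} := by
      refine le_antisymm (fun v hv => ?_)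
        (sup_le hDH₀ ((Submodule.span_singleton_le_iff_mem _ _).2 hX))
      obtain ⟨e, he, c, rfl⟩ := hspan v hv
      exact Submodule.add_mem_sup he
        (Submodule.smul_mem _ _ (Submodule.mem_span_singleton_self X))
    rw [e, hH'₀, Submodule.finrank_sup_span_singleton fun hu => huH (hDH₀ hu),
      Submodule.finrank_sup_span_singleton hXD]
  have hsV : star V ∈ D z₀ := hKD₀ (by rw [mem_tauDist, hsz] at hV; exact hV)
  have hτ : ∀ v, v ∈ Hc z₀ → star v ∈ Hc z₀ → v = 0 := fun v h1 h2 =>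
    (Submodule.eq_bot_iff _).1 h.transversal v ⟨h1, by rwa [SetLike.mem_coe, mem_tauDist, ← hz₀, hsz]⟩
  have hcoef : ∀ e ∈ D z₀, ∀ e' ∈ D z₀, ∀ c c' : ℂ,
      star (e + c • (X + V)) = e' + c' • (X + V) → c = 0 := fun e he e' he' c c' hee' => by
    -- The conjugate of `V` is in `K ⊆ D`, so this vector is in `H`; by `hee'` its conjugate has the
    -- same form and is in `H` too. Transversality of `H` makes it zero, and then `c X` lies in `D`,
    -- so `c = 0`.
    have h1 : e + c • X - star c' • star V = 0 := by
      refine hτ _ (sub_mem (add_mem (hDH₀ he) (Submodule.smul_mem _ _ hX))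
        (Submodule.smul_mem _ _ (hDH₀ hsV))) ?_
      have h2 : star (e + c • X - star c' • star V) = e' + c' • X - star c • star V := by
        have : star (e + c • X - star c' • star V) =
            star (e + c • (X + V)) - star c • star V - c' • V := by
          simp only [star_add, star_sub, star_smul, star_star, smul_add]
          abel
        rw [this, hee', smul_add]
        abel
      rw [h2]
      exact sub_mem (add_mem (hDH₀ he') (Submodule.smul_mem _ _ hX))
        (Submodule.smul_mem _ _ (hDH₀ hsV))
    by_contra hc
    refine hXD ((Submodule.smul_mem_iff _ hc).1 ?_)
    have h3 : c • X = star c' • star V - e := by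
      rw [eq_sub_iff_add_eq, ← sub_eq_zero, ← h1]
      abel
    rw [h3]
    exact sub_mem (Submodule.smul_mem _ _ hsV) he
  have htr : Hc' z₀ ⊓ tauDist Hc' z₀ = ⊥ := by
    refine (Submodule.eq_bot_iff _).2 fun w ⟨hw, hw'⟩ => ?_
    rw [SetLike.mem_coe, mem_tauDist, hsz] at hw'
    rw [SetLike.mem_coe] at hw
    rw [hH'₀] at hw hw'
    obtain ⟨e, he, y, hy, rfl⟩ := Submodule.mem_sup.1 hw
    obtain ⟨c, rfl⟩ := Submodule.mem_span_singleton.1 hy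
    obtain ⟨e', he', y', hy', hee'⟩ := Submodule.mem_sup.1 hw'
    obtain ⟨c', rfl⟩ := Submodule.mem_span_singleton.1 hy'
    have hc := hcoef e he e' he' c c' hee'.symm
    have hc' := hcoef e' he' e he c' c (by rw [hee', star_star])
    rw [hc, zero_smul, add_zero] at hee' ⊢
    rw [hc', zero_smul, add_zero] at hee'
    exact hτ e (hDH₀ he) (hee' ▸ hDH₀ he')
  have hKH' : ∀ᶠ z in 𝓝 z₀, Kc z ≤ Hc' z := by
    filter_upwards [hKD, hDH'] with z h1 h2 using h1.trans h2
  have hdist' := hP'.isDistAt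
  have hf : ∀ᶠ z in 𝓝 z₀, Module.finrank ℂ (Hc' z) = Module.finrank ℂ (Hc z) := by
    filter_upwards [hdist'.finrank_eventually, h.dist_H.finrank_eventually] with z h1 h2
    rw [h1, h2, hfin]
  have hfτ : ∀ᶠ z in 𝓝 z₀, Module.finrank ℂ (tauDist Hc' z) = Module.finrank ℂ (tauDist Hc z) := by
    filter_upwards [finrank_tauDist_eventually hdist', finrank_tauDist_eventually h.dist_H]
      with z h1 h2
    rw [h1, h2]
    exact hfin
  have htr' := hdist'.eventually_inf_eq_bot hdist'.tau_toC htr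
  have htrH := h.dist_H.eventually_inf_eq_bot h.dist_H.tau_toC h.transversal
  -- The two sum identities need only one inclusion each, since the summands are transversal and of
  -- equal dimensions.
  have hfsup : ∀ {S S' T T' : Submodule ℂ (CSpace d)}, S ⊓ T = ⊥ → S' ⊓ T' = ⊥ →
      Module.finrank ℂ S = Module.finrank ℂ S' → Module.finrank ℂ T = Module.finrank ℂ T' →
      S ⊔ T ≤ S' ⊔ T' → S ⊔ T = S' ⊔ T' := fun {S S' T T'} h1 h2 h3 h4 h5 => by
    refine Submodule.eq_of_le_of_finrank_eq h5 ?_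
    have e1 := Submodule.finrank_sup_add_finrank_inf_eq S T
    have e2 := Submodule.finrank_sup_add_finrank_inf_eq S' T'
    rw [h1, finrank_bot] at e1
    rw [h2, finrank_bot] at e2
    omega
  refine ⟨Hc', l, P', hP', hinv', hfin, htr, hKH', ?_, ?_, fun heq => huH ?_⟩
  · filter_upwards [hf, htr', htrH, eventually_star_toC hKH', h.τK_le_τH, hHS']
      with z h1 h2 h3 h4 h5 h6
    exact hfsup (le_bot_iff.1 ((inf_le_inf_left _ (tauDist_mono h4)).trans h2.le))
      (le_bot_iff.1 ((inf_le_inf_left _ h5).trans h3.le)) h1 rfl (sup_le h6 le_sup_right)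
  · have hHC : ∀ᶠ z in 𝓝 z₀, Hc' z ≤ Hc z ⊔ tauDist Hc z := by
      filter_upwards [hHS', h.S_le_C] with z h1 h2 using h1.trans h2
    filter_upwards [hf, hfτ, htr', htrH, hHC, eventually_star_toC hHC] with z h1 h2 h3 h4 h5 h6
    refine hfsup h3 h4 h1 h2 (sup_le h5 ?_)
    rw [← IsCRGerm.tauDist_C]
    exact tauDist_mono h6
  · rw [← heq, hH'₀]
    exact Submodule.mem_sup_right (Submodule.mem_span_singleton_self _)

/-- The second distribution restricts to a CR structure. -/
theorem IsCRGerm.exists_other_CRStructure {n : ℕ} (h : IsCRGerm H p Hc Kc)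
    (hn : IsTwoNondegenerateAt H p) (hHn : Module.finrank ℂ (Hc (realPoint d p p)) = n)
    (hK1 : Module.finrank ℂ (Kc (realPoint d p p)) = 1)
    (hP : IsCoframeAt P (fun z => Hc z ⊔ tauDist Kc z) (realPoint d p p))
    (hR : ∀ᶠ y in 𝓝 p, ¬ RankGtOne P Hc Kc (realPoint d p y)) :
    ∃ (Hc' : CSpace d → Submodule ℂ (CSpace d)) (H' : CDist d M) (U : Set M), IsOpen U ∧ p ∈ U ∧
      IsCRStructureOn n H' U ∧ (∀ q ∈ U, Module.finrank ℂ (leviKernel H' q) = 1) ∧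
      (∀ q ∈ U, IsTwoNondegenerateAt H' q) ∧ IsCRGerm H' p Hc' Kc ∧
      Module.finrank ℂ (Hc' (realPoint d p p)) = n ∧
      (∀ᶠ z in 𝓝 (realPoint d p p), Hc' z ⊔ tauDist Kc z = Hc z ⊔ tauDist Kc z) ∧
      (∀ᶠ z in 𝓝 (realPoint d p p), Hc' z ⊔ tauDist Hc' z = Hc z ⊔ tauDist Hc z) ∧
      Hc' (realPoint d p p) ≠ Hc (realPoint d p p) := by
  obtain ⟨Hc', l, P', hP', hinv, hfin, htr, hKH', hS, hC, hne⟩ := h.exists_rotation hn hK1 hP hR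
  obtain ⟨r, Q, hQ⟩ := h.dist_C
  have hQ' : IsCoframeAt Q (fun z => Hc' z ⊔ tauDist Hc' z) (realPoint d p p) :=
    hQ.congr (hC.mono fun z hz => hz.symm)
  have hPS : IsCoframeAt P (fun z => Hc' z ⊔ tauDist Kc z) (realPoint d p p) :=
    hP.congr (hS.mono fun z hz => hz.symm)
  -- The Cauchy characteristics of `H' ⊕ H̄' = H ⊕ H̄` at real points are `K ⊕ K̄`. The Levi kernel
  -- of `H'` is their intersection with `H'`, and this is `K` because `K ⊆ H'`, `K̄ ⊆ H̄'` and `H' ∩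
  -- H̄' = 0`.
  have hker : ∀ᶠ y in 𝓝 p, ∀ v, v ∈ Kc (realPoint d p y) ↔ v ∈ Hc' (realPoint d p y) ∧
      ∀ w ∈ tauDist Hc' (realPoint d p y), curv Q (realPoint d p y) v w = 0 := by
    have hdist' := hP'.isDistAt
    filter_upwards [eventually_realPoint hKH', eventually_realPoint (h.curv_K_C hQ),
      eventually_realPoint hC, h.mem_D_of_curv_C hQ, eventually_realPoint hinv,
      eventually_realPoint hP'.eventually, eventually_realPoint hQ'.eventually,
      eventually_realPoint (hdist'.eventually_inf_eq_bot hdist'.tau_toC htr),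
      eventually_realPoint (eventually_star_toC hKH')] with y h1 h2 h3 h4 h5 h6 h7 h8 h9 v
    constructor
    · exact fun hv => ⟨h1 hv, fun w hw => h2 v hv w (h3 ▸ Submodule.mem_sup_right hw)⟩
    · rintro ⟨hv, hvw⟩
      have h10 := h4 v (h3 ▸ Submodule.mem_sup_left hv) fun w hw => by
        rw [← h3] at hw
        obtain ⟨a, ha, b, hb, rfl⟩ := Submodule.mem_sup.1 hw
        rw [map_add, hvw b hb, add_zero]
        exact curv_eq_zero_of_le h7 h6 (Filter.Eventually.of_forall fun z => le_sup_left) hv ha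
          (h5 v hv a ha)
      obtain ⟨a, ha, b, hb, rfl⟩ := Submodule.mem_sup.1 h10
      have hb' : b ∈ Hc' (realPoint d p y) := (Submodule.add_mem_iff_right _ (h1 ha)).1 hv
      rw [(Submodule.eq_bot_iff _).1 h8 b ⟨hb', tauDist_mono h9 hb⟩, add_zero]
      exact ha
  -- Writing `X = w + b` with `w` in `H'` and `b` in `K̄`, the `b`-part is invisible to the
  -- curvature with `V`, because `K ⊕ K̄` is isotropic; so `w` detects `V` as `X` does.
  have hnd : ∀ᶠ z in 𝓝 (realPoint d p p), ∀ v ∈ tauDist Kc z, v ≠ 0 →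
      ∃ w ∈ Hc' z, curv P z v w ≠ 0 := by
    have hnd₀ := ((isTwoNondegenerateAt_iff h.ext_H h.ext_K (mem_chart_source _ p) h.dist_H
      h.dist_K hP).1 hn).2
    have hsz : star (realPoint d p p) = realPoint d p p := star_toC _
    obtain ⟨⟨k, hk⟩, hk0, -⟩ := finrank_eq_one_iff'.1 hK1
    have hkτ : star k ∈ tauDist Kc (realPoint d p p) := by rwa [mem_tauDist, star_star, hsz]
    have hkne : star k ≠ 0 := fun h0 => hk0 (Subtype.ext (star_eq_zero.1 h0))
    obtain ⟨x, hx, hkx⟩ := hnd₀ _ hkτ hkne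
    obtain ⟨V, hV, hV0⟩ := h.dist_K.tau_toC.exists_sec hkτ
    obtain ⟨X, hX, hX0⟩ := h.dist_H.exists_sec hx
    have h1 : ∀ᶠ z in 𝓝 (realPoint d p p), curv P z (V z) (X z) ≠ 0 :=
      (analyticAt_clm_apply (analyticAt_clm_apply (analyticAt_curv hP.analyticAt) hV.1)
        hX.1).continuousAt.eventually_ne (by rw [hV0, hX0]; exact hkx)
    filter_upwards [h1, hV.2, hX.2, hS, h.curv_D_of_le hP h.D_le_S,
      eventually_star_toC h.dist_K.finrank_eventually] with z h1 h2 h3 h4 h5 h6 v hv hv0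
    have hVne : V z ≠ 0 := fun h0 => h1 (by rw [h0, map_zero, zero_apply])
    obtain ⟨c, rfl⟩ := finrank_tauDist Kc z (h6.trans hK1) h2 hVne hv
    have hXS : X z ∈ Hc' z ⊔ tauDist Kc z := h4 ▸ Submodule.mem_sup_left h3
    obtain ⟨w, hw, b, hb, hwb⟩ := Submodule.mem_sup.1 hXS
    refine ⟨w, hw, fun h0 => ?_⟩
    have hc : c ≠ 0 := fun hc => hv0 (by rw [hc, zero_smul])
    rw [map_smul, smul_apply, smul_eq_zero] at h0
    refine h1 ?_
    rw [← hwb, map_add, h0.resolve_left hc, zero_add]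
    exact h5 _ (Submodule.mem_sup_right h2) _ (Submodule.mem_sup_right hb)
  obtain ⟨H', U, hU, hpU, hH', hr, hn', hg⟩ := exists_CRStructureOn_of_holomorphic p hP'.isDistAt
    h.dist_K (hfin.trans hHn) hK1 htr hP' hQ' hPS hinv hker hnd
  exact ⟨Hc', H', U, hU, hpU, hH', hr, hn', hg, hfin.trans hHn, hS, hC, hne⟩

end Rotate

end LeviCR

namespace LeviCR

set_option linter.unusedSectionVars false

/-! ### Failure of recoverability where the rank is one; the open dense set. -/

section Necessity

theorem map_sup_of_le_ker {E F : Type*} [AddCommGroup E] [Module ℂ E] [AddCommGroup F]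
    [Module ℂ F] {f : E →ₗ[ℂ] F} {T : Submodule ℂ E} (hT : T ≤ f.ker) (S : Submodule ℂ E) :
    (S ⊔ T).map f = S.map f := by
  rw [Submodule.map_sup, LinearMap.le_ker_iff_map.1 hT, sup_bot_eq]

variable {d : ℕ} {M : Type*} [TopologicalSpace M] [ChartedSpace (RSpace d) M]
  [IsManifold (𝓡 d) ω M] {p : M} {H : CDist d M} {Hc Kc : CSpace d → Submodule ℂ (CSpace d)}
  {m : ℕ} {P : CSpace d → CSpace d →L[ℂ] (Fin m → ℂ)}

/-- The witnessing vectors extend to holomorphic sections, and linear independence of two curvature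
values is an open condition. -/
theorem RankGtOne.eventually {x : RSpace d} (hP : AnalyticAt ℂ P (toC d x))
    (hH : IsDistAt Hc (toC d x)) (hK : IsDistAt Kc (toC d x))
    (h : RankGtOne P Hc Kc (toC d x)) : ∀ᶠ z in 𝓝 (toC d x), RankGtOne P Hc Kc z := by
  obtain ⟨v, hv, w₁, hw₁, w₂, hw₂, hli⟩ := h
  obtain ⟨V, hV, rfl⟩ := hK.tau_toC.exists_sec hv
  obtain ⟨X, hX, rfl⟩ := hH.exists_sec hw₁
  obtain ⟨Y, hY, rfl⟩ := hH.exists_sec hw₂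
  have hcV := analyticAt_clm_apply (analyticAt_curv hP) hV.1
  have hc : ContinuousAt (fun z => ![curv P z (V z) (X z), curv P z (V z) (Y z)]) (toC d x) := by
    refine continuousAt_pi.2 fun i => ?_
    fin_cases i
    · exact (analyticAt_clm_apply hcV hX.1).continuousAt
    · exact (analyticAt_clm_apply hcV hY.1).continuousAt
  filter_upwards [hc.eventually (isOpen_setOfPred_linearIndependent.mem_nhds hli), hV.2, hX.2, hY.2]
    with z h1 h2 h3 h4 using ⟨_, h2, _, h3, _, h4, h1⟩

theorem LeviLeafSpace.dlc_eq {n r k : ℕ} {M' : Type*} [TopologicalSpace M']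
    [ChartedSpace (RSpace d) M'] [IsManifold (𝓡 d) ω M'] {H' : CDist d M'} {U : Set M}
    {U' : Set M'} {p' : M'} (R : LeviLeafSpace n r k H U p) (R' : LeviLeafSpace n r k H' U' p')
    (hW : R'.W = R.W) (hπ : R'.π = R.π)
    (hC : ∀ q ∈ R.W, R'.Hc q ⊔ tauDist R'.Hc q = R.Hc q ⊔ tauDist R.Hc q)
    (hm : ∀ q ∈ R.W, R'.jMinus q = R.jMinus q) (hp : ∀ q ∈ R.W, R'.jPlus q = R.jPlus q) :
    R.dlc = R'.dlc := by
  simp only [LeviLeafSpace.dlc, DLCData.mk.injEq, hW, hπ, true_and]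
  refine ⟨funext fun γ => ?_, funext fun γ => ?_, funext fun γ => ?_, trivial⟩
  · exact iSup_congr fun q => iSup_congr fun hq => by rw [hC q hq.1]
  · ext L
    exact exists_congr fun q => and_congr_right fun hq => by rw [hm q hq]
  · ext L
    exact exists_congr fun q => and_congr_right fun hq => by rw [hp q hq]

/-- `K̄` lies in the kernel of `dπ`. So `J⁻` sees `H` only through `H ⊕ K̄`, which the second CR
structure shares. -/
theorem LeviLeafSpace.jMinus_eq {n r k : ℕ} {U : Set M} (R : LeviLeafSpace n r k H U p)
    {q : CSpace d} (hq : q ∈ R.W) :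
    R.jMinus q = (R.Hc q ⊔ tauDist R.Kc q).map (fderiv ℂ R.π q).toLinearMap :=
  (map_sup_of_le_ker (le_sup_right.trans (R.ker_π q hq).ge) _).symm

theorem LeviLeafSpace.jPlus_eq {n r k : ℕ} {U : Set M} (R : LeviLeafSpace n r k H U p)
    {q : CSpace d} (hq : q ∈ R.W) :
    R.jPlus q = (tauDist (fun z => R.Hc z ⊔ tauDist R.Kc z) q).map (fderiv ℂ R.π q).toLinearMap := by
  rw [tauDist_sup, tauDist_tauDist, map_sup_of_le_ker (le_sup_left.trans (R.ker_π q hq).ge)]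
  rfl

/-- The second CR structure on a neighbourhood of `p` has the same Levi kernel, so both structures
can be given leaf spaces with one domain and one projection. There `J⁻`, `J⁺` and the contact
distribution coincide, while the two structures differ at `p`. -/
theorem not_isRecoverableAt_of_rank_le_one {n : ℕ} {M : Type*} [TopologicalSpace M]
    [ChartedSpace (RSpace (2 * n + 1)) M] [IsManifold (𝓡 (2 * n + 1)) ω M]
    {H : CDist (2 * n + 1) M} {p : M} (hn : IsTwoNondegenerateAt H p)
    {Hc Kc : CSpace (2 * n + 1) → Submodule ℂ (CSpace (2 * n + 1))} (h : IsCRGerm H p Hc Kc)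
    (hHn : Module.finrank ℂ (Hc (realPoint (2 * n + 1) p p)) = n)
    (hK1 : Module.finrank ℂ (Kc (realPoint (2 * n + 1) p p)) = 1) {m : ℕ}
    {P : CSpace (2 * n + 1) → CSpace (2 * n + 1) →L[ℂ] (Fin m → ℂ)}
    (hP : IsCoframeAt P (fun z => Hc z ⊔ tauDist Kc z) (realPoint (2 * n + 1) p p))
    (hR : ∀ᶠ y in 𝓝 p, ¬ RankGtOne P Hc Kc (realPoint (2 * n + 1) p y)) :
    ¬ IsRecoverableAt n H p := by
  intro hrec
  obtain ⟨Hc', H', U, hU, hpU, hH', hr', hn', h', hHn', hS, hC, hne⟩ :=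
    h.exists_other_CRStructure hn hHn hK1 hP hR
  obtain ⟨k, Q, hQ⟩ := h.dist_D
  obtain ⟨π, hπ, hπD, hbox⟩ := exists_submersion_box (star_toC _) hQ (h.curv_D hQ)
    (fun z => by rw [tauDist_sup, tauDist_tauDist, sup_comm])
  obtain ⟨N, hN, hW⟩ := h.exists_leafSpace hn hHn hK1 hπ hπD (U := Set.univ) Filter.univ_mem
  obtain ⟨N', hN', hW'⟩ := h'.exists_leafSpace (hn' p hpU) hHn' hK1 hπ hπD (hU.mem_nhds hpU)
  obtain ⟨W, hWs, hWb⟩ := hbox _ (Filter.inter_mem (Filter.inter_mem hN hN') (hS.and hC))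
  obtain ⟨R, rfl, rfl, rfl, rfl⟩ := hW W (fun z hz => (hWs hz).1.1) hWb
  obtain ⟨R', hR'W, rfl, hR'K, hR'π⟩ := hW' R.W (fun z hz => (hWs hz).1.2) hWb
  have hm : ∀ q ∈ R.W, R'.jMinus q = R.jMinus q := fun q hq => by
    have h1 : R'.Hc q ⊔ tauDist R.Kc q = R.Hc q ⊔ tauDist R.Kc q := (hWs hq).2.1
    rw [R.jMinus_eq hq, R'.jMinus_eq (hR'W ▸ hq), hR'K, hR'π, h1]
  have hp : ∀ q ∈ R.W, R'.jPlus q = R.jPlus q := fun q hq => by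
    have h1 : R'.Hc (star q) ⊔ tauDist R.Kc (star q) = R.Hc (star q) ⊔ tauDist R.Kc (star q) :=
      (hWs (R.star_mem q hq)).2.1
    have h2 : tauDist (fun z => R'.Hc z ⊔ tauDist R.Kc z) q =
        tauDist (fun z => R.Hc z ⊔ tauDist R.Kc z) q :=
      le_antisymm (tauDist_mono h1.le) (tauDist_mono h1.ge)
    rw [R.jPlus_eq hq, R'.jPlus_eq (hR'W ▸ hq), hR'K, hR'π, h2]
  have hdlc := R.dlc_eq R' hR'W hR'π (fun q hq => (hWs hq).2.2) hm hp
  -- The canonical maps are equal, so the identity is an admissible `G`; recoverability at the base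
  -- point would give `H = H'` there.
  have key := hrec M H' U p 1 k hU hpU hH' hr' hn' R R' hdlc id analyticAt_id
    (by rw [fderiv_id]; exact Function.bijective_id) rfl ?_
  · have := key.self_of_nhds
    rw [fderiv_id] at this
    exact hne (this.symm.trans (Submodule.map_id _))
  · filter_upwards [R.isOpen_W.mem_nhds R.base_mem] with q hq
    simp only [LeviLeafSpace.canonicalMap, id, hm q hq, hp q hq, hR'π]

/-- The set of all points where the condition holds is open by `RankGtOne.eventually`. If some
neighbourhood of a point `p` missed it, the rank condition would fail throughout that neighbourhood
and the germ at `p` would not be recoverable. -/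
theorem exists_dense_of_isRecoverable (n : ℕ) {M : Type*} [TopologicalSpace M]
    [ChartedSpace (RSpace (2 * n + 1)) M] [IsManifold (𝓡 (2 * n + 1)) ω M]
    (H : CDist (2 * n + 1) M) (hH : IsCRStructureOn n H Set.univ)
    (hK : ∀ p : M, Module.finrank ℂ (leviKernel H p) = 1)
    (h2 : ∀ p : M, IsTwoNondegenerateAt H p) (hrec : IsRecoverable n H) :
    ∃ O : Set M, IsOpen O ∧ Dense O ∧ ∀ p ∈ O,
      ∃ A : HmodK H p →ₗ[ℂ] HbarModKbar H p,
        adKbar H p = Submodule.span ℂ {A} ∧ 1 < Module.finrank ℂ A.range := by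
  set S : Set M := {p | ∃ A : HmodK H p →ₗ[ℂ] HbarModKbar H p,
    adKbar H p = Submodule.span ℂ {A} ∧ 1 < Module.finrank ℂ A.range} with hSdef
  have hgerm : ∀ p : M, ∃ Hc Kc m, ∃ P : CSpace (2 * n + 1) → CSpace (2 * n + 1) →L[ℂ] (Fin m → ℂ),
      IsCRGerm H p Hc Kc ∧ Module.finrank ℂ (Hc (realPoint (2 * n + 1) p p)) = n ∧
      Module.finrank ℂ (Kc (realPoint (2 * n + 1) p p)) = 1 ∧
      IsCoframeAt P (fun z => Hc z ⊔ tauDist Kc z) (realPoint (2 * n + 1) p p) ∧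
      ∀ᶠ q in 𝓝 p, q ∈ S ↔ RankGtOne P Hc Kc (realPoint (2 * n + 1) p q) := fun p => by
    obtain ⟨Hc, Kc, h, hHn, hK1⟩ := hH.exists_germ (p := p) Filter.univ_mem
      (Filter.Eventually.of_forall hK)
    obtain ⟨m, P, hP⟩ := h.dist_S
    exact ⟨Hc, Kc, m, P, h, hHn, hK1, hP,
      h.rankGtOne_iff (Filter.Eventually.of_forall hK) hP⟩
  have hSopen : IsOpen S := isOpen_iff_mem_nhds.2 fun p hp => by
    obtain ⟨Hc, Kc, m, P, h, -, -, hP, hiff⟩ := hgerm p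
    filter_upwards [hiff, eventually_realPoint (RankGtOne.eventually hP.analyticAt h.dist_H
      h.dist_K (hiff.self_of_nhds.1 hp))] with q h1 h2 using h1.2 h2
  refine ⟨S, hSopen, fun p => mem_closure_iff_nhds.2 fun U hU => ?_, fun p hp => hp⟩
  by_contra hdis
  obtain ⟨Hc, Kc, m, P, h, hHn, hK1, hP, hiff⟩ := hgerm p
  refine not_isRecoverableAt_of_rank_le_one (h2 p) h hHn hK1 hP ?_ (hrec p)
  filter_upwards [hiff, hU] with q h1 h2 h3 using hdis ⟨q, h2, h1.2 h3⟩

end Necessity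

end LeviCR

open LeviCR in
theorem mainTheorem6 (n : ℕ) {M : Type u} [TopologicalSpace M]
    [ChartedSpace (RSpace (2 * n + 1)) M] [IsManifold (𝓡 (2 * n + 1)) ω M]
    (H : CDist (2 * n + 1) M)
    (hH : IsCRStructureOn n H Set.univ)
    (hK : ∀ p : M, Module.finrank ℂ (leviKernel H p) = 1)
    (h2 : ∀ p : M, IsTwoNondegenerateAt H p) :
    IsRecoverable n H ↔
      ∃ O : Set M, IsOpen O ∧ Dense O ∧ ∀ p ∈ O,
        ∃ A : HmodK H p →ₗ[ℂ] HbarModKbar H p,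
          adKbar H p = Submodule.span ℂ {A} ∧ 1 < Module.finrank ℂ A.range := by
  exact ⟨exists_dense_of_isRecoverable n H hH hK h2,
    fun ⟨_, _, hO, hA⟩ => isRecoverable_of_dense n H hH hK hO hA⟩
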